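/- Let $\mathbb{T}=[-\pi,\pi]$ with periodic boundary conditions. For an integer $s\ge 1$ let $H^s=\{f\in L^2(\mathbb{T};\mathbb{R}) : \partial_x^s f\in L^2(\mathbb{T};\mathbb{R})\}$ (weak derivatives), with norm $\|f\|_{H^s}^2=\|f\|_{L^2}^2+\|\partial_x^s f\|_{L^2}^2$. Let $\nu,\gamma>0$, and let $(u_0,v_0)\in H^3\times H^4$ satisfy $\int_{\mathbb{T}}u_0\,dx=\int_{\mathbb{T}}v_0\,dx=0$. Then there are a time $T_{\max}>0$ and a unique solution $$(u,v)\in C([0,T_{\max});H^3\times H^4)$$ of the initial value problem $$\partial_t u+3u\,\partial_x u=-6v^2\,\partial_x v-\gamma v\,\partial_x^3 v+\nu\,\partial_x^2 u,$$ $$\partial_t v-6v\,\partial_x v=\gamma\,\partial_x^3 v+\partial_x(uv),$$ $$u(x,0)=u_0(x),\qquad v(x,0)=v_0(x),\qquad x\in\mathbb{T}.$$ Here a solution on $[0,T)$ is a pair $(u,v)\in C([0,T);H^3\times H^4)$ that attains the initial data, is differentiable in time as an $L^2\times L^2$-valued curve (one-sidedly at $t=0$), and satisfies the two equations almost everywhere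 on $\mathbb{T}$ for every $t\in[0,T)$. Uniqueness means that, for every $0<T\le T_{\max}$, each solution on $[0,T)$ with the data $(u_0,v_0)$ coincides with $(u,v)$ on $[0,T)$. -/

import Mathlib

open MeasureTheory Set
open scoped Real ContDiff

noncomputable section

namespace BurgersKdV

instance fact_two_pi_pos : Fact (0 < 2 * π) := ⟨Real.two_pi_pos⟩

/-- The one-dimensional torus of length `2π`; its `volume` has total mass `2π`. -/
abbrev Torus : Type := AddCircle (2 * π)

/-- The real Lebesgue space `L²` of the torus. -/
abbrev L2 : Type := Lp ℝ 2 (volume : Measure Torus)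

/-- `g` is the weak derivative of order `k` of `f` on the torus: both are integrable, and
`∫ f ∂ₓᵏφ = (-1)ᵏ ∫ g φ` for all smooth `2π`-periodic `φ`. -/
def IsWeakDeriv (k : ℕ) (f g : Torus → ℝ) : Prop :=
  Integrable f ∧ Integrable g ∧
    ∀ φ : ℝ → ℝ, ContDiff ℝ ∞ φ → Function.Periodic φ (2 * π) →
      ∫ x in (-π)..π, f (x : Torus) * iteratedDeriv k φ x =
        (-1) ^ k * ∫ x in (-π)..π, g (x : Torus) * φ x

lemma integrable_L2 (f : L2) : Integrable f :=
  (Lp.memLp f).integrable (by norm_num)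

lemma measurePreserving_coe :
    MeasurePreserving (fun x : ℝ => (x : Torus)) (volume.restrict (Ioc (-π) π)) volume := by
  have h := AddCircle.measurePreserving_mk (2 * π) (-π)
  have e : -π + 2 * π = π := by ring
  rwa [e] at h

lemma intervalIntegrable_mul {f : Torus → ℝ} (hf : Integrable f) {φ : ℝ → ℝ}
    (hφ : Continuous φ) :
    IntervalIntegrable (fun x : ℝ => f (x : Torus) * φ x) volume (-π) π := by
  have h : IntervalIntegrable (fun x : ℝ => f (x : Torus)) volume (-π) π := by
    rw [intervalIntegrable_iff_integrableOn_Ioc_of_le (by linarith [Real.pi_pos])]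
    exact measurePreserving_coe.integrable_comp_of_integrable hf
  exact h.mul_continuousOn hφ.continuousOn

lemma IsWeakDeriv.congr {k : ℕ} {f f' g g' : Torus → ℝ} (h : IsWeakDeriv k f g)
    (hf : f =ᵐ[volume] f') (hg : g =ᵐ[volume] g') : IsWeakDeriv k f' g' := by
  have key : ∀ {a b : Torus → ℝ}, a =ᵐ[volume] b → ∀ ψ : ℝ → ℝ,
      ∫ x in (-π)..π, a (x : Torus) * ψ x = ∫ x in (-π)..π, b (x : Torus) * ψ x := by
    intro a b hab ψ
    have hle : -π ≤ π := by linarith [Real.pi_pos]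
    rw [intervalIntegral.integral_of_le hle, intervalIntegral.integral_of_le hle]
    refine integral_congr_ae ?_
    filter_upwards [measurePreserving_coe.quasiMeasurePreserving.ae_eq_comp hab] with x hx
    simp only [Function.comp_apply] at hx
    rw [hx]
  refine ⟨h.1.congr hf, h.2.1.congr hg, fun φ hφ hp => ?_⟩
  rw [← key hf, ← key hg]
  exact h.2.2 φ hφ hp

lemma IsWeakDeriv.add {k : ℕ} {f f' g g' : Torus → ℝ} (h : IsWeakDeriv k f g)
    (h' : IsWeakDeriv k f' g') : IsWeakDeriv k (f + f') (g + g') := by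
  refine ⟨h.1.add h'.1, h.2.1.add h'.2.1, fun φ hφ hp => ?_⟩
  have c : Continuous (iteratedDeriv k φ) := hφ.continuous_iteratedDeriv k (by exact_mod_cast le_top)
  simp only [Pi.add_apply, add_mul]
  rw [intervalIntegral.integral_add (intervalIntegrable_mul h.1 c) (intervalIntegrable_mul h'.1 c),
    intervalIntegral.integral_add (intervalIntegrable_mul h.2.1 hφ.continuous)
      (intervalIntegrable_mul h'.2.1 hφ.continuous), h.2.2 φ hφ hp, h'.2.2 φ hφ hp, mul_add]

lemma IsWeakDeriv.smul {k : ℕ} {f g : Torus → ℝ} (c : ℝ) (h : IsWeakDeriv k f g) :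
    IsWeakDeriv k (c • f) (c • g) := by
  refine ⟨h.1.smul c, h.2.1.smul c, fun φ hφ hp => ?_⟩
  simp only [Pi.smul_apply, smul_eq_mul, mul_assoc, intervalIntegral.integral_const_mul]
  rw [h.2.2 φ hφ hp]
  ring

/-- The Sobolev space `Hˢ = {f ∈ L² : ∂ₓˢ f ∈ L²}` of the torus, with `f` stored together with its
(unique) weak derivative `∂ₓˢ f`, so that the norm inherited from the `ℓ²` product is
`‖f‖² = ‖f‖²_{L²} + ‖∂ₓˢ f‖²_{L²}`. -/
def Sobolev (s : ℕ) : Submodule ℝ (WithLp 2 (L2 × L2)) where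
  carrier := {p | IsWeakDeriv s p.fst p.snd}
  zero_mem' := by
    have h : IsWeakDeriv s 0 0 :=
      ⟨integrable_zero _ _ _, integrable_zero _ _ _, fun φ _ _ => by simp⟩
    exact h.congr (Lp.coeFn_zero ℝ 2 _).symm (Lp.coeFn_zero ℝ 2 _).symm
  add_mem' := fun {p q} hp hq =>
    (IsWeakDeriv.add hp hq).congr (Lp.coeFn_add p.fst q.fst).symm (Lp.coeFn_add p.snd q.snd).symm
  smul_mem' := fun c p hp =>
    (IsWeakDeriv.smul c hp).congr (Lp.coeFn_smul c p.fst).symm (Lp.coeFn_smul c p.snd).symm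

/-- The `L²` function underlying an element of `Hˢ`. -/
def toL2 {s : ℕ} (f : Sobolev s) : L2 := f.1.fst

/-- `(u, v)` is a solution in `C([0,T); H³ × H⁴)`, with initial data `(u₀, v₀)`, of
`∂ₜu + 3u ∂ₓu = -6v² ∂ₓv - γ v ∂ₓ³v + ν ∂ₓ²u`,  `∂ₜv - 6v ∂ₓv = γ ∂ₓ³v + ∂ₓ(uv)`.
The time derivatives are derivatives of `L²`-valued curves (one-sided at `t = 0`), the space
derivatives are weak derivatives, and the equations hold a.e. on the torus at every `t ∈ [0,T)`. -/
structure IsSolution (ν γ : ℝ) (u₀ : Sobolev 3) (v₀ : Sobolev 4) (T : ℝ)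
    (u : ℝ → Sobolev 3) (v : ℝ → Sobolev 4) : Prop where
  continuousOn_u : ContinuousOn u (Ico 0 T)
  continuousOn_v : ContinuousOn v (Ico 0 T)
  initial_u : u 0 = u₀
  initial_v : v 0 = v₀
  equation : ∀ t ∈ Ico 0 T, ∃ ut vt ux uxx vx vxxx uvx : L2,
    HasDerivWithinAt (fun τ => toL2 (u τ)) ut (Ico 0 T) t ∧
    HasDerivWithinAt (fun τ => toL2 (v τ)) vt (Ico 0 T) t ∧
    IsWeakDeriv 1 (toL2 (u t)) ux ∧
    IsWeakDeriv 2 (toL2 (u t)) uxx ∧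
    IsWeakDeriv 1 (toL2 (v t)) vx ∧
    IsWeakDeriv 3 (toL2 (v t)) vxxx ∧
    IsWeakDeriv 1 (fun x => toL2 (u t) x * toL2 (v t) x) uvx ∧
    (∀ᵐ x : Torus, ut x + 3 * toL2 (u t) x * ux x =
      -6 * toL2 (v t) x ^ 2 * vx x - γ * toL2 (v t) x * vxxx x + ν * uxx x) ∧
    (∀ᵐ x : Torus, vt x - 6 * toL2 (v t) x * vx x = γ * vxxx x + uvx x)

end BurgersKdV

end

open MeasureTheory Set
open scoped Real ContDiff

noncomputable section

namespace BurgersKdV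

open AddMonoidAlgebra ComplexConjugate

/-! ### Real trigonometric polynomials -/

/-! Both equations lose derivatives at top order, and the losses cancel. Put `p = ∂³u` and `r =
∂⁴v`. Up to terms costing at most one derivative of `p`, the coupling `-γ v ∂³v` contributes
`-γ⟨∂²p, v r⟩` to the growth of `‖p‖²/2`, and `∂(uv)` contributes `⟨r, v ∂²p⟩` to that of `‖r‖²/2`.
Weighting the `v`-part of the energy by `γ` removes both. What is left is at most linear in `‖∂p‖`
and is absorbed by the viscosity; `γ ∂³v` is skew, and the transport terms `u ∂r`, `v ∂r` are
integrated by parts. This is `exists_energy_le`. The same cancellation at a lower level, between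
`-γ⟨w, v₁ ∂³z⟩` and `γ⟨∂z, ∂²(v₁ w)⟩` for differences `w`, `z` of two states, gives stability in `L²
× H¹`: `exists_stability_le`.

Existence is by Galerkin truncation, with a lifespan independent of the number of modes
(`exists_isGalerkin`). Continuity in time with values in `H³ × H⁴` requires convergence in the top
norm, which rests on two facts. The energy estimate survives a high-pass Fourier multiplier at the
price of an error `δ²`, so the high frequencies stay small uniformly in time and in the number of
modes (`exists_tailEnergy_le`). The low frequencies converge by stability (`exists_lowEnergy_le`),
because a solution with `N` modes solves every larger Galerkin system up to `O(1/N)`. Together they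
give `isGalerkin_cauchy`, and the limit satisfies the equations by `exists_tendsto_field`.

For uniqueness, Fourier truncations of an arbitrary solution solve the Galerkin system up to
`O(1/N)` (`exists_isApprox_of_isSolution`); the stability estimate bounds the difference of two of
them by `O(1/N)`, and `N → ∞`.

All estimates are made on real trigonometric polynomials, a commutative ring with a derivation on
which integration by parts is exact. Products are bounded by the sum of the absolute values of the
coefficients of one factor, which the `H¹` norm controls (`norm_mul_le_wiener`, `exists_wiener_le`).
-/

/-- The conjugation `∑ c_k e^{ikx} ↦ ∑ conj c_k e^{-ikx}` of Laurent polynomials. -/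
def conjHom : AddMonoidAlgebra ℂ ℤ →+* AddMonoidAlgebra ℂ ℤ :=
  (mapDomainRingHom ℂ (negAddMonoidHom : ℤ →+ ℤ)).comp (mapRingHom ℤ (starRingEnd ℂ))

lemma coeff_conjHom (f : AddMonoidAlgebra ℂ ℤ) (k : ℤ) :
    (conjHom f).coeff k = conj (f.coeff (-k)) := by
  induction f using AddMonoidAlgebra.induction_linear with
  | zero => simp
  | add x y hx hy => simp [hx, hy]
  | single m r =>
    simp only [conjHom, RingHom.comp_apply, mapRingHom_single, mapDomainRingHom_apply,
      mapDomain_single, coeff_single, Finsupp.single_apply]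
    by_cases h : -m = k
    · subst h; simp
    · have h' : ¬ m = -k := fun e => h (by omega)
      simp [h, h']

/-- Laurent polynomials invariant under conjugation. -/
def realLaurent : Subalgebra ℝ (AddMonoidAlgebra ℂ ℤ) where
  carrier := {f | conjHom f = f}
  mul_mem' {a b} ha hb := by
    simp only [mem_ofPred_eq] at *
    rw [map_mul, ha, hb]
  add_mem' {a b} ha hb := by
    simp only [mem_ofPred_eq] at *
    rw [map_add, ha, hb]
  algebraMap_mem' r := by
    refine AddMonoidAlgebra.ext (Finsupp.ext fun k => ?_)
    rw [coeff_conjHom]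
    simp only [AddMonoidAlgebra.coe_algebraMap, Function.comp_apply, coeff_single,
      Finsupp.single_apply]
    by_cases h : k = 0
    · subst h; simp
    · have h1 : ¬ (0 : ℤ) = -k := by omega
      have h2 : ¬ (0 : ℤ) = k := by omega
      simp [h1, h2]

/-- Real trigonometric polynomials, given by their Fourier coefficients. -/
def TrigPoly : Type := realLaurent

namespace TrigPoly

instance : CommRing TrigPoly := inferInstanceAs (CommRing realLaurent)
instance : Algebra ℝ TrigPoly := inferInstanceAs (Algebra ℝ realLaurent)

/-- The underlying Laurent polynomial. -/
def toLaurent (f : TrigPoly) : AddMonoidAlgebra ℂ ℤ := f.1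

/-- Fourier coefficients. -/
def co (f : TrigPoly) (k : ℤ) : ℂ := f.toLaurent.coeff k

/-- The finite set of frequencies. -/
def supp (f : TrigPoly) : Finset ℤ := f.toLaurent.coeff.support

lemma mem_supp {f : TrigPoly} {k : ℤ} : k ∈ f.supp ↔ f.co k ≠ 0 := by
  simp [supp, co]

lemma co_eq_zero {f : TrigPoly} {k : ℤ} (h : k ∉ f.supp) : f.co k = 0 := by
  by_contra h'; exact h (mem_supp.2 h')

@[ext] lemma ext {f g : TrigPoly} (h : ∀ k, f.co k = g.co k) : f = g :=
  Subtype.ext (AddMonoidAlgebra.ext (Finsupp.ext h))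

@[simp] lemma co_add (f g : TrigPoly) (k : ℤ) : (f + g).co k = f.co k + g.co k := rfl
@[simp] lemma co_zero (k : ℤ) : (0 : TrigPoly).co k = 0 := rfl
@[simp] lemma co_smul (c : ℝ) (f : TrigPoly) (k : ℤ) : (c • f).co k = c * f.co k := rfl

@[simp] lemma co_neg (f : TrigPoly) (k : ℤ) : (-f).co k = - f.co k := by
  have := co_add f (-f) k
  rw [add_neg_cancel, co_zero] at this
  linear_combination -this

@[simp] lemma co_sub (f g : TrigPoly) (k : ℤ) : (f - g).co k = f.co k - g.co k := by
  rw [sub_eq_add_neg, co_add, co_neg, sub_eq_add_neg]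

lemma co_conj (f : TrigPoly) (k : ℤ) : f.co (-k) = conj (f.co k) := by
  have h : conjHom f.toLaurent = f.toLaurent := f.2
  have := coeff_conjHom f.toLaurent (-k)
  rw [h, neg_neg] at this
  exact this

lemma co_mul (f g : TrigPoly) (k : ℤ) :
    (f * g).co k = ∑ j ∈ g.supp, f.co (k - j) * g.co j := by
  have := AddMonoidAlgebra.coeff_mul_apply_right f.toLaurent g.toLaurent k
  simp only [sub_eq_add_neg]
  exact this

lemma co_mul_of_subset (f g : TrigPoly) (k : ℤ) {s : Finset ℤ} (hs : g.supp ⊆ s) :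
    (f * g).co k = ∑ j ∈ s, f.co (k - j) * g.co j := by
  rw [co_mul]
  refine Finset.sum_subset hs fun j _ hj => ?_
  rw [co_eq_zero hj, mul_zero]

/-- The trigonometric polynomial with given finitely supported coefficients. -/
def ofCo (c : ℤ →₀ ℂ) (h : ∀ k, c (-k) = conj (c k)) : TrigPoly :=
  ⟨AddMonoidAlgebra.ofCoeff c, AddMonoidAlgebra.ext (Finsupp.ext fun k => by
    rw [coeff_conjHom, AddMonoidAlgebra.coeff_ofCoeff, h, Complex.conj_conj])⟩

@[simp] lemma co_ofCo (c : ℤ →₀ ℂ) (h : ∀ k, c (-k) = conj (c k)) (k : ℤ) :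
    (ofCo c h).co k = c k := rfl

/-- Fourier multiplier operators preserving real functions. -/
def mult (m : ℤ → ℂ) (hm : ∀ k, m (-k) = conj (m k)) : TrigPoly →ₗ[ℝ] TrigPoly where
  toFun f := ofCo (Finsupp.onFinset f.supp (fun k => m k * f.co k)
    (fun _ hk => mem_supp.2 (right_ne_zero_of_mul hk)))
    (fun _ => by simp [hm, co_conj])
  map_add' f g := by ext k; simp [mul_add]
  map_smul' c f := by ext k; simp; ring

@[simp] lemma co_mult (m : ℤ → ℂ) (hm : ∀ k, m (-k) = conj (m k)) (f : TrigPoly) (k : ℤ) :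
    (mult m hm f).co k = m k * f.co k := rfl

/-- The derivative. -/
def D : TrigPoly →ₗ[ℝ] TrigPoly := mult (fun k => Complex.I * k) (by simp)

@[simp] lemma co_D (f : TrigPoly) (k : ℤ) : (D f).co k = Complex.I * k * f.co k := rfl

lemma supp_D_subset (f : TrigPoly) : (D f).supp ⊆ f.supp := fun _ hk =>
  mem_supp.2 (right_ne_zero_of_mul (mem_supp.1 hk))

@[simp] lemma D_mul (f g : TrigPoly) : D (f * g) = D f * g + f * D g := by
  ext k
  rw [co_D, co_add, co_mul, co_mul, co_mul_of_subset f (D g) k (supp_D_subset g), Finset.mul_sum,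
    ← Finset.sum_add_distrib]
  refine Finset.sum_congr rfl fun j _ => ?_
  simp only [co_D]
  push_cast
  ring

/-- Multipliers with an even real symbol. -/
def evenMult (q : ℕ → ℝ) : TrigPoly →ₗ[ℝ] TrigPoly := mult (fun k => (q k.natAbs : ℂ)) (by simp)

@[simp] lemma co_evenMult (q : ℕ → ℝ) (f : TrigPoly) (k : ℤ) :
    (evenMult q f).co k = q k.natAbs * f.co k := rfl

lemma supp_evenMult_subset (q : ℕ → ℝ) (f : TrigPoly) : (evenMult q f).supp ⊆ f.supp :=
  fun _ hk => mem_supp.2 (right_ne_zero_of_mul (mem_supp.1 hk))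

lemma evenMult_D (q : ℕ → ℝ) (f : TrigPoly) : evenMult q (D f) = D (evenMult q f) := by
  ext k; simp; ring

lemma evenMult_comm (q r : ℕ → ℝ) (f : TrigPoly) :
    evenMult q (evenMult r f) = evenMult r (evenMult q f) := by
  ext k; simp; ring

/-! ### The `L²` inner product -/

/-- Reality gives `f.co (-j) = conj (f.co j)`, which turns the convolution at frequency zero into
the Hermitian pairing: Parseval's identity. -/
lemma co_mul_zero (f g : TrigPoly) {s : Finset ℤ} (hs : g.supp ⊆ s) :
    ((f * g).co 0) = ∑ j ∈ s, conj (f.co j) * g.co j := by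
  rw [co_mul_of_subset f g 0 hs]
  refine Finset.sum_congr rfl fun j _ => ?_
  rw [zero_sub, co_conj]

lemma co_mul_self_zero (f : TrigPoly) {s : Finset ℤ} (hs : f.supp ⊆ s) :
    ((f * f).co 0).re = ∑ j ∈ s, ‖f.co j‖ ^ 2 := by
  rw [co_mul_zero f f hs, Complex.re_sum]
  refine Finset.sum_congr rfl fun j _ => ?_
  rw [mul_comm, Complex.mul_conj, Complex.ofReal_re, Complex.normSq_eq_norm_sq]

/-- The normalised `L²` inner product. -/
@[reducible] def innerCore : InnerProductSpace.Core ℝ TrigPoly where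
  inner f g := ((f * g).co 0).re
  conj_inner_symm f g := by simp [mul_comm]
  re_inner_nonneg f := by
    simp only [RCLike.re_to_real]
    rw [co_mul_self_zero f subset_rfl]
    positivity
  add_left f g h := by simp [add_mul]
  smul_left f g c := by simp
  definite f h := by
    rw [co_mul_self_zero f subset_rfl] at h
    ext k
    by_cases hk : k ∈ f.supp
    · have := (Finset.sum_eq_zero_iff_of_nonneg (fun _ _ => by positivity)).1 h k hk
      simpa using this
    · simpa using co_eq_zero hk

instance : NormedAddCommGroup TrigPoly := innerCore.toNormedAddCommGroup
instance : InnerProductSpace ℝ TrigPoly := InnerProductSpace.ofCore innerCore.toCore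

open scoped InnerProductSpace

lemma inner_def (f g : TrigPoly) : ⟪f, g⟫_ℝ = ((f * g).co 0).re := rfl

lemma norm_sq_eq (f : TrigPoly) {s : Finset ℤ} (hs : f.supp ⊆ s) :
    ‖f‖ ^ 2 = ∑ j ∈ s, ‖f.co j‖ ^ 2 := by
  rw [← real_inner_self_eq_norm_sq, inner_def, co_mul_self_zero f hs]

lemma inner_mul_left (f g h : TrigPoly) : ⟪f * g, h⟫_ℝ = ⟪g, f * h⟫_ℝ := by
  rw [inner_def, inner_def]; congr 2; ring

/-- A derivative has mean zero, since its symbol vanishes at `k = 0`; this is applied to the product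
`f * g`. -/
lemma inner_D_left (f g : TrigPoly) : ⟪D f, g⟫_ℝ = - ⟪f, D g⟫_ℝ := by
  have h : (D (f * g)).co 0 = 0 := by rw [co_D]; simp
  rw [D_mul, co_add] at h
  have := congrArg Complex.re h
  rw [inner_def, inner_def]
  simp only [Complex.add_re, Complex.zero_re] at this
  linarith

lemma inner_D_right (f g : TrigPoly) : ⟪f, D g⟫_ℝ = - ⟪D f, g⟫_ℝ := by
  rw [inner_D_left, neg_neg]

lemma inner_D_self (f : TrigPoly) : ⟪f, D f⟫_ℝ = 0 := by
  have := inner_D_left f f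
  rw [real_inner_comm] at this
  linarith

lemma inner_evenMult_left (q : ℕ → ℝ) (f g : TrigPoly) :
    ⟪evenMult q f, g⟫_ℝ = ⟪f, evenMult q g⟫_ℝ := by
  rw [inner_def, inner_def, co_mul_zero _ _ subset_rfl,
    co_mul_zero _ _ (supp_evenMult_subset q g)]
  congr 1
  refine Finset.sum_congr rfl fun j _ => ?_
  simp; ring

/-- Comparison of `L²` norms through coefficients. -/
lemma norm_sq_le_of_co_sq_le {f g h : TrigPoly} {a b : ℝ}
    (H : ∀ k, ‖f.co k‖ ^ 2 ≤ a * ‖g.co k‖ ^ 2 + b * ‖h.co k‖ ^ 2) :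
    ‖f‖ ^ 2 ≤ a * ‖g‖ ^ 2 + b * ‖h‖ ^ 2 := by
  classical
  set s := f.supp ∪ g.supp ∪ h.supp
  have hf : f.supp ⊆ s := Finset.subset_union_left.trans Finset.subset_union_left
  have hg : g.supp ⊆ s := Finset.subset_union_right.trans Finset.subset_union_left
  have hh : h.supp ⊆ s := Finset.subset_union_right
  rw [norm_sq_eq f hf, norm_sq_eq g hg, norm_sq_eq h hh, Finset.mul_sum, Finset.mul_sum,
    ← Finset.sum_add_distrib]
  exact Finset.sum_le_sum fun k _ => H k

lemma norm_le_of_co_le {f g : TrigPoly} {c : ℝ} (hc : 0 ≤ c)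
    (H : ∀ k, ‖f.co k‖ ≤ c * ‖g.co k‖) : ‖f‖ ≤ c * ‖g‖ := by
  have := norm_sq_le_of_co_sq_le (f := f) (g := g) (h := 0) (a := c ^ 2) (b := 0) fun k => by
    have := pow_le_pow_left₀ (norm_nonneg _) (H k) 2
    rw [mul_pow] at this
    simpa using this
  have h2 : ‖f‖ ^ 2 ≤ (c * ‖g‖) ^ 2 := by rw [mul_pow]; simpa using this
  exact (pow_le_pow_iff_left₀ (norm_nonneg _) (by positivity) two_ne_zero).1 h2

/-! ### The Wiener norm -/

/-- The sum of the absolute values of the Fourier coefficients. -/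
def wiener (f : TrigPoly) : ℝ := ∑ k ∈ f.supp, ‖f.co k‖

lemma wiener_nonneg (f : TrigPoly) : 0 ≤ f.wiener := Finset.sum_nonneg fun _ _ => norm_nonneg _

lemma wiener_eq (f : TrigPoly) {s : Finset ℤ} (hs : f.supp ⊆ s) :
    f.wiener = ∑ k ∈ s, ‖f.co k‖ :=
  Finset.sum_subset hs fun k _ hk => by rw [co_eq_zero hk, norm_zero]

lemma sum_norm_co_le (f : TrigPoly) (s : Finset ℤ) : ∑ k ∈ s, ‖f.co k‖ ≤ f.wiener := by
  classical
  rw [f.wiener_eq (Finset.subset_union_left (s₂ := s))]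
  exact Finset.sum_le_sum_of_subset_of_nonneg Finset.subset_union_right
    fun _ _ _ => norm_nonneg _

lemma sum_norm_co_comp_le (f : TrigPoly) (s : Finset ℤ) {e : ℤ → ℤ} (he : e.Injective) :
    ∑ k ∈ s, ‖f.co (e k)‖ ≤ f.wiener := by
  classical
  rw [← Finset.sum_image (f := fun k => ‖f.co k‖) (g := e) he.injOn]
  exact sum_norm_co_le f _

lemma wiener_add_le (f g : TrigPoly) : (f + g).wiener ≤ f.wiener + g.wiener := by
  classical
  rw [wiener, Finset.sum_congr rfl fun k _ => by rw [co_add]]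
  calc ∑ k ∈ (f + g).supp, ‖f.co k + g.co k‖
      ≤ ∑ k ∈ (f + g).supp, (‖f.co k‖ + ‖g.co k‖) := Finset.sum_le_sum fun _ _ => norm_add_le _ _
    _ = _ := Finset.sum_add_distrib
    _ ≤ _ := add_le_add (sum_norm_co_le _ _) (sum_norm_co_le _ _)

lemma wiener_smul (c : ℝ) (f : TrigPoly) : (c • f).wiener = |c| * f.wiener := by
  have hs : (c • f).supp ⊆ f.supp := fun k hk => by
    rw [mem_supp, co_smul] at hk
    exact mem_supp.2 (right_ne_zero_of_mul hk)
  rw [wiener_eq _ hs, wiener, Finset.mul_sum]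
  simp

/-- Young's inequality. -/
lemma norm_mul_le_wiener (f g : TrigPoly) : ‖f * g‖ ≤ f.wiener * ‖g‖ := by
  have key : ∀ k, ‖(f * g).co k‖ ^ 2 ≤
      f.wiener * ∑ j ∈ g.supp, ‖f.co (k - j)‖ * ‖g.co j‖ ^ 2 := by
    intro k
    -- The kernel is split into two square roots, so that Cauchy–Schwarz leaves one factor of the
    -- kernel next to `‖g.co j‖ ^ 2`, to be summed over `k` afterwards.
    have h1 : ‖(f * g).co k‖ ≤ ∑ j ∈ g.supp, √‖f.co (k - j)‖ * (√‖f.co (k - j)‖ * ‖g.co j‖) := by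
      rw [co_mul]
      refine (norm_sum_le _ _).trans_eq (Finset.sum_congr rfl fun j _ => ?_)
      rw [norm_mul, ← mul_assoc, Real.mul_self_sqrt (norm_nonneg _)]
    have h2 := Finset.sum_mul_sq_le_sq_mul_sq g.supp (fun j => √‖f.co (k - j)‖)
      (fun j => √‖f.co (k - j)‖ * ‖g.co j‖)
    have h3 : ∑ j ∈ g.supp, √‖f.co (k - j)‖ ^ 2 ≤ f.wiener := by
      simp only [Real.sq_sqrt (norm_nonneg _)]
      exact sum_norm_co_comp_le f _ (sub_right_injective (b := k))
    calc ‖(f * g).co k‖ ^ 2 ≤ _ := pow_le_pow_left₀ (norm_nonneg _) h1 2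
      _ ≤ _ := h2
      _ ≤ f.wiener * ∑ j ∈ g.supp, (√‖f.co (k - j)‖ * ‖g.co j‖) ^ 2 :=
        mul_le_mul_of_nonneg_right h3 (Finset.sum_nonneg fun _ _ => by positivity)
      _ = _ := by simp only [mul_pow, Real.sq_sqrt (norm_nonneg _)]
  have hw := f.wiener_nonneg
  refine (pow_le_pow_iff_left₀ (norm_nonneg _) (by positivity) two_ne_zero).1 ?_
  rw [norm_sq_eq (f * g) subset_rfl, mul_pow, norm_sq_eq g subset_rfl]
  calc ∑ k ∈ (f * g).supp, ‖(f * g).co k‖ ^ 2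
      ≤ ∑ k ∈ (f * g).supp, f.wiener * ∑ j ∈ g.supp, ‖f.co (k - j)‖ * ‖g.co j‖ ^ 2 :=
        Finset.sum_le_sum fun k _ => key k
    _ = f.wiener * ∑ j ∈ g.supp, (∑ k ∈ (f * g).supp, ‖f.co (k - j)‖) * ‖g.co j‖ ^ 2 := by
        rw [← Finset.mul_sum, Finset.sum_comm]
        simp only [Finset.sum_mul]
    _ ≤ f.wiener * ∑ j ∈ g.supp, f.wiener * ‖g.co j‖ ^ 2 := by
        refine mul_le_mul_of_nonneg_left (Finset.sum_le_sum fun j _ => ?_) hw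
        exact mul_le_mul_of_nonneg_right (sum_norm_co_comp_le f _ (sub_left_injective (b := j)))
          (by positivity)
    _ = _ := by rw [← Finset.mul_sum]; ring

/-- The Sobolev embedding in dimension one: Cauchy–Schwarz with the weight `1 + k²`, whose inverse
is summable over the integers. -/
lemma exists_wiener_le : ∃ C : ℝ, 0 < C ∧ ∀ f : TrigPoly, f.wiener ≤ C * (‖f‖ + ‖D f‖) := by
  have hsum : Summable fun k : ℤ => (1 : ℝ) / (1 + (k : ℝ) ^ 2) := by
    refine Summable.of_norm_bounded_eventually
      (Real.summable_one_div_int_pow.2 (by norm_num : 1 < 2)) ?_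
    filter_upwards [(finite_singleton (0 : ℤ)).compl_mem_cofinite] with k hk
    have hk : k ≠ 0 := hk
    have : (0 : ℝ) < (k : ℝ) ^ 2 := by positivity
    rw [Real.norm_of_nonneg (by positivity)]
    exact one_div_le_one_div_of_le this (by linarith)
  set A := ∑' k : ℤ, (1 : ℝ) / (1 + (k : ℝ) ^ 2)
  have hA : 0 ≤ A := tsum_nonneg fun k => by positivity
  refine ⟨√A + 1, by positivity, fun f => ?_⟩
  have h1 : f.wiener ^ 2 ≤ A * (‖f‖ ^ 2 + ‖D f‖ ^ 2) := by
    have h2 := Finset.sum_mul_sq_le_sq_mul_sq f.supp (fun k => √(1 / (1 + (k : ℝ) ^ 2)))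
      (fun k => √(1 + (k : ℝ) ^ 2) * ‖f.co k‖)
    have e1 : ∑ k ∈ f.supp, √(1 / (1 + (k : ℝ) ^ 2)) * (√(1 + (k : ℝ) ^ 2) * ‖f.co k‖) =
        f.wiener := by
      refine Finset.sum_congr rfl fun k _ => ?_
      rw [← mul_assoc, ← Real.sqrt_mul (by positivity), one_div_mul_cancel (by positivity),
        Real.sqrt_one, one_mul]
    have e2 : ∑ k ∈ f.supp, (√(1 + (k : ℝ) ^ 2) * ‖f.co k‖) ^ 2 = ‖f‖ ^ 2 + ‖D f‖ ^ 2 := by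
      rw [norm_sq_eq f subset_rfl, norm_sq_eq (D f) (supp_D_subset f), ← Finset.sum_add_distrib]
      refine Finset.sum_congr rfl fun k _ => ?_
      rw [mul_pow, Real.sq_sqrt (by positivity), co_D, norm_mul, norm_mul, Complex.norm_I,
        Complex.norm_intCast, one_mul, mul_pow, sq_abs]
      ring
    have e3 : ∑ k ∈ f.supp, √(1 / (1 + (k : ℝ) ^ 2)) ^ 2 ≤ A := by
      rw [Finset.sum_congr rfl fun (k : ℤ) _ => Real.sq_sqrt (show (0 : ℝ) ≤ 1 / (1 + (k : ℝ) ^ 2) by positivity)]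
      exact hsum.sum_le_tsum _ fun k _ => by positivity
    rw [e1, e2] at h2
    exact h2.trans (mul_le_mul_of_nonneg_right e3 (by positivity))
  have h3 : f.wiener ^ 2 ≤ (√A * (‖f‖ + ‖D f‖)) ^ 2 := by
    rw [mul_pow, Real.sq_sqrt hA]
    refine h1.trans (mul_le_mul_of_nonneg_left ?_ hA)
    nlinarith [mul_nonneg (norm_nonneg f) (norm_nonneg (D f))]
  have h4 := (pow_le_pow_iff_left₀ f.wiener_nonneg (by positivity) two_ne_zero).1 h3
  nlinarith [norm_nonneg f, norm_nonneg (D f)]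

attribute [irreducible] D evenMult wiener

/-! ### Commutators with Fourier multipliers -/

lemma norm_co_D (f : TrigPoly) (k : ℤ) : ‖(D f).co k‖ = |(k : ℝ)| * ‖f.co k‖ := by
  rw [co_D, norm_mul, norm_mul, Complex.norm_I, Complex.norm_intCast, one_mul]

/-- The trigonometric polynomial whose coefficients are the absolute values of those of `f`. -/
def majorant (f : TrigPoly) : TrigPoly :=
  ofCo (Finsupp.onFinset f.supp (fun k => (‖f.co k‖ : ℂ))
    (fun k hk => mem_supp.2 (by simpa using hk))) (fun k => by simp [co_conj])

lemma co_majorant (f : TrigPoly) (k : ℤ) : f.majorant.co k = (‖f.co k‖ : ℂ) := rfl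

lemma norm_majorant (f : TrigPoly) : ‖f.majorant‖ = ‖f‖ := by
  refine le_antisymm ?_ ?_ <;>
  · have := norm_le_of_co_le (f := f.majorant) (g := f) zero_le_one (by simp [co_majorant])
    have := norm_le_of_co_le (f := f) (g := f.majorant) zero_le_one (by simp [co_majorant])
    linarith

lemma wiener_majorant (f : TrigPoly) : f.majorant.wiener = f.wiener := by
  have : f.majorant.supp = f.supp := by ext k; simp [mem_supp, co_majorant]
  simp [wiener, this, co_majorant]

/-- The right-hand side is a convolution of nonnegative numbers, so omitting indices only decreases
it. Bounds on coefficients thereby become norm bounds, through Young's inequality for the majorants.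
-/
lemma sum_mul_le_co_majorant (f g : TrigPoly) (s : Finset ℤ) (k : ℤ) :
    ∑ j ∈ s, ‖f.co (k - j)‖ * ‖g.co j‖ ≤ ((f.majorant * g.majorant).co k).re := by
  classical
  have hs : g.majorant.supp ⊆ s ∪ g.majorant.supp := Finset.subset_union_right
  rw [co_mul_of_subset _ _ _ hs, Complex.re_sum]
  have : ∀ j, (f.majorant.co (k - j) * g.majorant.co j).re = ‖f.co (k - j)‖ * ‖g.co j‖ := by
    intro j; rw [co_majorant, co_majorant, ← Complex.ofReal_mul, Complex.ofReal_re]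
  simp only [this]
  exact Finset.sum_le_sum_of_subset_of_nonneg Finset.subset_union_left
    fun _ _ _ => by positivity

/-- Bilinear multiplier estimate. -/
lemma norm_le_of_co_le_sum {h f₁ g₁ f₂ g₂ : TrigPoly} {c₁ c₂ : ℝ} (h₁ : 0 ≤ c₁) (h₂ : 0 ≤ c₂)
    (s : Finset ℤ)
    (H : ∀ k, ‖h.co k‖ ≤ ∑ j ∈ s, (c₁ * (‖f₁.co (k - j)‖ * ‖g₁.co j‖) +
      c₂ * (‖f₂.co (k - j)‖ * ‖g₂.co j‖))) :
    ‖h‖ ≤ c₁ * (f₁.wiener * ‖g₁‖) + c₂ * (f₂.wiener * ‖g₂‖) := by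
  set m := c₁ • (f₁.majorant * g₁.majorant) + c₂ • (f₂.majorant * g₂.majorant)
  have hm : ‖m‖ ≤ c₁ * (f₁.wiener * ‖g₁‖) + c₂ * (f₂.wiener * ‖g₂‖) := by
    refine (norm_add_le _ _).trans ?_
    rw [norm_smul, norm_smul, Real.norm_of_nonneg h₁, Real.norm_of_nonneg h₂,
      ← wiener_majorant f₁, ← wiener_majorant f₂, ← norm_majorant g₁, ← norm_majorant g₂]
    gcongr <;> exact norm_mul_le_wiener _ _
  refine le_trans ?_ hm
  have := norm_le_of_co_le (f := h) (g := m) zero_le_one fun k => by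
    rw [one_mul]
    refine (H k).trans (le_trans ?_ (Complex.re_le_norm _))
    rw [Finset.sum_add_distrib, ← Finset.mul_sum, ← Finset.mul_sum]
    simp only [m, co_add, co_smul, Complex.add_re, Complex.re_ofReal_mul]
    gcongr <;> exact sum_mul_le_co_majorant _ _ _ _
  simpa using this

/-- Even symbols `0 ≤ q ≤ 1` of order zero, small (of size `δ`) at bounded frequencies. -/
structure IsTailSymbol (q : ℕ → ℝ) (δ : ℝ) : Prop where
  delta_nonneg : 0 ≤ δ
  nonneg : ∀ n, 0 ≤ q n
  le_one : ∀ n, q n ≤ 1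
  le_mul : ∀ k : ℤ, q k.natAbs ≤ δ * (1 + |(k : ℝ)|)
  lip : ∀ k j : ℤ, |q k.natAbs - q j.natAbs| ≤ δ * |((k - j : ℤ) : ℝ)|
  comm_one : ∀ k j : ℤ, |q k.natAbs - q j.natAbs| * |(j : ℝ)| ≤
    2 * |((k - j : ℤ) : ℝ)| * q j.natAbs + δ * |((k - j : ℤ) : ℝ)| ^ 2
  comm_two : ∀ k j : ℤ, |q k.natAbs - q j.natAbs| * |(j : ℝ)| ^ 2 ≤
    |((k - j : ℤ) : ℝ)| ^ 2 * q j.natAbs + 2 * |((k - j : ℤ) : ℝ)| * (|(j : ℝ)| * q j.natAbs)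

/-- With this symbol, which has no commutators, the filtered energy estimate specialises to the
ordinary one in `H³ × H⁴`. -/
lemma isTailSymbol_one : IsTailSymbol (fun _ => 1) 1 where
  delta_nonneg := zero_le_one
  nonneg _ := zero_le_one
  le_one _ := le_rfl
  le_mul k := by linarith [abs_nonneg (k : ℝ)]
  lip k j := by simp
  comm_one k j := by simp; positivity
  comm_two k j := by simp; positivity

/-- The symbol `ε k² / (1 + ε k²)` with `ε = δ²`. -/
def highPass (δ : ℝ) (n : ℕ) : ℝ := δ ^ 2 * (n : ℝ) ^ 2 / (1 + δ ^ 2 * (n : ℝ) ^ 2)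

lemma highPass_natAbs (δ : ℝ) (k : ℤ) :
    highPass δ k.natAbs = δ ^ 2 * (k : ℝ) ^ 2 / (1 + δ ^ 2 * (k : ℝ) ^ 2) := by
  have : ((k.natAbs : ℕ) : ℝ) ^ 2 = (k : ℝ) ^ 2 := by
    rw [Nat.cast_natAbs, Int.cast_abs, sq_abs]
  rw [highPass, this]

/-- For `t/(1+t)` the difference quotient is explicit, and `k² - j²` factors. The factor `|k - j|`
is the derivative that a commutator moves onto the smooth factor. -/
lemma highPass_sub_abs (δ k j : ℝ) :
    |δ ^ 2 * k ^ 2 / (1 + δ ^ 2 * k ^ 2) - δ ^ 2 * j ^ 2 / (1 + δ ^ 2 * j ^ 2)| =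
      δ ^ 2 * (|k - j| * |k + j|) / ((1 + δ ^ 2 * k ^ 2) * (1 + δ ^ 2 * j ^ 2)) := by
  have hk : 0 < 1 + δ ^ 2 * k ^ 2 := by positivity
  have hj : 0 < 1 + δ ^ 2 * j ^ 2 := by positivity
  have : δ ^ 2 * k ^ 2 / (1 + δ ^ 2 * k ^ 2) - δ ^ 2 * j ^ 2 / (1 + δ ^ 2 * j ^ 2) =
      δ ^ 2 * ((k - j) * (k + j)) / ((1 + δ ^ 2 * k ^ 2) * (1 + δ ^ 2 * j ^ 2)) := by
    field_simp; ring
  rw [this, abs_div, abs_mul, abs_mul, abs_of_nonneg (sq_nonneg δ),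
    abs_of_pos (mul_pos hk hj)]

lemma isTailSymbol_highPass {δ : ℝ} (hδ : 0 ≤ δ) : IsTailSymbol (highPass δ) δ where
  delta_nonneg := hδ
  nonneg n := by unfold highPass; positivity
  le_one n := by
    unfold highPass
    rw [div_le_one (by positivity)]; linarith
  le_mul k := by
    rw [highPass_natAbs, ← sq_abs (k : ℝ), div_le_iff₀ (by positivity)]
    set a := |(k : ℝ)|
    have ha : 0 ≤ a := abs_nonneg _
    nlinarith [mul_nonneg hδ ha, mul_nonneg hδ (mul_nonneg ha (sq_nonneg (δ * a - 1))),
      mul_nonneg hδ (sq_nonneg (δ * a)), mul_nonneg (mul_nonneg hδ ha) (sq_nonneg (δ * a))]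
  lip k j := by
    rw [highPass_natAbs, highPass_natAbs, highPass_sub_abs, div_le_iff₀ (by positivity)]
    push_cast
    set a := |(k : ℝ)| with ha'
    set b := |(j : ℝ)| with hb'
    have ha : 0 ≤ a := abs_nonneg _
    have hb : 0 ≤ b := abs_nonneg _
    have h1 : |(k : ℝ) + j| ≤ a + b := abs_add_le _ _
    rw [← sq_abs (k : ℝ), ← sq_abs (j : ℝ), ← ha', ← hb']
    have h0 : 0 ≤ |(k : ℝ) - j| := abs_nonneg _
    have h2 : δ * (a + b) ≤ (1 + δ ^ 2 * a ^ 2) * (1 + δ ^ 2 * b ^ 2) := by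
      nlinarith [sq_nonneg (δ * a - 1), sq_nonneg (δ * b - 1), sq_nonneg (δ * a * (δ * b)),
        sq_nonneg (δ * a), sq_nonneg (δ * b)]
    calc δ ^ 2 * (|(k : ℝ) - j| * |(k : ℝ) + j|) ≤ δ ^ 2 * (|(k : ℝ) - j| * (a + b)) := by gcongr
      _ = δ * |(k : ℝ) - j| * (δ * (a + b)) := by ring
      _ ≤ _ := by gcongr
  comm_one k j := by
    rw [highPass_natAbs, highPass_natAbs, highPass_sub_abs]
    push_cast
    set b := |(j : ℝ)| with hb'
    set d := |(k : ℝ) - j| with hd'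
    have hb : 0 ≤ b := abs_nonneg _
    have hd : 0 ≤ d := abs_nonneg _
    -- All frequencies other than the difference are expressed through `j`, so that `δ² j² / (1 + δ²
    -- j²)`, the symbol at `j`, can be recognised below.
    have h1 : |(k : ℝ) + j| ≤ d + 2 * b := by
      have : (k : ℝ) + j = (k - j) + 2 * j := by ring
      rw [this]
      refine (abs_add_le _ _).trans ?_
      rw [abs_mul, abs_two]
    rw [← sq_abs (j : ℝ), ← hb']
    have hk : 1 ≤ 1 + δ ^ 2 * (k : ℝ) ^ 2 := by nlinarith [sq_nonneg (δ * k)]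
    have hj : 0 < 1 + δ ^ 2 * b ^ 2 := by positivity
    have h2 : δ * b ≤ 1 + δ ^ 2 * b ^ 2 := by nlinarith [sq_nonneg (δ * b - 1), sq_nonneg (δ * b)]
    -- The `d ^ 2` part carries a single power of `j`, too few to rebuild the symbol; `h2` bounds it
    -- by `δ` instead. This is the source of the `δ`-remainder.
    calc δ ^ 2 * (d * |(k : ℝ) + j|) / ((1 + δ ^ 2 * (k : ℝ) ^ 2) * (1 + δ ^ 2 * b ^ 2)) * b
        ≤ δ ^ 2 * (d * (d + 2 * b)) / (1 * (1 + δ ^ 2 * b ^ 2)) * b := by gcongr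
      _ = 2 * d * (δ ^ 2 * b ^ 2 / (1 + δ ^ 2 * b ^ 2)) +
          δ * d ^ 2 * (δ * b / (1 + δ ^ 2 * b ^ 2)) := by field_simp; ring
      _ ≤ 2 * d * (δ ^ 2 * b ^ 2 / (1 + δ ^ 2 * b ^ 2)) + δ * d ^ 2 * 1 := by
          gcongr; rw [div_le_one hj]; exact h2
      _ = _ := by ring
  comm_two k j := by
    rw [highPass_natAbs, highPass_natAbs, highPass_sub_abs]
    push_cast
    set b := |(j : ℝ)| with hb'
    set d := |(k : ℝ) - j| with hd'
    have hb : 0 ≤ b := abs_nonneg _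
    have hd : 0 ≤ d := abs_nonneg _
    have h1 : |(k : ℝ) + j| ≤ d + 2 * b := by
      have : (k : ℝ) + j = (k - j) + 2 * j := by ring
      rw [this]
      refine (abs_add_le _ _).trans ?_
      rw [abs_mul, abs_two]
    rw [← sq_abs (j : ℝ), ← hb']
    have hk : 1 ≤ 1 + δ ^ 2 * (k : ℝ) ^ 2 := by nlinarith [sq_nonneg (δ * k)]
    have hj : 0 < 1 + δ ^ 2 * b ^ 2 := by positivity
    -- With two powers of `j` both parts contain the full symbol at `j`, and no remainder in `δ`
    -- appears.
    calc δ ^ 2 * (d * |(k : ℝ) + j|) / ((1 + δ ^ 2 * (k : ℝ) ^ 2) * (1 + δ ^ 2 * b ^ 2)) * b ^ 2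
        ≤ δ ^ 2 * (d * (d + 2 * b)) / (1 * (1 + δ ^ 2 * b ^ 2)) * b ^ 2 := by gcongr
      _ = _ := by field_simp

/-- The commutator `[q(D), f] g`. -/
def comm (q : ℕ → ℝ) (f g : TrigPoly) : TrigPoly := evenMult q (f * g) - f * evenMult q g

lemma evenMult_mul (q : ℕ → ℝ) (f g : TrigPoly) :
    evenMult q (f * g) = f * evenMult q g + comm q f g := by rw [comm]; ring

lemma D_comm (q : ℕ → ℝ) (f g : TrigPoly) : D (comm q f g) = comm q (D f) g + comm q f (D g) := by
  simp only [comm, map_sub, D_mul, ← evenMult_D, map_add]; ring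

lemma norm_co_comm_le (q : ℕ → ℝ) (f g : TrigPoly) (k : ℤ) : ‖(comm q f g).co k‖ ≤
    ∑ j ∈ g.supp, ‖f.co (k - j)‖ * (|q k.natAbs - q j.natAbs| * ‖g.co j‖) := by
  rw [comm, co_sub, co_evenMult, co_mul,
    co_mul_of_subset _ _ _ (supp_evenMult_subset q g), Finset.mul_sum,
    ← Finset.sum_sub_distrib]
  refine (norm_sum_le _ _).trans_eq (Finset.sum_congr rfl fun j _ => ?_)
  rw [co_evenMult, ← Real.norm_eq_abs, ← Complex.norm_real, Complex.ofReal_sub, ← norm_mul,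
    ← norm_mul]
  congr 1; ring

/-! ### Commutator bounds for tail symbols. -/

section

variable {q : ℕ → ℝ} {δ : ℝ}

lemma IsTailSymbol.norm_comm_le (hq : IsTailSymbol q δ) (f g : TrigPoly) :
    ‖comm q f g‖ ≤ δ * ((D f).wiener * ‖g‖) := by
  have := norm_le_of_co_le_sum (h := comm q f g) (f₁ := D f) (g₁ := g) (f₂ := 0) (g₂ := 0)
    hq.delta_nonneg le_rfl g.supp fun k => by
      refine (norm_co_comm_le q f g k).trans (Finset.sum_le_sum fun j _ => ?_)
      rw [norm_co_D]
      have := mul_le_mul_of_nonneg_right (hq.lip k j)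
        (mul_nonneg (norm_nonneg (f.co (k - j))) (norm_nonneg (g.co j)))
      nlinarith
  simpa using this

/-- By `comm_one` the derivative on `g` is traded for derivatives on `f`. The main term keeps the
filter on `g`, as a Grönwall argument for the filtered energy requires; only the remainder sees `g`
unfiltered, with a factor `δ`. -/
lemma IsTailSymbol.norm_comm_D_le (hq : IsTailSymbol q δ) (f g : TrigPoly) :
    ‖comm q f (D g)‖ ≤
      2 * ((D f).wiener * ‖evenMult q g‖) + δ * ((D (D f)).wiener * ‖g‖) := by
  refine norm_le_of_co_le_sum zero_le_two hq.delta_nonneg (D g).supp fun k => ?_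
  refine (norm_co_comm_le q f (D g) k).trans (Finset.sum_le_sum fun j _ => ?_)
  simp only [norm_co_D, co_evenMult, norm_mul, Complex.norm_real,
    Real.norm_of_nonneg (hq.nonneg _)]
  have := mul_le_mul_of_nonneg_right (hq.comm_one k j)
    (mul_nonneg (norm_nonneg (f.co (k - j))) (norm_nonneg (g.co j)))
  nlinarith

/-- Every term on the right is filtered. This is needed for `g = ∂³u`, whose derivative is
controlled only after filtering, through the viscosity. -/
lemma IsTailSymbol.norm_comm_D_D_le (hq : IsTailSymbol q δ) (f g : TrigPoly) :
    ‖comm q f (D (D g))‖ ≤ 1 * ((D (D f)).wiener * ‖evenMult q g‖) +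
      2 * ((D f).wiener * ‖D (evenMult q g)‖) := by
  refine norm_le_of_co_le_sum zero_le_one zero_le_two (D (D g)).supp fun k => ?_
  refine (norm_co_comm_le q f (D (D g)) k).trans (Finset.sum_le_sum fun j _ => ?_)
  simp only [norm_co_D, co_evenMult, norm_mul, Complex.norm_real,
    Real.norm_of_nonneg (hq.nonneg _)]
  have := mul_le_mul_of_nonneg_right (hq.comm_two k j)
    (mul_nonneg (norm_nonneg (f.co (k - j))) (norm_nonneg (g.co j)))
  nlinarith

lemma IsTailSymbol.norm_D_comm_le (hq : IsTailSymbol q δ) (f g : TrigPoly) :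
    ‖D (comm q f g)‖ ≤
      2 * ((D f).wiener * ‖evenMult q g‖) + 2 * δ * ((D (D f)).wiener * ‖g‖) := by
  rw [D_comm]
  have h1 := hq.norm_comm_le (D f) g
  have h2 := hq.norm_comm_D_le f g
  linarith [norm_add_le (comm q (D f) g) (comm q f (D g))]

lemma IsTailSymbol.norm_evenMult_le (hq : IsTailSymbol q δ) (f : TrigPoly) :
    ‖evenMult q f‖ ≤ ‖f‖ := by
  have := norm_le_of_co_le (f := evenMult q f) (g := f) zero_le_one fun k => by
    rw [co_evenMult, norm_mul, Complex.norm_real, Real.norm_of_nonneg (hq.nonneg _)]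
    exact mul_le_mul_of_nonneg_right (hq.le_one _) (norm_nonneg _)
  simpa using this

/-- The symbol is at most `δ (1 + |k|)`: a term with one derivative to spare contributes only `O(δ)`
to the filtered energy. -/
lemma IsTailSymbol.norm_evenMult_le_mul (hq : IsTailSymbol q δ) (f : TrigPoly) :
    ‖evenMult q f‖ ≤ δ * (‖f‖ + ‖D f‖) := by
  have hδ := hq.delta_nonneg
  have h : ‖evenMult q f‖ ≤ δ * ‖f.majorant + (D f).majorant‖ :=
    norm_le_of_co_le hδ fun k => by
      rw [co_evenMult, norm_mul, Complex.norm_real, Real.norm_of_nonneg (hq.nonneg _), co_add,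
        co_majorant, co_majorant, ← Complex.ofReal_add, Complex.norm_real,
        Real.norm_of_nonneg (by positivity), norm_co_D]
      have := mul_le_mul_of_nonneg_right (hq.le_mul k) (norm_nonneg (f.co k))
      nlinarith
  refine h.trans (mul_le_mul_of_nonneg_left ?_ hδ)
  rw [← norm_majorant f, ← norm_majorant (D f)]
  exact norm_add_le _ _

end

attribute [irreducible] comm

/-! ### The energy estimate -/

/-- The right-hand side of the equation for `u`. -/
def fieldU (ν γ : ℝ) (u v : TrigPoly) : TrigPoly :=
  -(3 : ℝ) • (u * D u) - (6 : ℝ) • (v * (v * D v)) - γ • (v * D (D (D v))) + ν • D (D u)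

/-- The right-hand side of the equation for `v`. -/
def fieldV (γ : ℝ) (u v : TrigPoly) : TrigPoly :=
  (6 : ℝ) • (v * D v) + γ • D (D (D v)) + D (u * v)

/-- `u` and `v` are bounded by `M` in `H³` and `H⁴`, together with the uniform norms that these
control. -/
structure IsBdd (M : ℝ) (u v : TrigPoly) : Prop where
  u0 : ‖u‖ ≤ M
  u1 : ‖D u‖ ≤ M
  u2 : ‖D (D u)‖ ≤ M
  u3 : ‖D (D (D u))‖ ≤ M
  v0 : ‖v‖ ≤ M
  v1 : ‖D v‖ ≤ M
  v2 : ‖D (D v)‖ ≤ M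
  v3 : ‖D (D (D v))‖ ≤ M
  v4 : ‖D (D (D (D v)))‖ ≤ M
  wu0 : u.wiener ≤ M
  wu1 : (D u).wiener ≤ M
  wu2 : (D (D u)).wiener ≤ M
  wv0 : v.wiener ≤ M
  wv1 : (D v).wiener ≤ M
  wv2 : (D (D v)).wiener ≤ M
  wv3 : (D (D (D v))).wiener ≤ M

lemma IsBdd.nonneg {M : ℝ} {u v : TrigPoly} (h : IsBdd M u v) : 0 ≤ M :=
  (norm_nonneg _).trans h.u0

lemma norm_mul_le_of_le {f g : TrigPoly} {a b : ℝ} (hf : f.wiener ≤ a) (hg : ‖g‖ ≤ b) :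
    ‖f * g‖ ≤ a * b :=
  (norm_mul_le_wiener f g).trans
    (mul_le_mul hf hg (norm_nonneg _) (f.wiener_nonneg.trans hf))

lemma norm_mul_le_of_le' {f g : TrigPoly} {a b : ℝ} (hf : ‖f‖ ≤ a) (hg : g.wiener ≤ b) :
    ‖f * g‖ ≤ a * b := by
  rw [mul_comm f g, mul_comm a]; exact norm_mul_le_of_le hg hf

/-! ### Filtered energy estimates, one nonlinear term at a time. -/

section

variable {q : ℕ → ℝ} {δ M : ℝ} {u v : TrigPoly}

lemma IsTailSymbol.norm_evenMult_mul_le (hq : IsTailSymbol q δ) {f g : TrigPoly} {a b : ℝ}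
    (hf : f.wiener ≤ a) (hf' : (D f).wiener ≤ a) (hg : ‖g‖ ≤ b) :
    ‖evenMult q (f * g)‖ ≤ a * ‖evenMult q g‖ + δ * (a * b) := by
  have hδ := hq.delta_nonneg
  have ha : 0 ≤ a := f.wiener_nonneg.trans hf
  rw [evenMult_mul]
  refine (norm_add_le _ _).trans (add_le_add (norm_mul_le_of_le hf le_rfl) ?_)
  refine (hq.norm_comm_le f g).trans ?_
  gcongr

lemma IsTailSymbol.norm_evenMult_mul_D_le (hq : IsTailSymbol q δ) {f g : TrigPoly} {a b : ℝ}
    (hf' : (D f).wiener ≤ a) (hf'' : (D (D f)).wiener ≤ a) (hg : ‖g‖ ≤ b) :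
    ‖comm q f (D g)‖ ≤ 2 * a * ‖evenMult q g‖ + δ * (a * b) := by
  have hδ := hq.delta_nonneg
  have ha : 0 ≤ a := (D f).wiener_nonneg.trans hf'
  refine (hq.norm_comm_D_le f g).trans ?_
  rw [mul_assoc]
  gcongr

/-- One derivative is moved to the left factor, where the viscosity controls it. Of the two
derivatives left on `u * D u`, only `u * D (D (D u))` has top order; the rest has a derivative to
spare. -/
lemma energy_burgers (hq : IsTailSymbol q δ) (hM : 1 ≤ M) (h : IsBdd M u v) :
    |⟪evenMult q (D (D (D u))), evenMult q (D (D (D (u * D u))))⟫_ℝ| ≤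
      ‖D (evenMult q (D (D (D u))))‖ * (10 * M ^ 2 * (‖evenMult q (D (D (D u)))‖ + δ)) := by
  have hδ := hq.delta_nonneg
  rw [evenMult_D q (D (D (u * D u))), inner_D_right, abs_neg]
  refine (abs_real_inner_le_norm _ _).trans (mul_le_mul_of_nonneg_left ?_ (norm_nonneg _))
  have e : D (D (u * D u)) = u * D (D (D u)) + (3 : ℝ) • (D u * D (D u)) := by
    simp only [D_mul, map_add, Algebra.smul_def, map_ofNat]; ring
  rw [e, map_add, map_smul]
  have h1 := hq.norm_evenMult_mul_le h.wu0 h.wu1 h.u3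
  have h2 := hq.norm_evenMult_le_mul (D u * D (D u))
  have h3 : ‖D u * D (D u)‖ ≤ M * M := norm_mul_le_of_le h.wu1 h.u2
  have h4 : ‖D (D u * D (D u))‖ ≤ M * M + M * M := by
    rw [D_mul]
    exact (norm_add_le _ _).trans (add_le_add (norm_mul_le_of_le h.wu2 h.u2)
      (norm_mul_le_of_le h.wu1 h.u3))
  have h5 : δ * (‖D u * D (D u)‖ + ‖D (D u * D (D u))‖) ≤ δ * (M * M + (M * M + M * M)) := by
    gcongr
  refine (norm_add_le _ _).trans ?_
  rw [norm_smul, Real.norm_of_nonneg (by norm_num)]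
  have h6 : M ≤ M ^ 2 := by nlinarith
  nlinarith [mul_le_mul_of_nonneg_right h6 (norm_nonneg (evenMult q (D (D (D u))))),
    mul_nonneg hδ (sq_nonneg M), mul_nonneg (norm_nonneg (evenMult q (D (D (D u))))) (sq_nonneg M)]

/-- After one integration by parts, two derivatives fall on `v * (v * D v)`. For `v` in `H⁴` this
leaves one to spare, so the whole term is `O(δ)`. -/
lemma energy_cubic (hq : IsTailSymbol q δ) (h : IsBdd M u v) :
    |⟪evenMult q (D (D (D u))), evenMult q (D (D (D (v * (v * D v)))))⟫_ℝ| ≤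
      ‖D (evenMult q (D (D (D u))))‖ * (36 * M ^ 3 * δ) := by
  have hδ := hq.delta_nonneg
  have hM := h.nonneg
  rw [evenMult_D q (D (D (v * (v * D v)))), inner_D_right, abs_neg]
  refine (abs_real_inner_le_norm _ _).trans (mul_le_mul_of_nonneg_left ?_ (norm_nonneg _))
  have e2 : D (D (v * (v * D v))) = (2 : ℝ) • (D v * (D v * D v)) +
      (6 : ℝ) • (v * (D v * D (D v))) + v * (v * D (D (D v))) := by
    simp only [D_mul, map_add, Algebra.smul_def, map_ofNat]; ring
  have e3 : D (D (D (v * (v * D v)))) = (12 : ℝ) • (D v * (D v * D (D v))) +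
      (6 : ℝ) • (v * (D (D v) * D (D v))) + (8 : ℝ) • (v * (D v * D (D (D v)))) +
      v * (v * D (D (D (D v)))) := by
    simp only [D_mul, map_add, Algebra.smul_def, map_ofNat]; ring
  -- The constants 9 and 27 are the sums of the coefficients in `e2` and `e3`.
  have n2 : ‖D (D (v * (v * D v)))‖ ≤ 9 * M ^ 3 := by
    rw [e2]
    have a1 := norm_mul_le_of_le h.wv1 (norm_mul_le_of_le h.wv1 h.v1)
    have a2 := norm_mul_le_of_le h.wv0 (norm_mul_le_of_le h.wv1 h.v2)
    have a3 := norm_mul_le_of_le h.wv0 (norm_mul_le_of_le h.wv0 h.v3)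
    have b1 := norm_smul (2 : ℝ) (D v * (D v * D v))
    have b2 := norm_smul (6 : ℝ) (v * (D v * D (D v)))
    rw [Real.norm_of_nonneg (by norm_num)] at b1 b2
    refine (norm_add₃_le).trans ?_
    linarith
  have n3 : ‖D (D (D (v * (v * D v))))‖ ≤ 27 * M ^ 3 := by
    rw [e3]
    have a1 := norm_mul_le_of_le h.wv1 (norm_mul_le_of_le h.wv1 h.v2)
    have a2 := norm_mul_le_of_le h.wv0 (norm_mul_le_of_le h.wv2 h.v2)
    have a3 := norm_mul_le_of_le h.wv0 (norm_mul_le_of_le h.wv1 h.v3)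
    have a4 := norm_mul_le_of_le h.wv0 (norm_mul_le_of_le h.wv0 h.v4)
    have b1 := norm_smul (12 : ℝ) (D v * (D v * D (D v)))
    have b2 := norm_smul (6 : ℝ) (v * (D (D v) * D (D v)))
    have b3 := norm_smul (8 : ℝ) (v * (D v * D (D (D v))))
    rw [Real.norm_of_nonneg (by norm_num)] at b1 b2 b3
    refine (norm_add₄_le).trans ?_
    linarith
  refine (hq.norm_evenMult_le_mul _).trans ?_
  calc δ * (‖D (D (v * (v * D v)))‖ + ‖D (D (D (v * (v * D v))))‖)
      ≤ δ * (9 * M ^ 3 + 27 * M ^ 3) := by gcongr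
    _ = _ := by ring

/-- The subtracted term is the one that loses a derivative. It is isolated by moving two derivatives
to the left and commuting the filter past `v`; everything else needs only `D p`. -/
lemma energy_dispersive_u (hq : IsTailSymbol q δ) (hM : 1 ≤ M) (h : IsBdd M u v) :
    |⟪evenMult q (D (D (D u))), evenMult q (D (D (D (v * D (D (D v))))))⟫_ℝ -
      ⟪D (D (evenMult q (D (D (D u))))), v * evenMult q (D (D (D (D v))))⟫_ℝ| ≤
      ‖D (evenMult q (D (D (D u))))‖ * (10 * M ^ 2 * (‖evenMult q (D (D (D (D v))))‖ + δ)) := by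
  have hδ := hq.delta_nonneg
  set p := evenMult q (D (D (D u)))
  set g := D (D (D (D v))) with hg
  have e : D (D (D (v * D (D (D v))))) = D (D (v * g)) + D (D v * g + D (D v) * D (D (D v))) := by
    simp only [hg, D_mul, map_add]; ring
  have e2 : ⟪p, evenMult q (D (D (D (v * D (D (D v))))))⟫_ℝ - ⟪D (D p), v * evenMult q g⟫_ℝ =
      - ⟪D p, D (comm q v g) + (evenMult q (D v * g) + evenMult q (D (D v) * D (D (D v))))⟫_ℝ := by
    rw [e, map_add, evenMult_D, evenMult_D, evenMult_D, evenMult_mul q v g, inner_add_right,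
      inner_D_right p, inner_D_right p, inner_D_right (D p), inner_add_right (D (D p)),
      inner_add_right (D p), inner_D_right (D p), map_add]
    ring
  rw [e2, abs_neg]
  refine (abs_real_inner_le_norm _ _).trans (mul_le_mul_of_nonneg_left ?_ (norm_nonneg _))
  have h1 := hq.norm_D_comm_le v g
  have h2 := hq.norm_evenMult_mul_le h.wv1 h.wv2 h.v4
  have h3 := hq.norm_evenMult_le_mul (D (D v) * D (D (D v)))
  have h4 : ‖D (D v) * D (D (D v))‖ ≤ M * M := norm_mul_le_of_le h.wv2 h.v3
  have h5 : ‖D (D (D v) * D (D (D v)))‖ ≤ M * M + M * M := by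
    rw [D_mul]
    exact (norm_add_le _ _).trans (add_le_add (norm_mul_le_of_le h.wv3 h.v3)
      (norm_mul_le_of_le h.wv2 h.v4))
  have h6 : δ * (‖D (D v) * D (D (D v))‖ + ‖D (D (D v) * D (D (D v)))‖) ≤
      δ * (M * M + (M * M + M * M)) := by gcongr
  have h7 : (D v).wiener * ‖evenMult q g‖ ≤ M * ‖evenMult q g‖ :=
    mul_le_mul_of_nonneg_right h.wv1 (norm_nonneg _)
  have h8 : 2 * δ * ((D (D v)).wiener * ‖g‖) ≤ 2 * δ * (M * M) := by
    have := h.wv2; have := h.v4; have := h.nonneg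
    gcongr
  have h9 : M ≤ M ^ 2 := by nlinarith
  refine ((norm_add_le _ _).trans (add_le_add_right (norm_add_le _ _) _)).trans ?_
  nlinarith [mul_le_mul_of_nonneg_right h9 (norm_nonneg (evenMult q g)),
    mul_nonneg hδ (sq_nonneg M), mul_nonneg (norm_nonneg (evenMult q g)) (sq_nonneg M)]

/-- Integration by parts gives `⟪r, f * D r⟫ = -½ ⟪r, D f * r⟫`: transport terms lose no derivative.
-/
lemma abs_inner_mul_D_self_le (f r : TrigPoly) :
    |⟪r, f * D r⟫_ℝ| ≤ (D f).wiener * ‖r‖ * ‖r‖ := by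
  have h1 : ⟪r, D (f * r)⟫_ℝ = - ⟪r, f * D r⟫_ℝ := by
    rw [inner_D_right, real_inner_comm, inner_mul_left]
  rw [D_mul, inner_add_right] at h1
  have h2 := (abs_real_inner_le_norm r (D f * r)).trans
    (mul_le_mul_of_nonneg_left (norm_mul_le_wiener (D f) r) (norm_nonneg r))
  have h3 : ⟪r, f * D r⟫_ℝ = - (1 / 2) * ⟪r, D f * r⟫_ℝ := by linarith
  rw [h3, abs_mul, abs_neg, abs_of_nonneg (by norm_num)]
  nlinarith [abs_nonneg ⟪r, D f * r⟫_ℝ]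

/-- The Leibniz rule for five derivatives of `u * v` has two critical terms: `v * D (D p)`, kept on
the left to be matched with the `u`-equation, and `u * D r`, which is of transport type. The terms
with `D p` are left to the viscosity. -/
lemma energy_dispersive_v (hq : IsTailSymbol q δ) (hM : 1 ≤ M) (h : IsBdd M u v) :
    |⟪evenMult q (D (D (D (D v)))), evenMult q (D (D (D (D (D (u * v))))))⟫_ℝ -
      ⟪evenMult q (D (D (D (D v)))), v * D (D (evenMult q (D (D (D u)))))⟫_ℝ| ≤
      ‖evenMult q (D (D (D (D v))))‖ * (60 * M ^ 2 * (‖evenMult q (D (D (D u)))‖ +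
        ‖evenMult q (D (D (D (D v))))‖ + δ + ‖D (evenMult q (D (D (D u))))‖)) := by
  have hδ := hq.delta_nonneg
  have hM0 := h.nonneg
  set a := D (D (D u)) with ha
  set p := evenMult q a with hp
  set g := D (D (D (D v))) with hg
  set r := evenMult q g with hr
  have e : D (D (D (D (D (u * v))))) = v * D (D a) + (5 : ℝ) • (D v * D a) +
      (10 : ℝ) • (D (D v) * a) + (10 : ℝ) • (D (D (D v)) * D (D u)) + (5 : ℝ) • (D u * g) +
      u * D g := by
    simp only [hg, ha, D_mul, map_add, Algebra.smul_def, map_ofNat]; ring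
  set R := comm q v (D (D a)) + (5 : ℝ) • evenMult q (D v * D a) +
      (10 : ℝ) • evenMult q (D (D v) * a) + (10 : ℝ) • evenMult q (D (D (D v)) * D (D u)) +
      (5 : ℝ) • evenMult q (D u * g) + comm q u (D g) with hR
  have e2 : evenMult q (D (D (D (D (D (u * v)))))) = v * D (D p) + u * D r + R := by
    rw [e]
    simp only [map_add, map_smul]
    rw [evenMult_mul q v, evenMult_mul q u, evenMult_D q (D a), evenMult_D q a, evenMult_D q g, hR]
    abel
  -- Here `D (D a)` is the fifth derivative of `u`; the commutator bound without remainder is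
  -- essential, since `D a` is not bounded by `M`.
  have n1 : ‖comm q v (D (D a))‖ ≤ M * ‖p‖ + 2 * (M * ‖D p‖) := by
    refine (hq.norm_comm_D_D_le v a).trans ?_
    rw [one_mul]
    have := h.wv1; have := h.wv2
    gcongr
  have n2 : ‖evenMult q (D v * D a)‖ ≤ M * ‖D p‖ + (2 * M * ‖p‖ + δ * (M * M)) := by
    rw [evenMult_mul, evenMult_D]
    exact (norm_add_le _ _).trans (add_le_add (norm_mul_le_of_le h.wv1 le_rfl)
      (hq.norm_evenMult_mul_D_le h.wv2 h.wv3 h.u3))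
  have n3 := hq.norm_evenMult_mul_le h.wv2 h.wv3 h.u3
  have n4 : ‖evenMult q (D (D (D v)) * D (D u))‖ ≤ δ * (M * M + (M * M + M * M)) := by
    refine (hq.norm_evenMult_le_mul _).trans ?_
    have h1 : ‖D (D (D v)) * D (D u)‖ ≤ M * M := norm_mul_le_of_le h.wv3 h.u2
    have h2 : ‖D (D (D (D v)) * D (D u))‖ ≤ M * M + M * M := by
      rw [D_mul]
      exact (norm_add_le _ _).trans (add_le_add (norm_mul_le_of_le' h.v4 h.wu2)
        (norm_mul_le_of_le h.wv3 h.u3))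
    gcongr
  have n5 := hq.norm_evenMult_mul_le h.wu1 h.wu2 h.v4
  have n6 := hq.norm_evenMult_mul_D_le h.wu1 h.wu2 h.v4
  have nR : ‖R‖ ≤ ‖comm q v (D (D a))‖ + 5 * ‖evenMult q (D v * D a)‖ +
      10 * ‖evenMult q (D (D v) * a)‖ + 10 * ‖evenMult q (D (D (D v)) * D (D u))‖ +
      5 * ‖evenMult q (D u * g)‖ + ‖comm q u (D g)‖ := by
    refine (norm_add_le _ _).trans (add_le_add_left ?_ _)
    refine (norm_add_le _ _).trans (add_le_add ?_ (by rw [norm_smul]; norm_num))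
    refine norm_add₄_le.trans (le_of_eq ?_)
    simp only [norm_smul]; norm_num
  have t := abs_inner_mul_D_self_le u r
  have t' : (D u).wiener * ‖r‖ * ‖r‖ ≤ M * ‖r‖ * ‖r‖ := by
    have := h.wu1
    gcongr
  rw [e2, inner_add_right, inner_add_right]
  have e3 : ⟪r, v * D (D p)⟫_ℝ + ⟪r, u * D r⟫_ℝ + ⟪r, R⟫_ℝ - ⟪r, v * D (D p)⟫_ℝ =
    ⟪r, u * D r⟫_ℝ + ⟪r, R⟫_ℝ := by ring
  rw [e3]
  refine (abs_add_le _ _).trans ?_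
  have s1 := abs_real_inner_le_norm r R
  have h9 : M ≤ M ^ 2 := by nlinarith
  have key : M * ‖r‖ + ‖R‖ ≤ 60 * M ^ 2 * (‖p‖ + ‖r‖ + δ + ‖D p‖) := by
    nlinarith [mul_le_mul_of_nonneg_right h9 (norm_nonneg p),
      mul_le_mul_of_nonneg_right h9 (norm_nonneg r),
      mul_le_mul_of_nonneg_right h9 (norm_nonneg (D p)), mul_nonneg (sq_nonneg M) (norm_nonneg p),
      mul_nonneg (sq_nonneg M) (norm_nonneg r), mul_nonneg (sq_nonneg M) (norm_nonneg (D p)),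
      mul_nonneg (sq_nonneg M) hδ]
  calc _ ≤ M * ‖r‖ * ‖r‖ + ‖r‖ * ‖R‖ := add_le_add (t.trans t') s1
    _ = ‖r‖ * (M * ‖r‖ + ‖R‖) := by ring
    _ ≤ _ := mul_le_mul_of_nonneg_left key (norm_nonneg r)

/-- The top-order term `v * D r` is again a transport term; the commutator and the lower-order
products are filtered or `O(δ)`. -/
lemma energy_transport_v (hq : IsTailSymbol q δ) (hM : 1 ≤ M) (h : IsBdd M u v) :
    |⟪evenMult q (D (D (D (D v)))), evenMult q (D (D (D (D (v * D v)))))⟫_ℝ| ≤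
      ‖evenMult q (D (D (D (D v))))‖ * (60 * M ^ 2 * (‖evenMult q (D (D (D (D v))))‖ + δ)) := by
  have hδ := hq.delta_nonneg
  have hM0 := h.nonneg
  set g := D (D (D (D v))) with hg
  set r := evenMult q g with hr
  have e : D (D (D (D (v * D v)))) = v * D g + (5 : ℝ) • (D v * g) +
      (10 : ℝ) • (D (D v) * D (D (D v))) := by
    simp only [hg, D_mul, map_add, Algebra.smul_def, map_ofNat]; ring
  set R := comm q v (D g) + (5 : ℝ) • evenMult q (D v * g) +
      (10 : ℝ) • evenMult q (D (D v) * D (D (D v))) with hR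
  have e2 : evenMult q (D (D (D (D (v * D v))))) = v * D r + R := by
    rw [e]
    simp only [map_add, map_smul]
    rw [evenMult_mul q v, evenMult_D q g, hR]
    abel
  have n1 := hq.norm_evenMult_mul_D_le h.wv1 h.wv2 h.v4
  have n2 := hq.norm_evenMult_mul_le h.wv1 h.wv2 h.v4
  have n3 : ‖evenMult q (D (D v) * D (D (D v)))‖ ≤ δ * (M * M + (M * M + M * M)) := by
    refine (hq.norm_evenMult_le_mul _).trans ?_
    have h1 : ‖D (D v) * D (D (D v))‖ ≤ M * M := norm_mul_le_of_le h.wv2 h.v3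
    have h2 : ‖D (D (D v) * D (D (D v)))‖ ≤ M * M + M * M := by
      rw [D_mul]
      exact (norm_add_le _ _).trans (add_le_add (norm_mul_le_of_le h.wv3 h.v3)
        (norm_mul_le_of_le h.wv2 h.v4))
    gcongr
  have nR : ‖R‖ ≤ ‖comm q v (D g)‖ + 5 * ‖evenMult q (D v * g)‖ +
      10 * ‖evenMult q (D (D v) * D (D (D v)))‖ := by
    refine norm_add₃_le.trans (le_of_eq ?_)
    simp only [norm_smul]; norm_num
  have t := abs_inner_mul_D_self_le v r
  have t' : (D v).wiener * ‖r‖ * ‖r‖ ≤ M * ‖r‖ * ‖r‖ := by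
    have := h.wv1
    gcongr
  rw [e2, inner_add_right]
  refine (abs_add_le _ _).trans ?_
  have s1 := abs_real_inner_le_norm r R
  have h9 : M ≤ M ^ 2 := by nlinarith
  have key : M * ‖r‖ + ‖R‖ ≤ 60 * M ^ 2 * (‖r‖ + δ) := by
    nlinarith [mul_le_mul_of_nonneg_right h9 (norm_nonneg r),
      mul_nonneg (sq_nonneg M) (norm_nonneg r), mul_nonneg (sq_nonneg M) hδ]
  calc _ ≤ M * ‖r‖ * ‖r‖ + ‖r‖ * ‖R‖ := add_le_add (t.trans t') s1
    _ = ‖r‖ * (M * ‖r‖ + ‖R‖) := by ring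
    _ ≤ _ := mul_le_mul_of_nonneg_left key (norm_nonneg r)

end

/-- The difference of the two sides is `ν` times a perfect square. It is used to absorb the part
linear in `Z = ‖D p‖` into the viscosity. -/
lemma mul_mul_le_young {ν : ℝ} (hν : 0 < ν) (K Z B : ℝ) :
    K * (Z * B) ≤ ν * Z ^ 2 + K ^ 2 / (4 * ν) * B ^ 2 := by
  have : ν * Z ^ 2 + K ^ 2 / (4 * ν) * B ^ 2 - K * (Z * B) = ν * (Z - K / (2 * ν) * B) ^ 2 := by
    field_simp; ring
  have h0 : 0 ≤ ν * (Z - K / (2 * ν) * B) ^ 2 := by positivity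
  linarith

lemma add_add_sq_le (a b c : ℝ) : (a + b + c) ^ 2 ≤ 3 * (a ^ 2 + b ^ 2 + c ^ 2) := by
  nlinarith [sq_nonneg (a - b), sq_nonneg (a - c), sq_nonneg (b - c)]

/-- The high-frequency energy estimate, with the loss of derivatives in the two equations
cancelling. -/
theorem exists_energy_le {ν γ M : ℝ} (hν : 0 < ν) (hγ : 0 < γ) (hM : 1 ≤ M) :
    ∃ C : ℝ, 0 < C ∧ ∀ (q : ℕ → ℝ) (δ : ℝ) (u v : TrigPoly), IsTailSymbol q δ → IsBdd M u v →
      ⟪evenMult q (D (D (D u))), evenMult q (D (D (D (fieldU ν γ u v))))⟫_ℝ +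
        γ * ⟪evenMult q (D (D (D (D v)))), evenMult q (D (D (D (D (fieldV γ u v)))))⟫_ℝ ≤
      C * (‖evenMult q (D (D (D u)))‖ ^ 2 + ‖evenMult q (D (D (D (D v))))‖ ^ 2 + δ ^ 2) := by
  -- The number 500 dominates all coefficients collected in `hsum`; since `M ≥ 1`, the single power
  -- `M ^ 3` serves for every term.
  set K := 500 * M ^ 3 * (1 + γ) with hK
  have hK0 : 0 < K := by positivity
  -- The quotient comes from Young's inequality and the factor 3 from expanding the square of `X + Y
  -- + δ`.
  refine ⟨3 * (K ^ 2 / (4 * ν) + K), by positivity, fun q δ u v hq h => ?_⟩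
  clear_value K
  have hδ := hq.delta_nonneg
  have h1 := abs_le.1 (energy_burgers hq hM h)
  have h2 := abs_le.1 (energy_cubic hq h)
  have h3 := abs_le.1 (energy_dispersive_u hq hM h)
  have h4 := abs_le.1 (energy_dispersive_v hq hM h)
  have h5 := abs_le.1 (energy_transport_v hq hM h)
  set p := evenMult q (D (D (D u))) with hp
  set r := evenMult q (D (D (D (D v)))) with hr
  have e1 : ⟪p, evenMult q (D (D (D (D (D u)))))⟫_ℝ = - ‖D p‖ ^ 2 := by
    rw [evenMult_D, evenMult_D, inner_D_right, real_inner_self_eq_norm_sq]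
  have e2 : ⟪r, evenMult q (D (D (D (D (D (D (D v)))))))⟫_ℝ = 0 := by
    have : evenMult q (D (D (D (D (D (D (D v))))))) = D (D (D r)) := by
      rw [hr]; simp only [evenMult_D]
    rw [this, inner_D_right, inner_D_self, neg_zero]
  -- Multiplication by `v` is symmetric, so the critical terms isolated in the two equations are
  -- equal; they enter with the weights `-γ` and `γ`.
  have e3 : ⟪D (D p), v * r⟫_ℝ = ⟪r, v * D (D p)⟫_ℝ := by
    rw [real_inner_comm, inner_mul_left]
  have eF : ⟪p, evenMult q (D (D (D (fieldU ν γ u v))))⟫_ℝ =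
      -3 * ⟪p, evenMult q (D (D (D (u * D u))))⟫_ℝ
      - 6 * ⟪p, evenMult q (D (D (D (v * (v * D v)))))⟫_ℝ
      - γ * ⟪p, evenMult q (D (D (D (v * D (D (D v))))))⟫_ℝ
      + ν * ⟪p, evenMult q (D (D (D (D (D u)))))⟫_ℝ := by
    simp only [fieldU, map_add, map_sub, map_smul, inner_add_right, inner_sub_right,
      real_inner_smul_right]
  have eG : ⟪r, evenMult q (D (D (D (D (fieldV γ u v)))))⟫_ℝ =
      6 * ⟪r, evenMult q (D (D (D (D (v * D v)))))⟫_ℝ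
      + γ * ⟪r, evenMult q (D (D (D (D (D (D (D v)))))))⟫_ℝ
      + ⟪r, evenMult q (D (D (D (D (D (u * v))))))⟫_ℝ := by
    simp only [fieldV, map_add, map_smul, inner_add_right, real_inner_smul_right]
  rw [eF, eG, e1, e2]
  rw [e3] at h3
  clear_value p r
  clear eF eG e1 e2 e3 hp hr
  set X := ‖p‖
  set Y := ‖r‖
  set Z := ‖D p‖
  have hX : 0 ≤ X := norm_nonneg _
  have hY : 0 ≤ Y := norm_nonneg _
  have hZ : 0 ≤ Z := norm_nonneg _
  clear_value X Y Z
  set B := X + Y + δ with hB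
  have hB0 : 0 ≤ B := by positivity
  clear_value B
  have hM2 : M ^ 2 ≤ M ^ 3 := pow_le_pow_right₀ hM (by norm_num)
  have g1 : Z * (10 * M ^ 2 * (X + δ)) ≤ 10 * M ^ 3 * (Z * B) := by
    have : 10 * M ^ 2 * (X + δ) ≤ 10 * M ^ 3 * B := by gcongr; linarith
    nlinarith [mul_le_mul_of_nonneg_left this hZ]
  have g2 : Z * (36 * M ^ 3 * δ) ≤ 36 * M ^ 3 * (Z * B) := by
    have : 36 * M ^ 3 * δ ≤ 36 * M ^ 3 * B := by gcongr; linarith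
    nlinarith [mul_le_mul_of_nonneg_left this hZ]
  have g3 : Z * (10 * M ^ 2 * (Y + δ)) ≤ 10 * M ^ 3 * (Z * B) := by
    have : 10 * M ^ 2 * (Y + δ) ≤ 10 * M ^ 3 * B := by gcongr; linarith
    nlinarith [mul_le_mul_of_nonneg_left this hZ]
  have g4 : Y * (60 * M ^ 2 * (B + Z)) ≤ 60 * M ^ 3 * (Z * B + B ^ 2) := by
    have : 60 * M ^ 2 * (B + Z) ≤ 60 * M ^ 3 * (B + Z) := by gcongr
    have hYB : Y ≤ B := by linarith
    calc _ ≤ B * (60 * M ^ 3 * (B + Z)) := by gcongr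
      _ = _ := by ring
  have g5 : Y * (60 * M ^ 2 * (Y + δ)) ≤ 60 * M ^ 3 * B ^ 2 := by
    have : 60 * M ^ 2 * (Y + δ) ≤ 60 * M ^ 3 * B := by gcongr; linarith
    have hYB : Y ≤ B := by linarith
    calc _ ≤ B * (60 * M ^ 3 * B) := by gcongr
      _ = _ := by ring
  have hsum : -3 * ⟪p, evenMult q (D (D (D (u * D u))))⟫_ℝ
      - 6 * ⟪p, evenMult q (D (D (D (v * (v * D v)))))⟫_ℝ
      - γ * ⟪p, evenMult q (D (D (D (v * D (D (D v))))))⟫_ℝ + ν * -Z ^ 2 +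
      γ * (6 * ⟪r, evenMult q (D (D (D (D (v * D v)))))⟫_ℝ + γ * 0 +
        ⟪r, evenMult q (D (D (D (D (D (u * v))))))⟫_ℝ) ≤
      - ν * Z ^ 2 + K * (Z * B) + K * B ^ 2 := by
    have i1 := mul_le_mul_of_nonneg_left (h3.1) hγ.le
    have i2 := mul_le_mul_of_nonneg_left (h4.2) hγ.le
    have i3 := mul_le_mul_of_nonneg_left (h5.2) hγ.le
    have j3 := mul_le_mul_of_nonneg_left g3 hγ.le
    have j4 := mul_le_mul_of_nonneg_left g4 hγ.le
    have j5 := mul_le_mul_of_nonneg_left g5 hγ.le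
    have k1 : 0 ≤ M ^ 3 * (Z * B) := by positivity
    have k2 : 0 ≤ M ^ 3 * B ^ 2 := by positivity
    have k3 : 0 ≤ γ * (M ^ 3 * (Z * B)) := by positivity
    have k4 : 0 ≤ γ * (M ^ 3 * B ^ 2) := by positivity
    rw [hK]
    linarith [h1.1, h2.1]
  have hsq := mul_mul_le_young hν K Z B
  have hB2 := hB ▸ add_add_sq_le X Y δ
  have hC : 0 ≤ K ^ 2 / (4 * ν) + K := by positivity
  calc _ ≤ _ := hsum
    _ ≤ (K ^ 2 / (4 * ν) + K) * B ^ 2 := by linarith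
    _ ≤ (K ^ 2 / (4 * ν) + K) * (3 * (X ^ 2 + Y ^ 2 + δ ^ 2)) :=
      mul_le_mul_of_nonneg_left hB2 hC
    _ = _ := by ring

/-! ### Stability in `L² × H¹` and bounds for the vector field -/

/-- The Burgers and cubic differences are derivatives, as `u ∂u = ½ ∂(u²)` and `v² ∂v = ⅓ ∂(v³)`,
whence `3/2` and `2`. The dispersive difference is split so that `v₁` alone multiplies the third
derivative of `v₁ - v₂`, as the cancellation demands. -/
lemma fieldU_sub (ν γ : ℝ) (u₁ v₁ u₂ v₂ : TrigPoly) :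
    fieldU ν γ u₁ v₁ - fieldU ν γ u₂ v₂ =
      -(3 / 2 : ℝ) • D ((u₁ + u₂) * (u₁ - u₂))
      - (2 : ℝ) • D (v₁ * (v₁ * (v₁ - v₂)) + v₁ * (v₂ * (v₁ - v₂)) + v₂ * (v₂ * (v₁ - v₂)))
      - γ • (v₁ * D (D (D (v₁ - v₂)))) - γ • (D (D (D v₂)) * (v₁ - v₂))
      + ν • D (D (u₁ - u₂)) := by
  simp only [fieldU, D_mul, map_add, map_sub, Algebra.smul_def, map_ofNat, map_neg]
  have h : algebraMap ℝ TrigPoly (3 / 2) * 2 = 3 := by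
    rw [← map_ofNat (algebraMap ℝ TrigPoly) 2, ← map_mul, div_mul_cancel₀ _ two_ne_zero, map_ofNat]
  linear_combination (u₁ * D u₁ - u₂ * D u₂) * h

/-- The difference of the products `u v` is split so that `u₁ - u₂` is multiplied by `v₁`, the
coefficient of the critical term in `fieldU_sub`. -/
lemma fieldV_sub (γ : ℝ) (u₁ v₁ u₂ v₂ : TrigPoly) :
    fieldV γ u₁ v₁ - fieldV γ u₂ v₂ =
      D (((3 : ℝ) • (v₁ + v₂) + u₂) * (v₁ - v₂)) + γ • D (D (D (v₁ - v₂)))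
      + D (v₁ * (u₁ - u₂)) := by
  simp only [fieldV, D_mul, map_add, map_sub, map_smul]
  simp only [Algebra.smul_def, map_ofNat]
  ring

/-- Stability in `L² × H¹`: the terms of highest order cancel exactly. -/
theorem exists_stability_le {ν γ M : ℝ} (hν : 0 < ν) (hγ : 0 < γ) (hM : 1 ≤ M) :
    ∃ C : ℝ, 0 < C ∧ ∀ u₁ v₁ u₂ v₂ : TrigPoly, IsBdd M u₁ v₁ → IsBdd M u₂ v₂ →
      ⟪u₁ - u₂, fieldU ν γ u₁ v₁ - fieldU ν γ u₂ v₂⟫_ℝ +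
        γ * (⟪v₁ - v₂, fieldV γ u₁ v₁ - fieldV γ u₂ v₂⟫_ℝ +
          ⟪D (v₁ - v₂), D (fieldV γ u₁ v₁ - fieldV γ u₂ v₂)⟫_ℝ) ≤
      C * (‖u₁ - u₂‖ ^ 2 + ‖v₁ - v₂‖ ^ 2 + ‖D (v₁ - v₂)‖ ^ 2) := by
  obtain ⟨K, hK⟩ : ∃ K, K = 100 * M ^ 2 * (1 + γ) := ⟨_, rfl⟩
  have hK0 : 0 < K := by rw [hK]; positivity
  refine ⟨3 * (K ^ 2 / (4 * ν) + K), by positivity, fun u₁ v₁ u₂ v₂ h₁ h₂ => ?_⟩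
  rw [fieldU_sub, fieldV_sub]
  obtain ⟨w, hw⟩ : ∃ w, w = u₁ - u₂ := ⟨_, rfl⟩
  obtain ⟨z, hz⟩ : ∃ z, z = v₁ - v₂ := ⟨_, rfl⟩
  obtain ⟨b, hb⟩ : ∃ b, b = (3 : ℝ) • (v₁ + v₂) + u₂ := ⟨_, rfl⟩
  rw [← hw, ← hz, ← hb]
  have hM0 : 0 ≤ M := by linarith
  have A1 : |⟪w, D ((u₁ + u₂) * w)⟫_ℝ| ≤ ‖D w‖ * (2 * M * ‖w‖) := by
    rw [inner_D_right, abs_neg]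
    refine (abs_real_inner_le_norm _ _).trans (mul_le_mul_of_nonneg_left ?_ (norm_nonneg _))
    refine norm_mul_le_of_le ((wiener_add_le _ _).trans ?_) le_rfl
    linarith [h₁.wu0, h₂.wu0]
  have A2 : |⟪w, D (v₁ * (v₁ * z) + v₁ * (v₂ * z) + v₂ * (v₂ * z))⟫_ℝ| ≤
      ‖D w‖ * (3 * M ^ 2 * ‖z‖) := by
    rw [inner_D_right, abs_neg]
    refine (abs_real_inner_le_norm _ _).trans (mul_le_mul_of_nonneg_left ?_ (norm_nonneg _))
    have a1 := norm_mul_le_of_le h₁.wv0 (norm_mul_le_of_le h₁.wv0 (le_refl ‖z‖))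
    have a2 := norm_mul_le_of_le h₁.wv0 (norm_mul_le_of_le h₂.wv0 (le_refl ‖z‖))
    have a3 := norm_mul_le_of_le h₂.wv0 (norm_mul_le_of_le h₂.wv0 (le_refl ‖z‖))
    refine norm_add₃_le.trans ?_
    linarith
  have A4 : |⟪w, D (D (D v₂)) * z⟫_ℝ| ≤ ‖w‖ * (M * ‖z‖) :=
    (abs_real_inner_le_norm _ _).trans
      (mul_le_mul_of_nonneg_left (norm_mul_le_of_le h₂.wv3 le_rfl) (norm_nonneg _))
  have A5 : ⟪w, D (D w)⟫_ℝ = - ‖D w‖ ^ 2 := by rw [inner_D_right, real_inner_self_eq_norm_sq]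
  -- The cancellation: two integrations by parts turn the coupling in the `v`-equation into the
  -- critical term of the `u`-equation.
  have B1 : ⟪D z, D (D (v₁ * w))⟫_ℝ = ⟪w, v₁ * D (D (D z))⟫_ℝ := by
    rw [inner_D_right, inner_D_right, neg_neg, real_inner_comm, inner_mul_left]
  have B2 : |⟪z, D (v₁ * w)⟫_ℝ| ≤ ‖D z‖ * (M * ‖w‖) := by
    rw [inner_D_right, abs_neg]
    exact (abs_real_inner_le_norm _ _).trans
      (mul_le_mul_of_nonneg_left (norm_mul_le_of_le h₁.wv0 le_rfl) (norm_nonneg _))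
  have B3 : ⟪z, D (D (D z))⟫_ℝ = 0 := by rw [inner_D_right, inner_D_self, neg_zero]
  have B4 : ⟪D z, D (D (D (D z)))⟫_ℝ = 0 := by rw [inner_D_right, inner_D_self, neg_zero]
  have wb : ∀ {f₁ f₂ g : TrigPoly}, f₁.wiener ≤ M → f₂.wiener ≤ M → g.wiener ≤ M →
      ((3 : ℝ) • (f₁ + f₂) + g).wiener ≤ 7 * M := by
    intro f₁ f₂ g i1 i2 i3
    refine (wiener_add_le _ _).trans ?_
    rw [wiener_smul, abs_of_nonneg (by norm_num)]
    linarith [wiener_add_le f₁ f₂]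
  have b0 : b.wiener ≤ 7 * M := by rw [hb]; exact wb h₁.wv0 h₂.wv0 h₂.wu0
  have b1 : (D b).wiener ≤ 7 * M := by
    rw [hb, map_add, map_smul, map_add]; exact wb h₁.wv1 h₂.wv1 h₂.wu1
  have b2 : (D (D b)).wiener ≤ 7 * M := by
    rw [hb]; simp only [map_add, map_smul]; exact wb h₁.wv2 h₂.wv2 h₂.wu2
  have B5 : |⟪z, D (b * z)⟫_ℝ| ≤ ‖D z‖ * (7 * M * ‖z‖) := by
    rw [inner_D_right, abs_neg]
    exact (abs_real_inner_le_norm _ _).trans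
      (mul_le_mul_of_nonneg_left (norm_mul_le_of_le b0 le_rfl) (norm_nonneg _))
  -- Only `b * D (D z)` is critical, and against `D z` it is a transport term.
  have B6 : |⟪D z, D (D (b * z))⟫_ℝ| ≤ ‖D z‖ * (7 * M * ‖z‖ + 21 * M * ‖D z‖) := by
    have e : D (D (b * z)) = b * D (D z) + (D (D b) * z + (2 : ℝ) • (D b * D z)) := by
      simp only [D_mul, map_add, Algebra.smul_def, map_ofNat]; ring
    rw [e, inner_add_right]
    have t1 := abs_inner_mul_D_self_le b (D z)
    have t2 : (D b).wiener * ‖D z‖ * ‖D z‖ ≤ 7 * M * ‖D z‖ * ‖D z‖ := by gcongr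
    have t3 : ‖D (D b) * z + (2 : ℝ) • (D b * D z)‖ ≤ 7 * M * ‖z‖ + 2 * (7 * M * ‖D z‖) := by
      refine (norm_add_le _ _).trans (add_le_add (norm_mul_le_of_le b2 le_rfl) ?_)
      rw [norm_smul, Real.norm_of_nonneg (by norm_num)]
      exact mul_le_mul_of_nonneg_left (norm_mul_le_of_le b1 le_rfl) (by norm_num)
    have t4 := abs_real_inner_le_norm (D z) (D (D b) * z + (2 : ℝ) • (D b * D z))
    have t5 := mul_le_mul_of_nonneg_left t3 (norm_nonneg (D z))
    refine (abs_add_le _ _).trans ?_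
    linarith
  simp only [map_add D, map_smul D, inner_add_right, inner_sub_right, real_inner_smul_right,
    B1, B3, B4, A5]
  rw [map_add, map_add, inner_add_right, inner_add_right] at A2
  generalize ⟪w, D ((u₁ + u₂) * w)⟫_ℝ = a1 at *
  generalize ⟪w, D (v₁ * (v₁ * z))⟫_ℝ = a2 at *
  generalize ⟪w, D (v₁ * (v₂ * z))⟫_ℝ = a2' at *
  generalize ⟪w, D (v₂ * (v₂ * z))⟫_ℝ = a2'' at *
  generalize ⟪w, v₁ * D (D (D z))⟫_ℝ = a3 at *
  generalize ⟪w, D (D (D v₂)) * z⟫_ℝ = a4 at *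
  generalize ⟪z, D (v₁ * w)⟫_ℝ = c1 at *
  generalize ⟪z, D (b * z)⟫_ℝ = c2 at *
  generalize ⟪D z, D (D (b * z))⟫_ℝ = c3 at *
  have hX := norm_nonneg w
  have hY := norm_nonneg z
  have hW := norm_nonneg (D z)
  have hZ := norm_nonneg (D w)
  generalize ‖w‖ = X at *
  generalize ‖z‖ = Y at *
  generalize ‖D z‖ = W at *
  generalize ‖D w‖ = Z at *
  clear wb b0 b1 b2 hw hz hb h₁ h₂ B1 B3 B4 A5
  obtain ⟨B, hB⟩ : ∃ B, B = X + Y + W := ⟨_, rfl⟩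
  have hB0 : 0 ≤ B := by rw [hB]; positivity
  have hXB : X ≤ B := by linarith
  have hYB : Y ≤ B := by linarith
  have hWB : W ≤ B := by linarith
  have hM2 : M ≤ M ^ 2 := by nlinarith
  have bd : ∀ {x y : ℝ}, 0 ≤ x → 0 ≤ y → x ≤ B → y ≤ B → M * (x * y) ≤ M ^ 2 * B ^ 2 := by
    intro x y hx hy hx' hy'
    rw [sq B]
    gcongr
  have g1 : Z * (2 * M * X) ≤ 2 * (M ^ 2 * (Z * B)) := by
    calc Z * (2 * M * X) = 2 * (M * (Z * X)) := by ring
      _ ≤ _ := by gcongr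
  have g2 : Z * (3 * M ^ 2 * Y) ≤ 3 * (M ^ 2 * (Z * B)) := by
    calc Z * (3 * M ^ 2 * Y) = 3 * (M ^ 2 * (Z * Y)) := by ring
      _ ≤ _ := by gcongr
  have g4 := bd hX hY hXB hYB
  have g5 := bd hW hX hWB hXB
  have g6 := bd hW hY hWB hYB
  have g7 := bd hW hW hWB hWB
  have hsum : -(3 / 2) * a1 - 2 * (a2 + a2' + a2'') - γ * a3 - γ * a4 + ν * -Z ^ 2 +
      γ * (c2 + γ * 0 + c1 + (c3 + γ * 0 + a3)) ≤ -ν * Z ^ 2 + K * (Z * B) + K * B ^ 2 := by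
    have i1 := mul_le_mul_of_nonneg_left (abs_le.1 A4).1 hγ.le
    have i2 := mul_le_mul_of_nonneg_left (abs_le.1 B2).2 hγ.le
    have i3 := mul_le_mul_of_nonneg_left (abs_le.1 B5).2 hγ.le
    have i4 := mul_le_mul_of_nonneg_left (abs_le.1 B6).2 hγ.le
    have j4 := mul_le_mul_of_nonneg_left g4 hγ.le
    have j5 := mul_le_mul_of_nonneg_left g5 hγ.le
    have j6 := mul_le_mul_of_nonneg_left g6 hγ.le
    have j7 := mul_le_mul_of_nonneg_left g7 hγ.le
    have k1 : 0 ≤ M ^ 2 * (Z * B) := by positivity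
    have k2 : 0 ≤ M ^ 2 * B ^ 2 := by positivity
    have k3 : 0 ≤ γ * (M ^ 2 * (Z * B)) := by positivity
    have k4 : 0 ≤ γ * (M ^ 2 * B ^ 2) := by positivity
    rw [hK]
    linarith [(abs_le.1 A1).1, (abs_le.1 A2).1]
  have hsq := mul_mul_le_young hν K Z B
  have hB2 := hB ▸ add_add_sq_le X Y W
  have hC : 0 ≤ K ^ 2 / (4 * ν) + K := by positivity
  calc _ ≤ _ := hsum
    _ ≤ (K ^ 2 / (4 * ν) + K) * B ^ 2 := by linarith
    _ ≤ (K ^ 2 / (4 * ν) + K) * (3 * (X ^ 2 + Y ^ 2 + W ^ 2)) :=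
      mul_le_mul_of_nonneg_left hB2 hC
    _ = _ := by ring

/-- The nonlinear part of the equation for `v`. -/
def nonlinV (u v : TrigPoly) : TrigPoly := (6 : ℝ) • (v * D v) + D (u * v)

lemma fieldV_eq (γ : ℝ) (u v : TrigPoly) :
    fieldV γ u v = γ • D (D (D v)) + nonlinV u v := by
  rw [fieldV, nonlinV]; abel

/-- The vector field is bounded in terms of the `H³ × H⁴` norm. -/
theorem exists_field_le (ν γ M : ℝ) :
    ∃ C : ℝ, 0 < C ∧ ∀ u v : TrigPoly, IsBdd M u v → ‖fieldU ν γ u v‖ ≤ C ∧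
      ‖D (fieldU ν γ u v)‖ ≤ C ∧ ‖fieldV γ u v‖ ≤ C ∧ ‖nonlinV u v‖ ≤ C ∧
      ‖D (nonlinV u v)‖ ≤ C ∧ ‖D (D (nonlinV u v))‖ ≤ C := by
  refine ⟨1 + (100 + 100 * |γ| + |ν|) * (|M| + |M| * |M| + |M| * (|M| * |M|)), by positivity,
    fun u v h => ?_⟩
  rw [abs_of_nonneg h.nonneg]
  have hM := h.nonneg
  have hγ := abs_nonneg γ
  have hν := abs_nonneg ν
  have p1 : 0 ≤ M * M := by positivity
  have p2 : 0 ≤ M * (M * M) := by positivity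
  have p3 : 0 ≤ |γ| * M := by positivity
  have p4 : 0 ≤ |ν| * M := by positivity
  have p5 : 0 ≤ |γ| * (M * M) := by positivity
  have p6 : 0 ≤ |γ| * (M * (M * M)) := by positivity
  have p7 : 0 ≤ |ν| * (M * M) := by positivity
  have p8 : 0 ≤ |ν| * (M * (M * M)) := by positivity
  have nl : ‖nonlinV u v‖ ≤ 6 * (M * M) + (M * M + M * M) := by
    rw [nonlinV, D_mul]
    refine (norm_add_le _ _).trans (add_le_add ?_ ((norm_add_le _ _).trans (add_le_add
      (norm_mul_le_of_le h.wu1 h.v0) (norm_mul_le_of_le h.wu0 h.v1))))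
    rw [norm_smul, Real.norm_of_nonneg (by norm_num)]
    exact mul_le_mul_of_nonneg_left (norm_mul_le_of_le h.wv0 h.v1) (by norm_num)
  refine ⟨?_, ?_, ?_, ?_, ?_, ?_⟩
  · have a1 := norm_mul_le_of_le h.wu0 h.u1
    have a2 := norm_mul_le_of_le h.wv0 (norm_mul_le_of_le h.wv0 h.v1)
    have a3 := mul_le_mul_of_nonneg_left (norm_mul_le_of_le h.wv0 h.v3) hγ
    have a4 := mul_le_mul_of_nonneg_left h.u2 hν
    have e : ‖fieldU ν γ u v‖ ≤ 3 * ‖u * D u‖ + 6 * ‖v * (v * D v)‖ + |γ| * ‖v * D (D (D v))‖ +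
        |ν| * ‖D (D u)‖ := by
      rw [fieldU]
      refine (norm_add_le _ _).trans (add_le_add ((norm_sub_le _ _).trans (add_le_add
        ((norm_sub_le _ _).trans (add_le_add ?_ ?_)) ?_)) ?_) <;> simp [norm_smul]
    linarith
  · have e0 : D (fieldU ν γ u v) = -(3 : ℝ) • (D u * D u + u * D (D u))
        - (6 : ℝ) • (D v * (v * D v) + v * (D v * D v) + v * (v * D (D v)))
        - γ • (D v * D (D (D v)) + v * D (D (D (D v)))) + ν • D (D (D u)) := by
      simp only [fieldU, map_add, map_sub, map_smul, D_mul]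
      simp only [mul_add, add_assoc]
    have a1 := norm_mul_le_of_le h.wu1 h.u1
    have a1' := norm_mul_le_of_le h.wu0 h.u2
    have a2 := norm_mul_le_of_le h.wv1 (norm_mul_le_of_le h.wv0 h.v1)
    have a2' := norm_mul_le_of_le h.wv0 (norm_mul_le_of_le h.wv1 h.v1)
    have a2'' := norm_mul_le_of_le h.wv0 (norm_mul_le_of_le h.wv0 h.v2)
    have a3 := mul_le_mul_of_nonneg_left ((norm_add_le (D v * D (D (D v)))
      (v * D (D (D (D v))))).trans (add_le_add (norm_mul_le_of_le h.wv1 h.v3)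
      (norm_mul_le_of_le h.wv0 h.v4))) hγ
    have a4 := mul_le_mul_of_nonneg_left h.u3 hν
    have e : ‖D (fieldU ν γ u v)‖ ≤ 3 * (‖D u * D u‖ + ‖u * D (D u)‖) +
        6 * (‖D v * (v * D v)‖ + ‖v * (D v * D v)‖ + ‖v * (v * D (D v))‖) +
        |γ| * ‖D v * D (D (D v)) + v * D (D (D (D v)))‖ + |ν| * ‖D (D (D u))‖ := by
      rw [e0]
      refine (norm_add_le _ _).trans (add_le_add ((norm_sub_le _ _).trans (add_le_add
        ((norm_sub_le _ _).trans (add_le_add ?_ ?_)) ?_)) ?_)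
      · rw [norm_smul, norm_neg, Real.norm_of_nonneg (by norm_num)]
        exact mul_le_mul_of_nonneg_left (norm_add_le _ _) (by norm_num)
      · rw [norm_smul, Real.norm_of_nonneg (by norm_num)]
        exact mul_le_mul_of_nonneg_left norm_add₃_le (by norm_num)
      · rw [norm_smul, Real.norm_eq_abs]
      · rw [norm_smul, Real.norm_eq_abs]
    linarith
  · rw [fieldV_eq]
    have a1 := mul_le_mul_of_nonneg_left h.v3 hγ
    have e : ‖γ • D (D (D v)) + nonlinV u v‖ ≤ |γ| * ‖D (D (D v))‖ + ‖nonlinV u v‖ := by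
      refine (norm_add_le _ _).trans (le_of_eq ?_)
      rw [norm_smul, Real.norm_eq_abs]
    linarith
  · linarith
  · have e0 : D (nonlinV u v) = (6 : ℝ) • (D v * D v + v * D (D v)) +
        (D (D u) * v + (2 : ℝ) • (D u * D v) + u * D (D v)) := by
      simp only [nonlinV, map_add, map_smul, D_mul]
      simp only [Algebra.smul_def, map_ofNat]; ring
    have a1 := norm_mul_le_of_le h.wv1 h.v1
    have a2 := norm_mul_le_of_le h.wv0 h.v2
    have a3 := norm_mul_le_of_le h.wu2 h.v0
    have a4 := norm_mul_le_of_le h.wu1 h.v1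
    have a5 := norm_mul_le_of_le h.wu0 h.v2
    have e : ‖D (nonlinV u v)‖ ≤ 6 * (‖D v * D v‖ + ‖v * D (D v)‖) +
        (‖D (D u) * v‖ + 2 * ‖D u * D v‖ + ‖u * D (D v)‖) := by
      rw [e0]
      refine (norm_add_le _ _).trans (add_le_add ?_ (norm_add₃_le.trans (le_of_eq ?_)))
      · rw [norm_smul, Real.norm_of_nonneg (by norm_num)]
        exact mul_le_mul_of_nonneg_left (norm_add_le _ _) (by norm_num)
      · rw [norm_smul, Real.norm_of_nonneg (by norm_num)]
    linarith
  · have e0 : D (D (nonlinV u v)) = (6 : ℝ) • ((3 : ℝ) • (D v * D (D v)) + v * D (D (D v))) +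
        (v * D (D (D u)) + (3 : ℝ) • (D v * D (D u)) + (3 : ℝ) • (D u * D (D v)) +
          u * D (D (D v))) := by
      simp only [nonlinV, map_add, map_smul, D_mul]
      simp only [Algebra.smul_def, map_ofNat]; ring
    have a1 := norm_mul_le_of_le h.wv1 h.v2
    have a2 := norm_mul_le_of_le h.wv0 h.v3
    have a3 := norm_mul_le_of_le h.wv0 h.u3
    have a4 := norm_mul_le_of_le h.wv1 h.u2
    have a5 := norm_mul_le_of_le h.wu1 h.v2
    have a6 := norm_mul_le_of_le h.wu0 h.v3
    have e : ‖D (D (nonlinV u v))‖ ≤ 6 * (3 * ‖D v * D (D v)‖ + ‖v * D (D (D v))‖) +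
        (‖v * D (D (D u))‖ + 3 * ‖D v * D (D u)‖ + 3 * ‖D u * D (D v)‖ +
          ‖u * D (D (D v))‖) := by
      rw [e0]
      refine (norm_add_le _ _).trans (add_le_add ?_ (norm_add₄_le.trans (le_of_eq ?_)))
      · rw [norm_smul, Real.norm_of_nonneg (by norm_num)]
        refine mul_le_mul_of_nonneg_left ((norm_add_le _ _).trans (le_of_eq ?_)) (by norm_num)
        rw [norm_smul, Real.norm_of_nonneg (by norm_num)]
      · rw [norm_smul, norm_smul, Real.norm_of_nonneg (by norm_num)]
    linarith

/-- The vector field is Lipschitz on bounded sets from `H² × H³` to `L²`. -/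
theorem exists_field_sub_le (ν γ M : ℝ) :
    ∃ C : ℝ, 0 < C ∧ ∀ u₁ v₁ u₂ v₂ : TrigPoly, IsBdd M u₁ v₁ → IsBdd M u₂ v₂ →
      ‖fieldU ν γ u₁ v₁ - fieldU ν γ u₂ v₂‖ ≤ C * (‖u₁ - u₂‖ + ‖D (u₁ - u₂)‖ +
        ‖D (D (u₁ - u₂))‖ + ‖v₁ - v₂‖ + ‖D (v₁ - v₂)‖ + ‖D (D (D (v₁ - v₂)))‖) ∧
      ‖fieldV γ u₁ v₁ - fieldV γ u₂ v₂‖ ≤ C * (‖u₁ - u₂‖ + ‖D (u₁ - u₂)‖ +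
        ‖D (D (u₁ - u₂))‖ + ‖v₁ - v₂‖ + ‖D (v₁ - v₂)‖ + ‖D (D (D (v₁ - v₂)))‖) := by
  obtain ⟨K, hK⟩ : ∃ K, K = 1 + |γ| + |ν| + 100 * (1 + |γ|) * (|M| + |M| * |M|) := ⟨_, rfl⟩
  refine ⟨K, by rw [hK]; positivity, fun u₁ v₁ u₂ v₂ h₁ h₂ => ?_⟩
  have hM := h₁.nonneg
  rw [abs_of_nonneg hM] at hK
  obtain ⟨w, hw⟩ : ∃ w, w = u₁ - u₂ := ⟨_, rfl⟩
  obtain ⟨z, hz⟩ : ∃ z, z = v₁ - v₂ := ⟨_, rfl⟩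
  have eU : fieldU ν γ u₁ v₁ - fieldU ν γ u₂ v₂ =
      -(3 : ℝ) • (u₁ * D w + D u₂ * w) - (6 : ℝ) • (v₁ * (v₁ * D z) + v₁ * (D v₂ * z) +
        v₂ * (D v₂ * z)) - γ • (v₁ * D (D (D z)) + D (D (D v₂)) * z) + ν • D (D w) := by
    simp only [fieldU, hw, hz, map_sub, Algebra.smul_def, map_ofNat, map_neg]; ring
  have eV : fieldV γ u₁ v₁ - fieldV γ u₂ v₂ =
      (6 : ℝ) • (v₁ * D z + D v₂ * z) + γ • D (D (D z)) + (D v₁ * w + v₁ * D w + D u₂ * z +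
        u₂ * D z) := by
    simp only [fieldV, hw, hz, D_mul, map_sub, Algebra.smul_def, map_ofNat]; ring
  rw [eU, eV, ← hw, ← hz]
  have a1 := norm_mul_le_of_le h₁.wu0 (le_refl ‖D w‖)
  have a2 := norm_mul_le_of_le h₂.wu1 (le_refl ‖w‖)
  have a3 := norm_mul_le_of_le h₁.wv0 (norm_mul_le_of_le h₁.wv0 (le_refl ‖D z‖))
  have a4 := norm_mul_le_of_le h₁.wv0 (norm_mul_le_of_le h₂.wv1 (le_refl ‖z‖))
  have a5 := norm_mul_le_of_le h₂.wv0 (norm_mul_le_of_le h₂.wv1 (le_refl ‖z‖))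
  have a6 := norm_mul_le_of_le h₁.wv0 (le_refl ‖D (D (D z))‖)
  have a7 := norm_mul_le_of_le h₂.wv3 (le_refl ‖z‖)
  have c1 := norm_mul_le_of_le h₁.wv0 (le_refl ‖D z‖)
  have c2 := norm_mul_le_of_le h₂.wv1 (le_refl ‖z‖)
  have c3 := norm_mul_le_of_le h₁.wv1 (le_refl ‖w‖)
  have c4 := norm_mul_le_of_le h₁.wv0 (le_refl ‖D w‖)
  have c5 := norm_mul_le_of_le h₂.wu1 (le_refl ‖z‖)
  have c6 := norm_mul_le_of_le h₂.wu0 (le_refl ‖D z‖)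
  have fU : ‖-(3 : ℝ) • (u₁ * D w + D u₂ * w) - (6 : ℝ) • (v₁ * (v₁ * D z) + v₁ * (D v₂ * z) +
        v₂ * (D v₂ * z)) - γ • (v₁ * D (D (D z)) + D (D (D v₂)) * z) + ν • D (D w)‖ ≤
      3 * (‖u₁ * D w‖ + ‖D u₂ * w‖) + 6 * (‖v₁ * (v₁ * D z)‖ + ‖v₁ * (D v₂ * z)‖ +
        ‖v₂ * (D v₂ * z)‖) + |γ| * (‖v₁ * D (D (D z))‖ + ‖D (D (D v₂)) * z‖) +
        |ν| * ‖D (D w)‖ := by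
    refine (norm_add_le _ _).trans (add_le_add ((norm_sub_le _ _).trans (add_le_add
        ((norm_sub_le _ _).trans (add_le_add ?_ ?_)) ?_)) ?_)
    · rw [norm_smul, norm_neg, Real.norm_of_nonneg (by norm_num)]
      exact mul_le_mul_of_nonneg_left (norm_add_le _ _) (by norm_num)
    · rw [norm_smul, Real.norm_of_nonneg (by norm_num)]
      exact mul_le_mul_of_nonneg_left norm_add₃_le (by norm_num)
    · rw [norm_smul, Real.norm_eq_abs]
      exact mul_le_mul_of_nonneg_left (norm_add_le _ _) (abs_nonneg _)
    · rw [norm_smul, Real.norm_eq_abs]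
  have fV : ‖(6 : ℝ) • (v₁ * D z + D v₂ * z) + γ • D (D (D z)) + (D v₁ * w + v₁ * D w +
      D u₂ * z + u₂ * D z)‖ ≤ 6 * (‖v₁ * D z‖ + ‖D v₂ * z‖) + |γ| * ‖D (D (D z))‖ +
      (‖D v₁ * w‖ + ‖v₁ * D w‖ + ‖D u₂ * z‖ + ‖u₂ * D z‖) := by
    refine norm_add₃_le.trans (add_le_add (add_le_add ?_ ?_) norm_add₄_le)
    · rw [norm_smul, Real.norm_of_nonneg (by norm_num)]
      exact mul_le_mul_of_nonneg_left (norm_add_le _ _) (by norm_num)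
    · rw [norm_smul, Real.norm_eq_abs]
  have n1 := norm_nonneg w
  have n2 := norm_nonneg (D w)
  have n3 := norm_nonneg (D (D w))
  have n4 := norm_nonneg z
  have n5 := norm_nonneg (D z)
  have n6 := norm_nonneg (D (D (D z)))
  have hγ := abs_nonneg γ
  have a6' := mul_le_mul_of_nonneg_left (add_le_add a6 a7) hγ
  generalize ‖w‖ = x1 at *
  generalize ‖D w‖ = x2 at *
  generalize ‖D (D w)‖ = x3 at *
  generalize ‖z‖ = x4 at *
  generalize ‖D z‖ = x5 at *
  generalize ‖D (D (D z))‖ = x6 at *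
  have hν := abs_nonneg ν
  generalize |γ| = g at *
  generalize |ν| = n at *
  obtain ⟨S, hS⟩ : ∃ S, S = x1 + x2 + x3 + x4 + x5 + x6 := ⟨_, rfl⟩
  have l : ∀ {x : ℝ}, x ≤ S → M * x ≤ M * S := fun h => mul_le_mul_of_nonneg_left h hM
  have l2 : ∀ {x : ℝ}, x ≤ S → M * (M * x) ≤ M * (M * S) := fun h => by gcongr
  have hS0 : 0 ≤ S := by rw [hS]; positivity
  have m1 := l (show x1 ≤ S by linarith)
  have m2 := l (show x2 ≤ S by linarith)
  have m4 := l (show x4 ≤ S by linarith)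
  have m5 := l (show x5 ≤ S by linarith)
  have m6 := l (show x6 ≤ S by linarith)
  have k4 := l2 (show x4 ≤ S by linarith)
  have k5 := l2 (show x5 ≤ S by linarith)
  have m46 := mul_le_mul_of_nonneg_left (add_le_add m6 m4) hγ
  have g6 : g * x6 ≤ g * S := by gcongr; linarith
  have h3 : n * x3 ≤ n * S := by gcongr; linarith
  have q1 : 0 ≤ M * S := by positivity
  have q2 : 0 ≤ M * (M * S) := by positivity
  have q3 : 0 ≤ g * (M * S) := by positivity
  have q4 : 0 ≤ g * (M * (M * S)) := by positivity
  have q5 : 0 ≤ g * S := by positivity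
  have q6 : 0 ≤ n * S := by positivity
  rw [← hS, hK]
  constructor
  · refine fU.trans ?_
    linarith
  · refine fV.trans ?_
    linarith

/-! ### Frequency truncation -/

/-- Truncation to the frequencies `|k| ≤ N`. -/
def cut (N : ℕ) : TrigPoly →ₗ[ℝ] TrigPoly := evenMult fun n => if n ≤ N then 1 else 0

lemma co_cut (N : ℕ) (f : TrigPoly) (k : ℤ) :
    (cut N f).co k = if k.natAbs ≤ N then f.co k else 0 := by
  rw [cut, co_evenMult]
  split_ifs <;> simp

lemma cut_cut_of_le {N M : ℕ} (h : N ≤ M) (f : TrigPoly) : cut M (cut N f) = cut N f := by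
  ext k
  rw [co_cut, co_cut]
  split_ifs <;> first | rfl | omega

lemma cut_cut (N : ℕ) (f : TrigPoly) : cut N (cut N f) = cut N f := cut_cut_of_le le_rfl f

lemma cut_eq_self_of_le {N M : ℕ} (h : N ≤ M) {f : TrigPoly} (hf : cut N f = f) :
    cut M f = f := by
  rw [← hf, cut_cut_of_le h]

lemma exists_cut_eq_self (f : TrigPoly) : ∃ N, cut N f = f := by
  refine ⟨f.supp.sup Int.natAbs, ?_⟩
  ext k
  rw [co_cut]
  split_ifs with h
  · rfl
  · by_contra h'
    exact h (Finset.le_sup (f := Int.natAbs) (mem_supp.2 (Ne.symm h')))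

lemma cut_D (N : ℕ) (f : TrigPoly) : cut N (D f) = D (cut N f) := evenMult_D _ f

lemma cut_D_eq_self {N : ℕ} {f : TrigPoly} (h : cut N f = f) : cut N (D f) = D f := by
  rw [cut_D, h]

lemma evenMult_cut (q : ℕ → ℝ) (N : ℕ) (f : TrigPoly) :
    evenMult q (cut N f) = cut N (evenMult q f) := evenMult_comm _ _ f

lemma inner_cut_left (N : ℕ) (f g : TrigPoly) : ⟪cut N f, g⟫_ℝ = ⟪f, cut N g⟫_ℝ :=
  inner_evenMult_left _ f g

lemma inner_cut_right {N : ℕ} {f : TrigPoly} (hf : cut N f = f) (g : TrigPoly) :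
    ⟪f, cut N g⟫_ℝ = ⟪f, g⟫_ℝ := by
  rw [← inner_cut_left, hf]

lemma norm_cut_le (N : ℕ) (f : TrigPoly) : ‖cut N f‖ ≤ ‖f‖ := by
  have := norm_le_of_co_le (f := cut N f) (g := f) zero_le_one fun k => by
    rw [co_cut, one_mul]
    split_ifs <;> simp
  simpa using this

/-- Bernstein's inequality. -/
lemma norm_D_cut_le (N : ℕ) (f : TrigPoly) : ‖D (cut N f)‖ ≤ N * ‖f‖ :=
  norm_le_of_co_le (Nat.cast_nonneg N) fun k => by
    rw [norm_co_D, co_cut]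
    split_ifs with h
    · have : |(k : ℝ)| ≤ N := by
        rw [← Int.cast_abs, ← Nat.cast_natAbs]; exact_mod_cast h
      exact mul_le_mul_of_nonneg_right this (norm_nonneg _)
    · simp; positivity

/-- Truncation errors gain a factor `1 / N` for each derivative. -/
lemma norm_sub_cut_le (N : ℕ) (f : TrigPoly) : (N : ℝ) * ‖f - cut N f‖ ≤ ‖D f - cut N (D f)‖ := by
  have : ‖(N : ℝ) • (f - cut N f)‖ ≤ 1 * ‖D f - cut N (D f)‖ :=
    norm_le_of_co_le zero_le_one fun k => by
      rw [one_mul, co_smul, co_sub, co_sub, co_cut, co_cut]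
      split_ifs with h
      · simp
      · rw [sub_zero, sub_zero, norm_co_D, norm_mul, Complex.norm_real, Real.norm_natCast]
        have : (N : ℝ) ≤ |(k : ℝ)| := by
          rw [← Int.cast_abs, ← Nat.cast_natAbs]; push Not at h; exact_mod_cast h.le
        exact mul_le_mul_of_nonneg_right this (norm_nonneg _)
  rwa [one_mul, norm_smul, Real.norm_natCast] at this

lemma norm_sub_cut_le_norm (N : ℕ) (f : TrigPoly) : ‖f - cut N f‖ ≤ ‖f‖ := by
  have := norm_le_of_co_le (f := f - cut N f) (g := f) zero_le_one fun k => by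
    rw [co_sub, co_cut, one_mul]
    split_ifs <;> simp
  simpa using this

lemma norm_sub_cut_le_D (N : ℕ) (f : TrigPoly) : (N : ℝ) * ‖f - cut N f‖ ≤ ‖D f‖ :=
  (norm_sub_cut_le N f).trans (norm_sub_cut_le_norm N _)

lemma norm_cut_sub_cut_le {N M : ℕ} (h : N ≤ M) (f : TrigPoly) :
    ‖cut M f - cut N f‖ ≤ ‖f - cut N f‖ := by
  have : cut M f - cut N f = cut M (f - cut N f) := by rw [map_sub, cut_cut_of_le h]
  rw [this]
  exact norm_cut_le _ _

/-! ### Interpolation -/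

lemma norm_co_iterate_D (n : ℕ) (f : TrigPoly) (k : ℤ) :
    ‖(D^[n] f).co k‖ = |(k : ℝ)| ^ n * ‖f.co k‖ := by
  induction n generalizing f with
  | zero => simp
  | succ n ih => rw [Function.iterate_succ_apply, ih, norm_co_D, pow_succ, mul_assoc]

/-- Frequency by frequency, `|k|^(2j) ≤ 1 + |k|^(2n)`. -/
lemma norm_iterate_D_le {j n : ℕ} (h : j ≤ n) (f : TrigPoly) :
    ‖D^[j] f‖ ^ 2 ≤ ‖f‖ ^ 2 + ‖D^[n] f‖ ^ 2 := by
  have := norm_sq_le_of_co_sq_le (f := D^[j] f) (g := f) (h := D^[n] f) (a := 1) (b := 1)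
    fun k => by
      rw [norm_co_iterate_D, norm_co_iterate_D, one_mul, one_mul, mul_pow, mul_pow]
      have hk : (|(k : ℝ)| ^ j) ^ 2 ≤ 1 + (|(k : ℝ)| ^ n) ^ 2 := by
        rcases le_total |(k : ℝ)| 1 with h1 | h1
        · have : (|(k : ℝ)| ^ j) ^ 2 ≤ 1 := pow_le_one₀ (by positivity) (pow_le_one₀ (by positivity) h1)
          nlinarith [sq_nonneg (|(k : ℝ)| ^ n)]
        · have : (|(k : ℝ)| ^ j) ^ 2 ≤ (|(k : ℝ)| ^ n) ^ 2 := by gcongr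
          linarith
      nlinarith [mul_le_mul_of_nonneg_right hk (sq_nonneg ‖f.co k‖)]
  simpa using this

/-- The `H³ × H⁴` energy. -/
def energy (γ : ℝ) (u v : TrigPoly) : ℝ :=
  ‖u‖ ^ 2 + ‖D (D (D u))‖ ^ 2 + γ * (‖v‖ ^ 2 + ‖D (D (D (D v)))‖ ^ 2)

/-- Intermediate derivatives are interpolated between the two ends of the energy; the Wiener norm of
each derivative costs one further derivative, by the Sobolev embedding. -/
theorem exists_isBdd_of_energy_le {γ : ℝ} (hγ : 0 < γ) (R : ℝ) :
    ∃ M : ℝ, 1 ≤ M ∧ ∀ u v : TrigPoly, energy γ u v ≤ R → IsBdd M u v := by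
  obtain ⟨C, hC, hw⟩ := exists_wiener_le
  -- The summand 1 makes `A ≥ 1`, so that a square bounded by `A` has its root bounded by `A` too.
  obtain ⟨A, hA⟩ : ∃ A, A = 1 + |R| + |R| / γ := ⟨_, rfl⟩
  have hRγ : 0 ≤ |R| / γ := by positivity
  have hR0 := abs_nonneg R
  have hA1 : 1 ≤ A := by rw [hA]; linarith
  refine ⟨A + C * (A + A), by nlinarith, fun u v h => ?_⟩
  have hu : ‖u‖ ^ 2 + ‖D^[3] u‖ ^ 2 ≤ A := by
    have : 0 ≤ γ * (‖v‖ ^ 2 + ‖D (D (D (D v)))‖ ^ 2) := by positivity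
    have h' : ‖u‖ ^ 2 + ‖D (D (D u))‖ ^ 2 ≤ A := by
      rw [energy] at h
      have := le_abs_self R
      linarith
    exact h'
  have hv : ‖v‖ ^ 2 + ‖D^[4] v‖ ^ 2 ≤ A := by
    have h1 : 0 ≤ ‖u‖ ^ 2 + ‖D (D (D u))‖ ^ 2 := by positivity
    have h' : ‖v‖ ^ 2 + ‖D (D (D (D v)))‖ ^ 2 ≤ |R| / γ := by
      rw [energy] at h
      rw [le_div_iff₀ hγ]
      have := le_abs_self R
      linarith
    change ‖v‖ ^ 2 + ‖D (D (D (D v)))‖ ^ 2 ≤ A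
    linarith
  have bu : ∀ j ≤ 3, ‖D^[j] u‖ ≤ A := fun j hj => by
    have := (norm_iterate_D_le hj u).trans hu
    nlinarith [norm_nonneg (D^[j] u)]
  have bv : ∀ j ≤ 4, ‖D^[j] v‖ ≤ A := fun j hj => by
    have := (norm_iterate_D_le hj v).trans hv
    nlinarith [norm_nonneg (D^[j] v)]
  have hAM : A ≤ A + C * (A + A) := by nlinarith
  have wu : ∀ j ≤ 2, (D^[j] u).wiener ≤ A + C * (A + A) := fun j hj => by
    have h1 := hw (D^[j] u)
    have h2 := bu j (by omega)
    have h3 := bu (j + 1) (by omega)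
    rw [Function.iterate_succ_apply'] at h3
    have := mul_le_mul_of_nonneg_left (add_le_add h2 h3) hC.le
    linarith
  have wv : ∀ j ≤ 3, (D^[j] v).wiener ≤ A + C * (A + A) := fun j hj => by
    have h1 := hw (D^[j] v)
    have h2 := bv j (by omega)
    have h3 := bv (j + 1) (by omega)
    rw [Function.iterate_succ_apply'] at h3
    have := mul_le_mul_of_nonneg_left (add_le_add h2 h3) hC.le
    linarith
  exact ⟨(bu 0 (by norm_num)).trans hAM, (bu 1 (by norm_num)).trans hAM,
    (bu 2 (by norm_num)).trans hAM, (bu 3 (by norm_num)).trans hAM,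
    (bv 0 (by norm_num)).trans hAM, (bv 1 (by norm_num)).trans hAM,
    (bv 2 (by norm_num)).trans hAM, (bv 3 (by norm_num)).trans hAM,
    (bv 4 (by norm_num)).trans hAM, wu 0 (by norm_num), wu 1 (by norm_num), wu 2 (by norm_num),
    wv 0 (by norm_num), wv 1 (by norm_num), wv 2 (by norm_num), wv 3 (by norm_num)⟩

/-! ### Calculus for curves of trigonometric polynomials -/

/-- Differentiation after truncation, as a bounded operator. -/
def cutD (N : ℕ) : TrigPoly →L[ℝ] TrigPoly :=
  (D ∘ₗ cut N).mkContinuous N fun f => norm_D_cut_le N f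

lemma cutD_apply (N : ℕ) (f : TrigPoly) : cutD N f = D (cut N f) := rfl

/-- `D` is unbounded, but on curves with `N` modes it agrees with the bounded operator `cutD N`. -/
lemma hasDerivWithinAt_D {N : ℕ} {u : ℝ → TrigPoly} {u' : TrigPoly} {s : Set ℝ} {t : ℝ}
    (ht : t ∈ s) (hu : ∀ τ ∈ s, cut N (u τ) = u τ) (hu' : cut N u' = u')
    (h : HasDerivWithinAt u u' s t) : HasDerivWithinAt (fun τ => D (u τ)) (D u') s t := by
  have := (cutD N).hasFDerivAt.comp_hasDerivWithinAt t h
  rw [cutD_apply, hu'] at this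
  refine this.congr (fun τ hτ => ?_) ?_
  · rw [Function.comp_apply, cutD_apply, hu τ hτ]
  · rw [Function.comp_apply, cutD_apply, hu t ht]

lemma IsTailSymbol.hasDerivWithinAt {q : ℕ → ℝ} {δ : ℝ} (hq : IsTailSymbol q δ)
    {u : ℝ → TrigPoly} {u' : TrigPoly} {s : Set ℝ} {t : ℝ} (h : HasDerivWithinAt u u' s t) :
    HasDerivWithinAt (fun τ => evenMult q (u τ)) (evenMult q u') s t :=
  ((evenMult q).mkContinuous 1 fun f => by
    simpa using hq.norm_evenMult_le f).hasFDerivAt.comp_hasDerivWithinAt t h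

/-- Grönwall's inequality: `e t * exp (-C t) - b t` is nonincreasing, because `exp (-C t) ≤ 1`. No
sign of `e` is needed. -/
lemma le_mul_exp_of_deriv_le {e e' : ℝ → ℝ} {T C b : ℝ} (hC : 0 ≤ C) (hb : 0 ≤ b)
    (he : ∀ t ∈ Icc 0 T, HasDerivWithinAt e (e' t) (Icc 0 T) t)
    (h : ∀ t ∈ Icc 0 T, e' t ≤ C * e t + b) :
    ∀ t ∈ Icc 0 T, e t ≤ (e 0 + b * t) * Real.exp (C * t) := by
  set g : ℝ → ℝ := fun t => e t * Real.exp (-(C * t)) - b * t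
  have hg : ∀ t ∈ Icc 0 T, HasDerivWithinAt g (e' t * Real.exp (-(C * t)) +
      e t * (Real.exp (-(C * t)) * -(C * 1)) - b * 1) (Icc 0 T) t := fun t ht =>
    ((he t ht).mul ((((hasDerivAt_id t).const_mul C).neg.exp).hasDerivWithinAt)).sub
      ((hasDerivAt_id t).const_mul b).hasDerivWithinAt
  have anti : AntitoneOn g (Icc 0 T) := by
    refine antitoneOn_of_hasDerivWithinAt_nonpos (convex_Icc 0 T)
      (fun t ht => (hg t ht).continuousWithinAt)
      (fun t ht => (hg t (interior_subset ht)).mono interior_subset) fun t ht => ?_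
    have ht' := interior_subset ht
    have h1 : Real.exp (-(C * t)) ≤ 1 := by
      rw [Real.exp_le_one_iff]; have := mul_nonneg hC ht'.1; linarith
    have h2 := Real.exp_pos (-(C * t))
    nlinarith [mul_le_mul_of_nonneg_right (h t ht') h2.le, mul_le_mul_of_nonneg_left h1 hb]
  intro t ht
  have h0 : (0 : ℝ) ∈ Icc 0 T := ⟨le_rfl, ht.1.trans ht.2⟩
  have := anti h0 ht ht.1
  simp only [g, mul_zero, neg_zero, Real.exp_zero, mul_one, sub_zero] at this
  have h3 : e t * Real.exp (-(C * t)) ≤ e 0 + b * t := by linarith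
  calc e t = e t * Real.exp (-(C * t)) * Real.exp (C * t) := by
        rw [mul_assoc, ← Real.exp_add, neg_add_cancel, Real.exp_zero, mul_one]
    _ ≤ _ := mul_le_mul_of_nonneg_right h3 (Real.exp_pos _).le

/-! ### The Galerkin approximation -/

lemma cut_mul_eq_self {K L : ℕ} {f g : TrigPoly} (hf : cut K f = f) (hg : cut L g = g) :
    cut (K + L) (f * g) = f * g := by
  ext k
  rw [co_cut]
  split_ifs with h
  · rfl
  · rw [co_mul]
    refine (Finset.sum_eq_zero fun j _ => ?_).symm
    rw [← hf, ← hg, co_cut, co_cut]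
    split_ifs <;> first | omega | simp

/-- The space of trigonometric polynomials with frequencies `|k| ≤ N`. -/
def modes (N : ℕ) : Submodule ℝ TrigPoly := LinearMap.ker (cut N - LinearMap.id)

lemma mem_modes {N : ℕ} {f : TrigPoly} : f ∈ modes N ↔ cut N f = f := by
  rw [modes, LinearMap.mem_ker, LinearMap.sub_apply, LinearMap.id_apply, sub_eq_zero]

instance (N : ℕ) : FiniteDimensional ℝ (modes N) := by
  let φ : modes N →ₗ[ℝ] (Finset.Icc (-(N : ℤ)) N → ℂ) :=
    { toFun := fun f k => f.1.co k
      map_add' := fun f g => rfl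
      map_smul' := fun c f => rfl }
  refine FiniteDimensional.of_injective φ fun f g h => Subtype.ext (TrigPoly.ext fun k => ?_)
  by_cases hk : k.natAbs ≤ N
  · exact congrFun h ⟨k, Finset.mem_Icc.2 ⟨by omega, by omega⟩⟩
  · rw [← mem_modes.1 f.2, ← mem_modes.1 g.2, co_cut, co_cut, if_neg hk, if_neg hk]

/-- Truncation as a bounded operator onto the space of modes. -/
def cutModes (N : ℕ) : TrigPoly →L[ℝ] modes N :=
  ((cut N).codRestrict (modes N) fun f => mem_modes.2 (cut_cut N f)).mkContinuous 1 fun f => by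
    rw [one_mul]; exact norm_cut_le N f

lemma coe_cutModes (N : ℕ) (f : TrigPoly) : (cutModes N f : TrigPoly) = cut N f := rfl

/-- Multiplication is not bounded for the `L²` norm. Once the factors are truncated it is, by
Bernstein's inequality and the Sobolev embedding, and so it is smooth. -/
lemma exists_mulCut (K : ℕ) : ∃ B : TrigPoly →L[ℝ] TrigPoly →L[ℝ] TrigPoly,
    ∀ f g, B f g = cut K f * cut K g := by
  obtain ⟨C, hC, hw⟩ := exists_wiener_le
  refine ⟨LinearMap.mkContinuous₂ (LinearMap.mk₂ ℝ (fun f g => cut K f * cut K g)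
    (fun f f' g => by rw [map_add, add_mul]) (fun c f g => by rw [map_smul, smul_mul_assoc])
    (fun f g g' => by rw [map_add, mul_add]) (fun c f g => by rw [map_smul, mul_smul_comm]))
    (C * (1 + K)) fun f g => ?_, fun f g => rfl⟩
  rw [LinearMap.mk₂_apply]
  refine (norm_mul_le_wiener _ _).trans (mul_le_mul ?_ (norm_cut_le K g) (norm_nonneg _)
    (by positivity))
  refine (hw _).trans ?_
  rw [mul_assoc]
  refine mul_le_mul_of_nonneg_left ?_ hC.le
  linarith [norm_cut_le K f, norm_D_cut_le K f]

/-! ### Smoothness of the truncated field and of the energy. -/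

section

variable {E : Type*} [NormedAddCommGroup E] [NormedSpace ℝ E]

lemma contDiff_mul_of_cut {a b : E → TrigPoly} {K : ℕ} (ha : ContDiff ℝ ∞ a)
    (hb : ContDiff ℝ ∞ b) (hKa : ∀ x, cut K (a x) = a x) (hKb : ∀ x, cut K (b x) = b x) :
    ContDiff ℝ ∞ fun x => a x * b x := by
  obtain ⟨B, hB⟩ := exists_mulCut K
  have : (fun x => a x * b x) = fun x => B (a x) (b x) := by
    funext x; rw [hB, hKa, hKb]
  rw [this]
  exact B.isBoundedBilinearMap.contDiff.comp₂ ha hb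

lemma contDiff_D_of_cut {a : E → TrigPoly} {K : ℕ} (ha : ContDiff ℝ ∞ a)
    (hKa : ∀ x, cut K (a x) = a x) : ContDiff ℝ ∞ fun x => D (a x) := by
  have : (fun x => D (a x)) = fun x => cutD K (a x) := by
    funext x; rw [cutD_apply, hKa]
  rw [this]
  exact (cutD K).contDiff.comp ha

lemma contDiff_field {a b : E → TrigPoly} {N : ℕ} (ν γ : ℝ) (ha : ContDiff ℝ ∞ a)
    (hb : ContDiff ℝ ∞ b) (hKa : ∀ x, cut N (a x) = a x) (hKb : ∀ x, cut N (b x) = b x) :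
    (ContDiff ℝ ∞ fun x => fieldU ν γ (a x) (b x)) ∧
      ContDiff ℝ ∞ fun x => fieldV γ (a x) (b x) := by
  have a1 := contDiff_D_of_cut ha hKa
  have ka1 : ∀ x, cut N (D (a x)) = D (a x) := fun x => cut_D_eq_self (hKa x)
  have a2 := contDiff_D_of_cut a1 ka1
  have b1 := contDiff_D_of_cut hb hKb
  have kb1 : ∀ x, cut N (D (b x)) = D (b x) := fun x => cut_D_eq_self (hKb x)
  have b2 := contDiff_D_of_cut b1 kb1
  have kb2 : ∀ x, cut N (D (D (b x))) = D (D (b x)) := fun x => cut_D_eq_self (kb1 x)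
  have b3 := contDiff_D_of_cut b2 kb2
  have kb3 : ∀ x, cut N (D (D (D (b x)))) = D (D (D (b x))) := fun x => cut_D_eq_self (kb2 x)
  have c1 := contDiff_mul_of_cut hb b1 hKb kb1
  -- The inner factor `v * D v` already has frequencies up to `2N`.
  have c2 := contDiff_mul_of_cut (K := N + N) hb c1
    (fun x => cut_eq_self_of_le (Nat.le_add_right _ _) (hKb x))
    (fun x => cut_mul_eq_self (hKb x) (kb1 x))
  have d1 := contDiff_mul_of_cut ha a1 hKa ka1
  have d2 := contDiff_mul_of_cut hb b3 hKb kb3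
  have d3 := contDiff_D_of_cut (contDiff_mul_of_cut ha hb hKa hKb)
    (fun x => cut_mul_eq_self (hKa x) (hKb x))
  exact ⟨(((d1.const_smul _).sub (c2.const_smul _)).sub (d2.const_smul _)).add (a2.const_smul _),
    ((c1.const_smul _).add (b3.const_smul _)).add d3⟩

lemma contDiff_energy {a b : E → TrigPoly} {N : ℕ} (γ : ℝ) (ha : ContDiff ℝ ∞ a)
    (hb : ContDiff ℝ ∞ b) (hKa : ∀ x, cut N (a x) = a x) (hKb : ∀ x, cut N (b x) = b x) :
    ContDiff ℝ ∞ fun x => energy γ (a x) (b x) := by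
  have a1 := contDiff_D_of_cut ha hKa
  have ka1 : ∀ x, cut N (D (a x)) = D (a x) := fun x => cut_D_eq_self (hKa x)
  have a2 := contDiff_D_of_cut a1 ka1
  have a3 := contDiff_D_of_cut a2 fun x => cut_D_eq_self (ka1 x)
  have b1 := contDiff_D_of_cut hb hKb
  have kb1 : ∀ x, cut N (D (b x)) = D (b x) := fun x => cut_D_eq_self (hKb x)
  have b2 := contDiff_D_of_cut b1 kb1
  have kb2 : ∀ x, cut N (D (D (b x))) = D (D (b x)) := fun x => cut_D_eq_self (kb1 x)
  have b3 := contDiff_D_of_cut b2 kb2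
  have b4 := contDiff_D_of_cut b3 fun x => cut_D_eq_self (kb2 x)
  exact ((ha.norm_sq ℝ).add (a3.norm_sq ℝ)).add
    (contDiff_const.mul ((hb.norm_sq ℝ).add (b4.norm_sq ℝ)))

end

/-- A smooth vector field with compact support has global integral curves. -/
lemma exists_integralCurve_of_hasCompactSupport {E : Type*} [NormedAddCommGroup E]
    [NormedSpace ℝ E] [CompleteSpace E] {f : E → E} (hf : ContDiff ℝ ∞ f)
    (hc : HasCompactSupport f) (x₀ : E) {T : ℝ} (hT : 0 ≤ T) :
    ∃ y : ℝ → E, y 0 = x₀ ∧ ∀ t ∈ Icc 0 T, HasDerivWithinAt y (f (y t)) (Icc 0 T) t := by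
  obtain ⟨K, hK⟩ := ContDiff.lipschitzWith_of_hasCompactSupport hc hf (by simp)
  obtain ⟨B, hB⟩ := hf.continuous.bounded_above_of_compact_support hc
  have hB0 : 0 ≤ B := (norm_nonneg _).trans (hB x₀)
  -- At speed at most `B` a curve cannot leave the ball of radius `B * T` before time `T`, so one
  -- Picard–Lindelöf step covers the whole interval.
  have hPL : IsPicardLindelof (fun _ => f) (⟨0, le_rfl, hT⟩ : Icc (0 : ℝ) T) x₀
      (⟨B, hB0⟩ * ⟨T, hT⟩) 0 ⟨B, hB0⟩ K :=
    { lipschitzOnWith := fun t _ => hK.lipschitzOnWith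
      continuousOn := fun x _ => continuousOn_const
      norm_le := fun t _ x _ => hB x
      mul_max_le := by simp [hT]; exact le_refl (B * T) }
  exact hPL.exists_eq_forall_mem_Icc_hasDerivWithinAt₀

lemma hasDerivWithinAt_energy {N : ℕ} {u v : ℝ → TrigPoly} {u' v' : TrigPoly} {s : Set ℝ}
    {t : ℝ} (γ : ℝ) (ht : t ∈ s) (hu : ∀ τ ∈ s, cut N (u τ) = u τ) (hu' : cut N u' = u')
    (hv : ∀ τ ∈ s, cut N (v τ) = v τ) (hv' : cut N v' = v')
    (h : HasDerivWithinAt u u' s t) (h' : HasDerivWithinAt v v' s t) :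
    HasDerivWithinAt (fun τ => energy γ (u τ) (v τ))
      (2 * ⟪u t, u'⟫_ℝ + 2 * ⟪D (D (D (u t))), D (D (D u'))⟫_ℝ +
        γ * (2 * ⟪v t, v'⟫_ℝ + 2 * ⟪D (D (D (D (v t)))), D (D (D (D v')))⟫_ℝ)) s t := by
  have k1 : ∀ {f : ℝ → TrigPoly}, (∀ τ ∈ s, cut N (f τ) = f τ) →
      ∀ τ ∈ s, cut N (D (f τ)) = D (f τ) := fun hf τ hτ => cut_D_eq_self (hf τ hτ)
  have u1 := hasDerivWithinAt_D ht hu hu' h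
  have u2 := hasDerivWithinAt_D ht (k1 hu) (cut_D_eq_self hu') u1
  have u3 := hasDerivWithinAt_D ht (k1 (k1 hu)) (cut_D_eq_self (cut_D_eq_self hu')) u2
  have v1 := hasDerivWithinAt_D ht hv hv' h'
  have v2 := hasDerivWithinAt_D ht (k1 hv) (cut_D_eq_self hv') v1
  have v3 := hasDerivWithinAt_D ht (k1 (k1 hv)) (cut_D_eq_self (cut_D_eq_self hv')) v2
  have v4 := hasDerivWithinAt_D ht (k1 (k1 (k1 hv)))
    (cut_D_eq_self (cut_D_eq_self (cut_D_eq_self hv'))) v3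
  exact (h.norm_sq.add u3.norm_sq).add ((h'.norm_sq.add v4.norm_sq).const_mul γ)

lemma evenMult_one (f : TrigPoly) : evenMult (fun _ => 1) f = f := by
  ext k; simp

/-- A curve of trigonometric polynomials solving the Galerkin system with `N` modes and staying
bounded in `H³ × H⁴`. -/
structure IsGalerkin (ν γ T M : ℝ) (N : ℕ) (u v : ℝ → TrigPoly) : Prop where
  cut_u : ∀ t ∈ Icc 0 T, cut N (u t) = u t
  cut_v : ∀ t ∈ Icc 0 T, cut N (v t) = v t
  isBdd : ∀ t ∈ Icc 0 T, IsBdd M (u t) (v t)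
  deriv_u : ∀ t ∈ Icc 0 T,
    HasDerivWithinAt u (cut N (fieldU ν γ (u t) (v t))) (Icc 0 T) t
  deriv_v : ∀ t ∈ Icc 0 T,
    HasDerivWithinAt v (cut N (fieldV γ (u t) (v t))) (Icc 0 T) t

/-- The growth of the energy along the vector field is bounded on bounded sets. -/
lemma exists_energy_growth_le {ν γ M : ℝ} (hν : 0 < ν) (hγ : 0 < γ) (hM : 1 ≤ M) :
    ∃ C : ℝ, 0 < C ∧ ∀ u v : TrigPoly, IsBdd M u v →
      2 * ⟪u, fieldU ν γ u v⟫_ℝ + 2 * ⟪D (D (D u)), D (D (D (fieldU ν γ u v)))⟫_ℝ +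
        γ * (2 * ⟪v, fieldV γ u v⟫_ℝ + 2 * ⟪D (D (D (D v))), D (D (D (D (fieldV γ u v))))⟫_ℝ)
      ≤ C := by
  obtain ⟨C₁, hC₁, h₁⟩ := exists_energy_le hν hγ hM
  obtain ⟨C₂, hC₂, h₂⟩ := exists_field_le ν γ M
  refine ⟨2 * (C₁ * (M ^ 2 + M ^ 2 + 1)) + 2 * (M * C₂) + 2 * γ * (M * C₂), by positivity,
    fun u v h => ?_⟩
  have a1 := h₁ (fun _ => 1) 1 u v isTailSymbol_one h
  simp only [evenMult_one] at a1
  have a2 : C₁ * (‖D (D (D u))‖ ^ 2 + ‖D (D (D (D v)))‖ ^ 2 + 1 ^ 2) ≤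
      C₁ * (M ^ 2 + M ^ 2 + 1) := by
    have := h.u3; have := h.v4
    rw [one_pow]
    gcongr
  obtain ⟨b1, -, b2, -⟩ := h₂ u v h
  have b3 : ⟪u, fieldU ν γ u v⟫_ℝ ≤ M * C₂ :=
    (real_inner_le_norm _ _).trans (mul_le_mul h.u0 b1 (norm_nonneg _) h.nonneg)
  have b4 : ⟪v, fieldV γ u v⟫_ℝ ≤ M * C₂ :=
    (real_inner_le_norm _ _).trans (mul_le_mul h.v0 b2 (norm_nonneg _) h.nonneg)
  have b5 := mul_le_mul_of_nonneg_left b4 hγ.le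
  linarith

/-- The Galerkin system, switched off smoothly where the energy exceeds `R`. -/
lemma exists_truncated_flow (ν γ : ℝ) {R M T : ℝ} (hR : 0 < R) (hT : 0 ≤ T)
    (hbd : ∀ u v : TrigPoly, energy γ u v ≤ 2 * R → IsBdd M u v) {N : ℕ} {u₀ v₀ : TrigPoly}
    (hu₀ : cut N u₀ = u₀) (hv₀ : cut N v₀ = v₀) :
    ∃ (u v : ℝ → TrigPoly) (c : ℝ → ℝ), u 0 = u₀ ∧ v 0 = v₀ ∧ (∀ t, cut N (u t) = u t) ∧
      (∀ t, cut N (v t) = v t) ∧ (∀ t, 0 ≤ c t ∧ c t ≤ 1) ∧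
      (∀ t, c t ≠ 0 → energy γ (u t) (v t) ≤ 2 * R) ∧
      (∀ t, energy γ (u t) (v t) ≤ R → c t = 1) ∧
      (∀ t ∈ Icc 0 T, HasDerivWithinAt u (c t • cut N (fieldU ν γ (u t) (v t))) (Icc 0 T) t) ∧
      ∀ t ∈ Icc 0 T, HasDerivWithinAt v (c t • cut N (fieldV γ (u t) (v t))) (Icc 0 T) t := by
  -- The argument of the transition function is at least 1 when the energy is at most `R`, and
  -- nonpositive when the energy is at least `2 * R`.
  obtain ⟨χ, hχ⟩ : ∃ χ : modes N × modes N → ℝ,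
    χ = fun y => Real.smoothTransition (2 - energy γ y.1 y.2 / R) := ⟨_, rfl⟩
  have s1 : ContDiff ℝ ∞ fun y : modes N × modes N => (y.1 : TrigPoly) :=
    (modes N).subtypeL.contDiff.comp contDiff_fst
  have s2 : ContDiff ℝ ∞ fun y : modes N × modes N => (y.2 : TrigPoly) :=
    (modes N).subtypeL.contDiff.comp contDiff_snd
  have k1 : ∀ y : modes N × modes N, cut N (y.1 : TrigPoly) = y.1 := fun y => mem_modes.1 y.1.2
  have k2 : ∀ y : modes N × modes N, cut N (y.2 : TrigPoly) = y.2 := fun y => mem_modes.1 y.2.2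
  obtain ⟨f1, f2⟩ := contDiff_field ν γ s1 s2 k1 k2
  have hχs : ContDiff ℝ ∞ χ := by
    rw [hχ]
    exact Real.smoothTransition.contDiff.comp
      (contDiff_const.sub ((contDiff_energy γ s1 s2 k1 k2).div_const R))
  have hχ0 : ∀ y : modes N × modes N, χ y ≠ 0 → energy γ y.1 y.2 ≤ 2 * R := by
    intro y hy
    by_contra! h
    refine hy ?_
    rw [hχ]
    refine Real.smoothTransition.zero_of_nonpos ?_
    rw [sub_nonpos, le_div_iff₀ hR]
    exact h.le
  obtain ⟨Φ, hΦ⟩ : ∃ Φ : modes N × modes N → modes N × modes N, Φ = fun y =>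
    χ y • (cutModes N (fieldU ν γ y.1 y.2), cutModes N (fieldV γ y.1 y.2)) := ⟨_, rfl⟩
  have hΦs : ContDiff ℝ ∞ Φ := by
    rw [hΦ]
    exact hχs.smul (((cutModes N).contDiff.comp f1).prodMk ((cutModes N).contDiff.comp f2))
  -- Where the cutoff does not vanish, the energy bounds the `L²` norms by `M`, and closed balls are
  -- compact in the finite-dimensional space of modes.
  have hΦc : HasCompactSupport Φ := by
    refine HasCompactSupport.intro (isCompact_closedBall (0 : modes N × modes N) M) fun y hy => ?_
    by_contra h
    have hb := hbd y.1 y.2 (hχ0 y fun h0 => h (by simp only [hΦ, h0, zero_smul]))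
    refine hy ?_
    rw [mem_closedBall_zero_iff, Prod.norm_def]
    exact max_le hb.u0 hb.v0
  obtain ⟨y, hy0, hy⟩ := exists_integralCurve_of_hasCompactSupport hΦs hΦc
    (⟨u₀, mem_modes.2 hu₀⟩, ⟨v₀, mem_modes.2 hv₀⟩) hT
  refine ⟨fun t => (y t).1, fun t => (y t).2, fun t => χ (y t), by simp only [hy0],
    by simp only [hy0], fun t => k1 (y t), fun t => k2 (y t), fun t => ?_, fun t => hχ0 (y t),
    fun t ht => ?_, fun t ht => ?_, fun t ht => ?_⟩
  · rw [hχ]; exact ⟨Real.smoothTransition.nonneg _, Real.smoothTransition.le_one _⟩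
  · rw [hχ]
    refine Real.smoothTransition.one_of_one_le ?_
    have := (div_le_one hR).2 ht
    linarith
  · have := ((modes N).subtypeL ∘L ContinuousLinearMap.fst ℝ (modes N) (modes N)).hasFDerivAt
      (x := y t) |>.comp_hasDerivWithinAt t (hy t ht)
    rw [hΦ] at this
    exact this
  · have := ((modes N).subtypeL ∘L ContinuousLinearMap.snd ℝ (modes N) (modes N)).hasFDerivAt
      (x := y t) |>.comp_hasDerivWithinAt t (hy t ht)
    rw [hΦ] at this
    exact this

/-- Galerkin solutions exist on a time interval independent of the number of modes. -/
theorem exists_isGalerkin {ν γ : ℝ} (hν : 0 < ν) (hγ : 0 < γ) {R₀ : ℝ} (hR₀ : 0 ≤ R₀) :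
    ∃ T M : ℝ, 0 < T ∧ 1 ≤ M ∧ ∀ (N : ℕ) (u₀ v₀ : TrigPoly), cut N u₀ = u₀ → cut N v₀ = v₀ →
      energy γ u₀ v₀ ≤ R₀ → ∃ u v : ℝ → TrigPoly, u 0 = u₀ ∧ v 0 = v₀ ∧
        IsGalerkin ν γ T M N u v := by
  obtain ⟨R, hR⟩ : ∃ R, R = R₀ + 1 := ⟨_, rfl⟩
  have hR0 : 0 < R := by linarith
  obtain ⟨M, hM, hbd⟩ := exists_isBdd_of_energy_le hγ (2 * R)
  obtain ⟨C, hC, hgrow⟩ := exists_energy_growth_le hν hγ hM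
  -- The energy grows at rate at most `C`, so it needs at least the time `1 / C` to use up the
  -- margin 1 between `R₀` and `R`; until then the cutoff equals 1.
  refine ⟨1 / C, M, by positivity, hM, fun N u₀ v₀ hu₀ hv₀ hE => ?_⟩
  have hT0 : 0 ≤ 1 / C := by positivity
  obtain ⟨u, v, c, hu0, hv0, ku, kv, hc, hc0, hc1, du, dv⟩ :=
    exists_truncated_flow ν γ hR0 hT0 hbd hu₀ hv₀
  have key : ∀ t ∈ Icc 0 (1 / C), energy γ (u t) (v t) ≤ R := by
    intro t ht
    -- Grönwall with exponential rate 0: the energy grows at most linearly.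
    have := le_mul_exp_of_deriv_le (T := 1 / C) le_rfl hC.le (fun τ hτ =>
      hasDerivWithinAt_energy γ hτ (fun τ _ => ku τ) (by rw [map_smul, cut_cut])
        (fun τ _ => kv τ) (by rw [map_smul, cut_cut]) (du τ hτ) (dv τ hτ)) (fun τ _ => by
        have e3 : ⟪D (D (D (u τ))), D (D (D (cut N (fieldU ν γ (u τ) (v τ)))))⟫_ℝ =
            ⟪D (D (D (u τ))), D (D (D (fieldU ν γ (u τ) (v τ))))⟫_ℝ := by
          rw [← cut_D, ← cut_D, ← cut_D, inner_cut_right]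
          exact cut_D_eq_self (cut_D_eq_self (cut_D_eq_self (ku τ)))
        have e4 : ⟪D (D (D (D (v τ)))), D (D (D (D (cut N (fieldV γ (u τ) (v τ))))))⟫_ℝ =
            ⟪D (D (D (D (v τ)))), D (D (D (D (fieldV γ (u τ) (v τ)))))⟫_ℝ := by
          rw [← cut_D, ← cut_D, ← cut_D, ← cut_D, inner_cut_right]
          exact cut_D_eq_self (cut_D_eq_self (cut_D_eq_self (cut_D_eq_self (kv τ))))
        simp only [map_smul, real_inner_smul_right, inner_cut_right (ku τ), inner_cut_right (kv τ),
          e3, e4, zero_mul, zero_add]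
        -- Where the cutoff vanishes the energy is stationary; elsewhere it is at most `2 * R`, so
        -- the growth bound applies and is multiplied by a factor at most 1.
        by_cases h0 : c τ = 0
        · simp only [h0, zero_mul, mul_zero, add_zero]; exact hC.le
        · have hg := mul_le_mul_of_nonneg_left (hgrow _ _ (hbd (u τ) (v τ) (hc0 τ h0))) (hc τ).1
          have := mul_le_mul_of_nonneg_right (hc τ).2 hC.le
          linarith) t ht
    rw [zero_mul, Real.exp_zero, mul_one, hu0, hv0] at this
    have h2 : C * t ≤ 1 := by
      have := mul_le_mul_of_nonneg_left ht.2 hC.le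
      rwa [mul_one_div_cancel hC.ne'] at this
    linarith
  refine ⟨u, v, hu0, hv0, fun t _ => ku t, fun t _ => kv t, fun t ht => hbd _ _ ?_,
    fun t ht => ?_, fun t ht => ?_⟩
  · linarith [key t ht]
  · have := du t ht
    rwa [hc1 t (key t ht), one_smul] at this
  · have := dv t ht
    rwa [hc1 t (key t ht), one_smul] at this

/-! ### Tightness and stability of Galerkin solutions -/

/-- The high-frequency part of the energy. -/
def tailEnergy (q : ℕ → ℝ) (γ : ℝ) (u v : TrigPoly) : ℝ :=
  ‖evenMult q (D (D (D u)))‖ ^ 2 + γ * ‖evenMult q (D (D (D (D v))))‖ ^ 2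

lemma add_le_mul_add {γ a b : ℝ} (hγ : 0 < γ) (ha : 0 ≤ a) (hb : 0 ≤ b) :
    a + b ≤ (1 + 1 / γ) * (a + γ * b) := by
  have : (1 + 1 / γ) * (a + γ * b) = a + b + (γ * b + a / γ) := by field_simp; ring
  rw [this]
  have : 0 ≤ γ * b + a / γ := by positivity
  linarith

/-- Grönwall applied to the filtered energy estimate. The constant depends neither on the symbol nor
on the number of modes, so tails that are small initially stay small. -/
theorem exists_tailEnergy_le {ν γ M T : ℝ} (hν : 0 < ν) (hγ : 0 < γ) (hM : 1 ≤ M) (hT : 0 ≤ T) :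
    ∃ C : ℝ, 0 < C ∧ ∀ (q : ℕ → ℝ) (δ : ℝ) (N : ℕ) (u v : ℝ → TrigPoly), IsTailSymbol q δ →
      IsGalerkin ν γ T M N u v → ∀ t ∈ Icc 0 T,
        tailEnergy q γ (u t) (v t) ≤ C * (tailEnergy q γ (u 0) (v 0) + δ ^ 2) := by
  obtain ⟨C, hC, hen⟩ := exists_energy_le hν hγ hM
  obtain ⟨A, hA⟩ : ∃ A, A = 2 * C * (1 + 1 / γ) := ⟨_, rfl⟩
  have hA0 : 0 ≤ A := by rw [hA]; positivity
  refine ⟨(1 + 2 * C * T) * Real.exp (A * T), by positivity, fun q δ N u v hq h t ht => ?_⟩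
  have k1 : ∀ {f : ℝ → TrigPoly}, (∀ τ ∈ Icc 0 T, cut N (f τ) = f τ) →
      ∀ τ ∈ Icc 0 T, cut N (D (f τ)) = D (f τ) := fun hf τ hτ => cut_D_eq_self (hf τ hτ)
  have hd : ∀ τ ∈ Icc 0 T, HasDerivWithinAt (fun τ => tailEnergy q γ (u τ) (v τ))
      (2 * ⟪evenMult q (D (D (D (u τ)))),
        evenMult q (D (D (D (cut N (fieldU ν γ (u τ) (v τ))))))⟫_ℝ +
      γ * (2 * ⟪evenMult q (D (D (D (D (v τ))))),
        evenMult q (D (D (D (D (cut N (fieldV γ (u τ) (v τ)))))))⟫_ℝ)) (Icc 0 T) τ := by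
    intro τ hτ
    have cu := cut_cut N (fieldU ν γ (u τ) (v τ))
    have cv := cut_cut N (fieldV γ (u τ) (v τ))
    have u1 := hasDerivWithinAt_D hτ h.cut_u cu (h.deriv_u τ hτ)
    have u2 := hasDerivWithinAt_D hτ (k1 h.cut_u) (cut_D_eq_self cu) u1
    have u3 := hasDerivWithinAt_D hτ (k1 (k1 h.cut_u)) (cut_D_eq_self (cut_D_eq_self cu)) u2
    have v1 := hasDerivWithinAt_D hτ h.cut_v cv (h.deriv_v τ hτ)
    have v2 := hasDerivWithinAt_D hτ (k1 h.cut_v) (cut_D_eq_self cv) v1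
    have v3 := hasDerivWithinAt_D hτ (k1 (k1 h.cut_v)) (cut_D_eq_self (cut_D_eq_self cv)) v2
    have v4 := hasDerivWithinAt_D hτ (k1 (k1 (k1 h.cut_v)))
      (cut_D_eq_self (cut_D_eq_self (cut_D_eq_self cv))) v3
    exact (hq.hasDerivWithinAt u3).norm_sq.add ((hq.hasDerivWithinAt v4).norm_sq.const_mul γ)
  have hb : 0 ≤ 2 * C * δ ^ 2 := by positivity
  have main := le_mul_exp_of_deriv_le hA0 hb hd (fun τ hτ => by
    -- The truncation commutes with the filter and with `D` and is symmetric, so it disappears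
    -- against a function with `N` modes: the Galerkin projection preserves the energy estimate.
    have e3 : ⟪evenMult q (D (D (D (u τ)))),
        evenMult q (D (D (D (cut N (fieldU ν γ (u τ) (v τ))))))⟫_ℝ =
        ⟪evenMult q (D (D (D (u τ)))), evenMult q (D (D (D (fieldU ν γ (u τ) (v τ)))))⟫_ℝ := by
      rw [← cut_D, ← cut_D, ← cut_D, evenMult_cut, inner_cut_right]
      rw [← evenMult_cut, k1 (k1 (k1 h.cut_u)) τ hτ]
    have e4 : ⟪evenMult q (D (D (D (D (v τ))))),
        evenMult q (D (D (D (D (cut N (fieldV γ (u τ) (v τ)))))))⟫_ℝ =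
        ⟪evenMult q (D (D (D (D (v τ))))),
          evenMult q (D (D (D (D (fieldV γ (u τ) (v τ))))))⟫_ℝ := by
      rw [← cut_D, ← cut_D, ← cut_D, ← cut_D, evenMult_cut, inner_cut_right]
      rw [← evenMult_cut, k1 (k1 (k1 (k1 h.cut_v))) τ hτ]
    rw [e3, e4]
    have := hen q δ (u τ) (v τ) hq (h.isBdd τ hτ)
    have h2 : C * (‖evenMult q (D (D (D (u τ))))‖ ^ 2 +
        ‖evenMult q (D (D (D (D (v τ)))))‖ ^ 2) ≤ C * (1 + 1 / γ) * tailEnergy q γ (u τ) (v τ) := by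
      rw [mul_assoc, tailEnergy]
      refine mul_le_mul_of_nonneg_left ?_ hC.le
      exact add_le_mul_add hγ (sq_nonneg _) (sq_nonneg _)
    rw [hA]
    linarith) t ht
  have h0 : 0 ≤ tailEnergy q γ (u 0) (v 0) := by unfold tailEnergy; positivity
  calc tailEnergy q γ (u t) (v t) ≤ _ := main
    _ ≤ (tailEnergy q γ (u 0) (v 0) + 2 * C * δ ^ 2 * T) * Real.exp (A * T) := by
        gcongr
        · exact ht.2
        · exact ht.2
    _ ≤ ((1 + 2 * C * T) * (tailEnergy q γ (u 0) (v 0) + δ ^ 2)) * Real.exp (A * T) := by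
        refine mul_le_mul_of_nonneg_right ?_ (Real.exp_pos _).le
        have : 0 ≤ 2 * C * T * tailEnergy q γ (u 0) (v 0) := by positivity
        nlinarith [sq_nonneg δ]
    _ = _ := by ring

/-- Curves with `N` modes that solve the Galerkin system up to an error `ε` in `L² × H¹`. -/
structure IsApprox (ν γ T M ε : ℝ) (N : ℕ) (u v : ℝ → TrigPoly) : Prop where
  cut_u : ∀ t ∈ Icc 0 T, cut N (u t) = u t
  cut_v : ∀ t ∈ Icc 0 T, cut N (v t) = v t
  isBdd : ∀ t ∈ Icc 0 T, IsBdd M (u t) (v t)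
  deriv : ∀ t ∈ Icc 0 T, ∃ r s : TrigPoly, cut N r = r ∧ cut N s = s ∧ ‖r‖ ≤ ε ∧ ‖s‖ ≤ ε ∧
    ‖D s‖ ≤ ε ∧ HasDerivWithinAt u (cut N (fieldU ν γ (u t) (v t)) + r) (Icc 0 T) t ∧
    HasDerivWithinAt v (cut N (fieldV γ (u t) (v t)) + s) (Icc 0 T) t

/-- The `L² × H¹` distance, with the weight adapted to the system. -/
def lowEnergy (γ : ℝ) (w z : TrigPoly) : ℝ := ‖w‖ ^ 2 + γ * (‖z‖ ^ 2 + ‖D z‖ ^ 2)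

lemma lowEnergy_nonneg {γ : ℝ} (hγ : 0 < γ) (w z : TrigPoly) : 0 ≤ lowEnergy γ w z := by
  unfold lowEnergy; positivity

lemma inner_sub_le_of_norm_le {f r₁ r₂ : TrigPoly} {ε : ℝ} (h₁ : ‖r₁‖ ≤ ε) (h₂ : ‖r₂‖ ≤ ε) :
    2 * ⟪f, r₁ - r₂⟫_ℝ ≤ 2 * ‖f‖ ^ 2 + 2 * ε ^ 2 := by
  have h3 : ‖r₁ - r₂‖ ≤ 2 * ε := (norm_sub_le _ _).trans (by linarith)
  have h4 := (real_inner_le_norm f (r₁ - r₂)).trans (mul_le_mul_of_nonneg_left h3 (norm_nonneg f))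
  nlinarith [sq_nonneg (‖f‖ - ε)]

/-- Grönwall applied to the stability estimate. The residuals `r`, `s` enter through `2⟪f, r₁ - r₂⟫
≤ 2‖f‖² + 2ε²`, which accounts for the summand 2 in the rate `A`. -/
theorem exists_lowEnergy_le {ν γ M T : ℝ} (hν : 0 < ν) (hγ : 0 < γ) (hM : 1 ≤ M) (hT : 0 ≤ T) :
    ∃ C : ℝ, 0 < C ∧ ∀ (ε : ℝ) (N : ℕ) (u₁ v₁ u₂ v₂ : ℝ → TrigPoly),
      IsApprox ν γ T M ε N u₁ v₁ → IsApprox ν γ T M ε N u₂ v₂ → ∀ t ∈ Icc 0 T,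
        lowEnergy γ (u₁ t - u₂ t) (v₁ t - v₂ t) ≤
          C * (lowEnergy γ (u₁ 0 - u₂ 0) (v₁ 0 - v₂ 0) + ε ^ 2) := by
  obtain ⟨C, hC, hst⟩ := exists_stability_le hν hγ hM
  obtain ⟨A, hA⟩ : ∃ A, A = 2 * C * (1 + 1 / γ) + 2 := ⟨_, rfl⟩
  have hA0 : 0 ≤ A := by rw [hA]; positivity
  refine ⟨(1 + (2 + 4 * γ) * T) * Real.exp (A * T), by positivity,
    fun ε N u₁ v₁ u₂ v₂ h₁ h₂ t ht => ?_⟩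
  choose! r₁ s₁ cr₁ cs₁ nr₁ ns₁ nDs₁ du₁ dv₁ using h₁.deriv
  choose! r₂ s₂ cr₂ cs₂ nr₂ ns₂ nDs₂ du₂ dv₂ using h₂.deriv
  have kw : ∀ τ ∈ Icc 0 T, cut N (u₁ τ - u₂ τ) = u₁ τ - u₂ τ := fun τ hτ => by
    rw [map_sub, h₁.cut_u τ hτ, h₂.cut_u τ hτ]
  have kz : ∀ τ ∈ Icc 0 T, cut N (v₁ τ - v₂ τ) = v₁ τ - v₂ τ := fun τ hτ => by
    rw [map_sub, h₁.cut_v τ hτ, h₂.cut_v τ hτ]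
  have eV : ∀ τ, cut N (fieldV γ (u₁ τ) (v₁ τ)) + s₁ τ - (cut N (fieldV γ (u₂ τ) (v₂ τ)) + s₂ τ) =
      cut N (fieldV γ (u₁ τ) (v₁ τ) - fieldV γ (u₂ τ) (v₂ τ)) + (s₁ τ - s₂ τ) := fun τ => by
    rw [map_sub]; abel
  have eU : ∀ τ, cut N (fieldU ν γ (u₁ τ) (v₁ τ)) + r₁ τ -
      (cut N (fieldU ν γ (u₂ τ) (v₂ τ)) + r₂ τ) =
      cut N (fieldU ν γ (u₁ τ) (v₁ τ) - fieldU ν γ (u₂ τ) (v₂ τ)) + (r₁ τ - r₂ τ) := fun τ => by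
    rw [map_sub]; abel
  have hd : ∀ τ ∈ Icc 0 T, HasDerivWithinAt
      (fun τ => lowEnergy γ (u₁ τ - u₂ τ) (v₁ τ - v₂ τ))
      (2 * ⟪u₁ τ - u₂ τ, cut N (fieldU ν γ (u₁ τ) (v₁ τ) - fieldU ν γ (u₂ τ) (v₂ τ)) +
        (r₁ τ - r₂ τ)⟫_ℝ + γ * (2 * ⟪v₁ τ - v₂ τ,
        cut N (fieldV γ (u₁ τ) (v₁ τ) - fieldV γ (u₂ τ) (v₂ τ)) + (s₁ τ - s₂ τ)⟫_ℝ +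
        2 * ⟪D (v₁ τ - v₂ τ), D (cut N (fieldV γ (u₁ τ) (v₁ τ) - fieldV γ (u₂ τ) (v₂ τ)) +
        (s₁ τ - s₂ τ))⟫_ℝ)) (Icc 0 T) τ := by
    intro τ hτ
    have dz := (dv₁ τ hτ).sub (dv₂ τ hτ)
    have dw := (du₁ τ hτ).sub (du₂ τ hτ)
    rw [eV] at dz
    rw [eU] at dw
    have dDz := hasDerivWithinAt_D hτ kz
      (by rw [map_add, cut_cut, map_sub (cut N) (s₁ τ), cs₁ τ hτ, cs₂ τ hτ]) dz
    exact dw.norm_sq.add ((dz.norm_sq.add dDz.norm_sq).const_mul γ)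
  have hb : 0 ≤ (2 + 4 * γ) * ε ^ 2 := by positivity
  have main := le_mul_exp_of_deriv_le hA0 hb hd (fun τ hτ => by
    have st := hst _ _ _ _ (h₁.isBdd τ hτ) (h₂.isBdd τ hτ)
    rw [map_add, ← cut_D]
    simp only [inner_add_right]
    rw [inner_cut_right (kw τ hτ), inner_cut_right (kz τ hτ),
      inner_cut_right (cut_D_eq_self (kz τ hτ)), map_sub D (s₁ τ)]
    have i1 := inner_sub_le_of_norm_le (f := u₁ τ - u₂ τ) (nr₁ τ hτ) (nr₂ τ hτ)
    have i2 := mul_le_mul_of_nonneg_left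
      (inner_sub_le_of_norm_le (f := v₁ τ - v₂ τ) (ns₁ τ hτ) (ns₂ τ hτ)) hγ.le
    have i3 := mul_le_mul_of_nonneg_left
      (inner_sub_le_of_norm_le (f := D (v₁ τ - v₂ τ)) (nDs₁ τ hτ) (nDs₂ τ hτ)) hγ.le
    have h2 : C * (‖u₁ τ - u₂ τ‖ ^ 2 + (‖v₁ τ - v₂ τ‖ ^ 2 + ‖D (v₁ τ - v₂ τ)‖ ^ 2)) ≤
        C * (1 + 1 / γ) * lowEnergy γ (u₁ τ - u₂ τ) (v₁ τ - v₂ τ) := by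
      rw [mul_assoc, lowEnergy]
      exact mul_le_mul_of_nonneg_left (add_le_mul_add hγ (by positivity) (by positivity)) hC.le
    have h3 : lowEnergy γ (u₁ τ - u₂ τ) (v₁ τ - v₂ τ) = ‖u₁ τ - u₂ τ‖ ^ 2 +
      γ * (‖v₁ τ - v₂ τ‖ ^ 2 + ‖D (v₁ τ - v₂ τ)‖ ^ 2) := rfl
    rw [hA]
    linarith) t ht
  have h0 := lowEnergy_nonneg hγ (u₁ 0 - u₂ 0) (v₁ 0 - v₂ 0)
  calc _ ≤ _ := main
    _ ≤ (lowEnergy γ (u₁ 0 - u₂ 0) (v₁ 0 - v₂ 0) + (2 + 4 * γ) * ε ^ 2 * T) *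
        Real.exp (A * T) := by
        gcongr
        · exact ht.2
        · exact ht.2
    _ ≤ ((1 + (2 + 4 * γ) * T) * (lowEnergy γ (u₁ 0 - u₂ 0) (v₁ 0 - v₂ 0) + ε ^ 2)) *
        Real.exp (A * T) := by
        refine mul_le_mul_of_nonneg_right ?_ (Real.exp_pos _).le
        have : 0 ≤ (2 + 4 * γ) * T * lowEnergy γ (u₁ 0 - u₂ 0) (v₁ 0 - v₂ 0) := by positivity
        nlinarith [sq_nonneg ε]
    _ = _ := by ring

/-- A Galerkin solution solves the systems with more modes approximately. -/
theorem exists_isApprox_of_isGalerkin (ν γ M : ℝ) :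
    ∃ C : ℝ, 0 < C ∧ ∀ (T : ℝ) (N N' : ℕ) (u v : ℝ → TrigPoly), IsGalerkin ν γ T M N u v →
      0 < N → N ≤ N' → ∀ ε, C / N ≤ ε → IsApprox ν γ T M ε N' u v := by
  obtain ⟨C, hC, hF⟩ := exists_field_le ν γ M
  refine ⟨C, hC, fun T N N' u v h hN hNN' ε hε => ⟨fun t ht => cut_eq_self_of_le hNN' (h.cut_u t ht),
    fun t ht => cut_eq_self_of_le hNN' (h.cut_v t ht), h.isBdd, fun t ht => ?_⟩⟩
  obtain ⟨-, b1, -, -, b2, b3⟩ := hF _ _ (h.isBdd t ht)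
  have hN0 : (0 : ℝ) < N := by exact_mod_cast hN
  have bd : ∀ {f : TrigPoly}, ‖D f‖ ≤ C → ‖cut N f - cut N' f‖ ≤ ε := fun {f} hf => by
    refine le_trans ?_ hε
    rw [norm_sub_rev, le_div_iff₀ hN0, mul_comm]
    refine (mul_le_mul_of_nonneg_left (norm_cut_sub_cut_le hNN' f) hN0.le).trans ?_
    exact (norm_sub_cut_le_D N f).trans hf
  have hv3 : cut N (D (D (D (v t)))) = D (D (D (v t))) :=
    cut_D_eq_self (cut_D_eq_self (cut_D_eq_self (h.cut_v t ht)))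
  -- The third-order term is linear and already has only `N` modes, so it cancels. The nonlinear
  -- part has two bounded derivatives, enough for an `O(1/N)` error in `H¹`.
  have eV : cut N (fieldV γ (u t) (v t)) - cut N' (fieldV γ (u t) (v t)) =
      cut N (nonlinV (u t) (v t)) - cut N' (nonlinV (u t) (v t)) := by
    rw [fieldV_eq, map_add, map_add, map_smul, map_smul, hv3, cut_eq_self_of_le hNN' hv3]
    abel
  refine ⟨cut N (fieldU ν γ (u t) (v t)) - cut N' (fieldU ν γ (u t) (v t)),
    cut N (fieldV γ (u t) (v t)) - cut N' (fieldV γ (u t) (v t)), ?_, ?_, bd b1, ?_, ?_, ?_, ?_⟩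
  · rw [map_sub, cut_cut, cut_cut_of_le hNN']
  · rw [map_sub, cut_cut, cut_cut_of_le hNN']
  · rw [eV]; exact bd b2
  · rw [eV, map_sub, ← cut_D, ← cut_D]; exact bd b3
  · rw [add_sub_cancel]; exact h.deriv_u t ht
  · rw [add_sub_cancel]; exact h.deriv_v t ht

/-- The frequencies are split at `δ |k| = 1`. Above, the symbol is at least `1/2`, so `4 q² ≥ 1`;
below, `|k|^n ≤ δ^(-n)`. -/
lemma norm_sq_iterate_D_le_highPass {δ : ℝ} (hδ : 0 < δ) (n : ℕ) (f : TrigPoly) :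
    ‖D^[n] f‖ ^ 2 ≤ 4 * ‖evenMult (highPass δ) (D^[n] f)‖ ^ 2 + (1 / δ ^ n) ^ 2 * ‖f‖ ^ 2 := by
  refine norm_sq_le_of_co_sq_le fun k => ?_
  rw [co_evenMult, norm_mul, Complex.norm_real, mul_pow, Real.norm_eq_abs, sq_abs]
  by_cases hk : 1 ≤ δ * |(k : ℝ)|
  · have hq : 1 / 2 ≤ highPass δ k.natAbs := by
      rw [highPass_natAbs, ← sq_abs (k : ℝ), div_le_div_iff₀ (by norm_num) (by positivity)]
      nlinarith
    have : 1 ≤ 4 * highPass δ k.natAbs ^ 2 := by nlinarith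
    nlinarith [mul_le_mul_of_nonneg_right this (sq_nonneg ‖(D^[n] f).co k‖),
      mul_nonneg (sq_nonneg (1 / δ ^ n)) (sq_nonneg ‖f.co k‖)]
  · have hk' : |(k : ℝ)| ≤ 1 / δ := by
      rw [le_div_iff₀ hδ]; push Not at hk; linarith
    have h1 : ‖(D^[n] f).co k‖ ^ 2 ≤ (1 / δ ^ n) ^ 2 * ‖f.co k‖ ^ 2 := by
      rw [norm_co_iterate_D, mul_pow, ← one_div_pow]
      gcongr
    nlinarith [mul_nonneg (sq_nonneg (highPass δ k.natAbs)) (sq_nonneg ‖(D^[n] f).co k‖)]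

/-! ### Convergence of Galerkin solutions -/

/-- `f` and `g` are at most `ε` in size in `H³` and `H⁴`. -/
structure IsSmall (ε : ℝ) (f g : TrigPoly) : Prop where
  f0 : ‖f‖ ≤ ε
  f3 : ‖D (D (D f))‖ ≤ ε
  g0 : ‖g‖ ≤ ε
  g4 : ‖D (D (D (D g)))‖ ≤ ε

section

variable {ν γ M T : ℝ} {U V : ℕ → ℝ → TrigPoly}

/-- At time 0 every datum is close to the fixed polynomial datum of index `N₀`, whose filtered part
is `O(δ)`; so the initial tails are uniformly small, and `exists_tailEnergy_le` propagates this. -/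
lemma exists_tailEnergy_le_of_cauchy (hν : 0 < ν) (hγ : 0 < γ) (hM : 1 ≤ M) (hT : 0 ≤ T)
    (hG : ∀ N, IsGalerkin ν γ T M N (U N) (V N))
    (h0 : ∀ ε > 0, ∃ N₀, ∀ N ≥ N₀, ∀ N' ≥ N₀, IsSmall ε (U N 0 - U N' 0) (V N 0 - V N' 0))
    {η : ℝ} (hη : 0 < η) : ∃ δ > 0, ∃ N₀, ∀ N ≥ N₀, ∀ t ∈ Icc 0 T,
      tailEnergy (highPass δ) γ (U N t) (V N t) ≤ η := by
  obtain ⟨C, hC, htail⟩ := exists_tailEnergy_le hν hγ hM hT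
  obtain ⟨x, hx⟩ : ∃ x, x = √(η / (C * (4 * (1 + γ) + 1))) := ⟨_, rfl⟩
  have hx0 : 0 < x := by rw [hx]; positivity
  have hx2 : C * ((1 + γ) * (2 * x) ^ 2 + x ^ 2) = η := by
    have : x ^ 2 = η / (C * (4 * (1 + γ) + 1)) := by rw [hx, Real.sq_sqrt (by positivity)]
    rw [mul_pow, this]
    field_simp
    ring
  obtain ⟨N₀, hN₀⟩ := h0 x hx0
  obtain ⟨B, hB⟩ : ∃ B, B = ‖D (D (D (U N₀ 0)))‖ + ‖D (D (D (D (U N₀ 0))))‖ +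
    (‖D (D (D (D (V N₀ 0))))‖ + ‖D (D (D (D (D (V N₀ 0)))))‖) := ⟨_, rfl⟩
  have hB0 : 0 ≤ B := by rw [hB]; positivity
  -- Since `δ * B + δ = x`, both `δ * B` and `δ` are at most `x`; the first handles the tail of the
  -- fixed datum, the second the error `δ ^ 2`.
  obtain ⟨δ, hδ⟩ : ∃ δ, δ = x / (B + 1) := ⟨_, rfl⟩
  have hδ0 : 0 < δ := by rw [hδ]; positivity
  have hδB : δ * B + δ = x := by rw [hδ]; field_simp
  have hδx : δ * B ≤ x := by linarith
  have hδx' : δ ≤ x := by nlinarith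
  have hq := isTailSymbol_highPass hδ0.le
  refine ⟨δ, hδ0, N₀, fun N hN t ht => ?_⟩
  refine (htail _ δ N _ _ hq (hG N) t ht).trans ?_
  rw [← hx2]
  have hs := hN₀ N hN N₀ le_rfl
  have key : ∀ {f g : TrigPoly}, ‖f - g‖ ≤ x → ‖g‖ + ‖D g‖ ≤ B →
      ‖evenMult (highPass δ) f‖ ≤ 2 * x := by
    intro f g h1 h2
    have e : evenMult (highPass δ) f = evenMult (highPass δ) (f - g) + evenMult (highPass δ) g := by
      rw [map_sub]; abel
    rw [e]
    have a1 := hq.norm_evenMult_le (f - g)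
    have a2 := hq.norm_evenMult_le_mul g
    have a3 := mul_le_mul_of_nonneg_left h2 hδ0.le
    linarith [norm_add_le (evenMult (highPass δ) (f - g)) (evenMult (highPass δ) g)]
  have k1 : ‖evenMult (highPass δ) (D (D (D (U N 0))))‖ ≤ 2 * x := by
    refine key (g := D (D (D (U N₀ 0)))) ?_ ?_
    · simpa only [map_sub] using hs.f3
    · rw [hB]; linarith [norm_nonneg (D (D (D (D (V N₀ 0))))), norm_nonneg (D (D (D (D (D (V N₀ 0))))))]
  have k2 : ‖evenMult (highPass δ) (D (D (D (D (V N 0)))))‖ ≤ 2 * x := by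
    refine key (g := D (D (D (D (V N₀ 0))))) ?_ ?_
    · simpa only [map_sub] using hs.g4
    · rw [hB]; linarith [norm_nonneg (D (D (D (U N₀ 0)))), norm_nonneg (D (D (D (D (U N₀ 0)))))]
  have k3 : tailEnergy (highPass δ) γ (U N 0) (V N 0) ≤ (1 + γ) * (2 * x) ^ 2 := by
    rw [tailEnergy, add_mul, one_mul]
    gcongr
  gcongr

lemma lowEnergy_sub_comm (γ : ℝ) (a b c d : TrigPoly) :
    lowEnergy γ (a - b) (c - d) = lowEnergy γ (b - a) (d - c) := by
  rw [lowEnergy, lowEnergy, norm_sub_rev a, norm_sub_rev c, ← neg_sub d c, map_neg, norm_neg]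

/-- For `N ≤ N'` both curves are approximate solutions of the system with `N'` modes, so the
stability estimate compares them. -/
lemma exists_lowEnergy_le_of_cauchy (hν : 0 < ν) (hγ : 0 < γ) (hM : 1 ≤ M) (hT : 0 ≤ T)
    (hG : ∀ N, IsGalerkin ν γ T M N (U N) (V N))
    (h0 : ∀ ε > 0, ∃ N₀, ∀ N ≥ N₀, ∀ N' ≥ N₀, IsSmall ε (U N 0 - U N' 0) (V N 0 - V N' 0))
    {η : ℝ} (hη : 0 < η) : ∃ N₀, ∀ N ≥ N₀, ∀ N' ≥ N₀, ∀ t ∈ Icc 0 T,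
      lowEnergy γ (U N t - U N' t) (V N t - V N' t) ≤ η := by
  obtain ⟨C, hC, hlow⟩ := exists_lowEnergy_le hν hγ hM hT
  obtain ⟨A, hA, happ⟩ := exists_isApprox_of_isGalerkin ν γ M
  obtain ⟨x, hx⟩ : ∃ x, x = √(η / (C * ((1 + 3 * γ) + 1))) := ⟨_, rfl⟩
  have hx0 : 0 < x := by rw [hx]; positivity
  have hx2 : C * ((1 + 3 * γ) * x ^ 2 + x ^ 2) = η := by
    have : x ^ 2 = η / (C * ((1 + 3 * γ) + 1)) := by rw [hx, Real.sq_sqrt (by positivity)]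
    rw [this]
    field_simp
  obtain ⟨N₁, hN₁⟩ := h0 x hx0
  obtain ⟨N₂, hN₂⟩ := exists_nat_ge (A / x)
  have main : ∀ N ≥ max N₁ (N₂ + 1), ∀ N' ≥ N, ∀ t ∈ Icc 0 T,
      lowEnergy γ (U N t - U N' t) (V N t - V N' t) ≤ η := by
    intro N hN N' hN' t ht
    have hN1 : N₁ ≤ N := (le_max_left _ _).trans hN
    have hN2 : N₂ + 1 ≤ N := (le_max_right _ _).trans hN
    have hAx : ∀ n : ℕ, N₂ + 1 ≤ n → A / n ≤ x := fun n hn => by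
      have hn0 : (0 : ℝ) < n := by exact_mod_cast (by omega : 0 < n)
      rw [div_le_iff₀ hn0]
      have h1 : A / x ≤ n := hN₂.trans (by exact_mod_cast (by omega : N₂ ≤ n))
      rw [div_le_iff₀ hx0] at h1
      linarith
    refine (hlow x N' _ _ _ _ (happ T N N' _ _ (hG N) (by omega) hN' x (hAx N hN2))
      (happ T N' N' _ _ (hG N') (by omega) le_rfl x (hAx N' (by omega))) t ht).trans ?_
    rw [← hx2]
    have hs := hN₁ N hN1 N' (hN1.trans hN')
    have hD : ‖D (V N 0 - V N' 0)‖ ^ 2 ≤ ‖V N 0 - V N' 0‖ ^ 2 +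
        ‖D (D (D (D (V N 0 - V N' 0))))‖ ^ 2 :=
      norm_iterate_D_le (j := 1) (n := 4) (by norm_num) (V N 0 - V N' 0)
    have p1 := pow_le_pow_left₀ (norm_nonneg _) hs.f0 2
    have p2 := pow_le_pow_left₀ (norm_nonneg _) hs.g0 2
    have p3 := pow_le_pow_left₀ (norm_nonneg _) hs.g4 2
    refine mul_le_mul_of_nonneg_left (add_le_add_left ?_ _) hC.le
    rw [lowEnergy]
    have := mul_le_mul_of_nonneg_left (show ‖V N 0 - V N' 0‖ ^ 2 + ‖D (V N 0 - V N' 0)‖ ^ 2 ≤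
      3 * x ^ 2 by linarith) hγ.le
    linarith
  refine ⟨max N₁ (N₂ + 1), fun N hN N' hN' t ht => ?_⟩
  rcases le_total N N' with h | h
  · exact main N hN N' h t ht
  · rw [lowEnergy_sub_comm]; exact main N' hN' N h t ht

/-- Galerkin solutions whose data converge in `H³ × H⁴` converge in `H³ × H⁴`, uniformly in
time. -/
theorem isGalerkin_cauchy (hν : 0 < ν) (hγ : 0 < γ) (hM : 1 ≤ M) (hT : 0 ≤ T)
    (hG : ∀ N, IsGalerkin ν γ T M N (U N) (V N))
    (h0 : ∀ ε > 0, ∃ N₀, ∀ N ≥ N₀, ∀ N' ≥ N₀, IsSmall ε (U N 0 - U N' 0) (V N 0 - V N' 0)) :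
    ∀ ε > 0, ∃ N₀, ∀ N ≥ N₀, ∀ N' ≥ N₀, ∀ t ∈ Icc 0 T,
      IsSmall ε (U N t - U N' t) (V N t - V N' t) := by
  intro ε hε
  -- The minimum makes `2 * κ` at most both `ε ^ 2` and `γ * ε ^ 2`, so that one threshold serves
  -- `u` and the `γ`-weighted `v`.
  obtain ⟨κ, hκ⟩ : ∃ κ, κ = ε ^ 2 / 2 * min 1 γ := ⟨_, rfl⟩
  have hm : 0 < min 1 γ := lt_min one_pos hγ
  have hκ0 : 0 < κ := by rw [hκ]; positivity
  have hκ1 : 2 * κ ≤ ε ^ 2 := by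
    rw [hκ]; nlinarith [min_le_left 1 γ, sq_nonneg ε]
  have hκ2 : 2 * κ ≤ γ * ε ^ 2 := by
    rw [hκ]; nlinarith [min_le_right 1 γ, sq_nonneg ε]
  -- The 16 accounts for two solutions, the factor 2 in `par` and the factor 4 in
  -- `norm_sq_iterate_D_le_highPass`: the high frequencies contribute at most `κ` in total.
  obtain ⟨δ, hδ, N₁, hN₁⟩ := exists_tailEnergy_le_of_cauchy hν hγ hM hT hG h0
    (show 0 < κ / 16 by positivity)
  -- With `δ` fixed, the low-frequency distance is made small enough to compensate for the factors
  -- `δ^(-6)` and `δ^(-8)`.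
  obtain ⟨ζ, hζ⟩ : ∃ ζ, ζ = κ / (1 + ((1 / δ ^ 3) ^ 2 + (1 / δ ^ 4) ^ 2)) := ⟨_, rfl⟩
  have hζ0 : 0 < ζ := by rw [hζ]; positivity
  have hζ1 : ζ + ((1 / δ ^ 3) ^ 2 * ζ + (1 / δ ^ 4) ^ 2 * ζ) = κ := by
    rw [hζ]; field_simp
  have z3 : 0 ≤ (1 / δ ^ 3) ^ 2 * ζ := by positivity
  have z4 : 0 ≤ (1 / δ ^ 4) ^ 2 * ζ := by positivity
  obtain ⟨N₂, hN₂⟩ := exists_lowEnergy_le_of_cauchy hν hγ hM hT hG h0 hζ0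
  refine ⟨max N₁ N₂, fun N hN N' hN' t ht => ?_⟩
  have t1 := hN₁ N ((le_max_left _ _).trans hN) t ht
  have t2 := hN₁ N' ((le_max_left _ _).trans hN') t ht
  have lo := hN₂ N ((le_max_right _ _).trans hN) N' ((le_max_right _ _).trans hN') t ht
  rw [tailEnergy] at t1 t2
  rw [lowEnergy] at lo
  have w3 := norm_sq_iterate_D_le_highPass hδ 3 (U N t - U N' t)
  have z4' := norm_sq_iterate_D_le_highPass hδ 4 (V N t - V N' t)
  change ‖D (D (D (U N t - U N' t)))‖ ^ 2 ≤
    4 * ‖evenMult (highPass δ) (D (D (D (U N t - U N' t))))‖ ^ 2 + _ at w3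
  change ‖D (D (D (D (V N t - V N' t))))‖ ^ 2 ≤
    4 * ‖evenMult (highPass δ) (D (D (D (D (V N t - V N' t)))))‖ ^ 2 + _ at z4'
  have par : ∀ a b : TrigPoly, ‖a - b‖ ^ 2 ≤ 2 * ‖a‖ ^ 2 + 2 * ‖b‖ ^ 2 := fun a b => by
    have := norm_sub_le a b
    nlinarith [norm_nonneg (a - b), sq_nonneg (‖a‖ - ‖b‖)]
  have p3 := par (evenMult (highPass δ) (D (D (D (U N t)))))
    (evenMult (highPass δ) (D (D (D (U N' t)))))
  have p4 := par (evenMult (highPass δ) (D (D (D (D (V N t))))))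
    (evenMult (highPass δ) (D (D (D (D (V N' t))))))
  rw [← map_sub, ← map_sub, ← map_sub, ← map_sub] at p3
  rw [← map_sub, ← map_sub, ← map_sub, ← map_sub, ← map_sub] at p4
  have q1 := mul_le_mul_of_nonneg_left z4' hγ.le
  have q2 := mul_le_mul_of_nonneg_left p4 hγ.le
  have n1 : 0 ≤ γ * ‖V N t - V N' t‖ ^ 2 := by positivity
  have n2 : 0 ≤ γ * ‖D (V N t - V N' t)‖ ^ 2 := by positivity
  have n3 : 0 ≤ γ * ‖evenMult (highPass δ) (D (D (D (D (V N t)))))‖ ^ 2 := by positivity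
  have n4 : 0 ≤ γ * ‖evenMult (highPass δ) (D (D (D (D (V N' t)))))‖ ^ 2 := by positivity
  have n5 : 0 ≤ ‖evenMult (highPass δ) (D (D (D (U N t))))‖ ^ 2 := by positivity
  have n6 : 0 ≤ ‖evenMult (highPass δ) (D (D (D (U N' t))))‖ ^ 2 := by positivity
  have n7 : 0 ≤ ‖U N t - U N' t‖ ^ 2 := by positivity
  have l1 : ‖U N t - U N' t‖ ^ 2 ≤ ζ := by linarith
  have l2 : γ * ‖V N t - V N' t‖ ^ 2 ≤ ζ := by linarith
  have m1 := mul_le_mul_of_nonneg_left l1 (sq_nonneg (1 / δ ^ 3))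
  have m2 := mul_le_mul_of_nonneg_left l2 (sq_nonneg (1 / δ ^ 4))
  have fin : ∀ {f : TrigPoly}, γ * ‖f‖ ^ 2 ≤ 2 * κ → ‖f‖ ≤ ε := fun {f} h =>
    (pow_le_pow_iff_left₀ (norm_nonneg _) hε.le two_ne_zero).1
      (le_of_mul_le_mul_left (h.trans hκ2) hγ)
  have fin' : ∀ {f : TrigPoly}, ‖f‖ ^ 2 ≤ 2 * κ → ‖f‖ ≤ ε := fun {f} h =>
    (pow_le_pow_iff_left₀ (norm_nonneg _) hε.le two_ne_zero).1 (h.trans hκ1)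
  exact ⟨fin' (by linarith), fin' (by linarith), fin (by linarith), fin (by linarith)⟩

end

end TrigPoly

open Filter Topology

/-! ### Trigonometric polynomials as functions on the torus -/

/-- The function `∑ c_k e^{ikx}` given by a Laurent polynomial. -/
def evalLaurent : AddMonoidAlgebra ℂ ℤ →ₐ[ℂ] C(Torus, ℂ) :=
  AddMonoidAlgebra.lift ℂ C(Torus, ℂ) ℤ
    { toFun := fun k => fourier k.toAdd
      map_one' := by ext x; simp
      map_mul' := fun a b => by ext x; simp [toAdd_mul, fourier_add, -fourier_apply] }

lemma evalLaurent_single (k : ℤ) (c : ℂ) :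
    evalLaurent (single k c) = c • (fourier k : C(Torus, ℂ)) := by
  rw [evalLaurent, AddMonoidAlgebra.lift_single]
  rfl

lemma conjHom_single (m : ℤ) (r : ℂ) : conjHom (single m r) = single (-m) (conj r) := by
  simp only [conjHom, RingHom.comp_apply, mapRingHom_single, mapDomainRingHom_apply,
    mapDomain_single]
  rfl

lemma evalLaurent_apply (f : AddMonoidAlgebra ℂ ℤ) (x : Torus) :
    evalLaurent f x = ∑ k ∈ f.coeff.support, f.coeff k * fourier k x := by
  rw [evalLaurent, AddMonoidAlgebra.lift_apply, Finsupp.sum, ContinuousMap.sum_apply]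
  rfl

lemma evalLaurent_conjHom (f : AddMonoidAlgebra ℂ ℤ) (x : Torus) :
    evalLaurent (conjHom f) x = conj (evalLaurent f x) := by
  induction f using AddMonoidAlgebra.induction_linear with
  | zero => simp
  | add x y hx hy => simp [hx, hy]
  | single m r =>
    rw [conjHom_single, evalLaurent_single, evalLaurent_single]
    simp [fourier_neg, -fourier_apply]

lemma integral_evalLaurent (f : AddMonoidAlgebra ℂ ℤ) :
    ∫ x, evalLaurent f x = 2 * π * f.coeff 0 := by
  have hi : ∀ g : C(Torus, ℂ), Integrable g := fun g =>
    g.continuous.integrable_of_hasCompactSupport (HasCompactSupport.of_compactSpace _)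
  induction f using AddMonoidAlgebra.induction_linear with
  | zero => simp
  | add x y hx hy =>
    simp only [map_add, ContinuousMap.add_apply]
    rw [integral_add (hi _) (hi _), hx, hy, coeff_add, Finsupp.add_apply, mul_add]
  | single m r =>
    rw [evalLaurent_single]
    simp only [ContinuousMap.smul_apply, smul_eq_mul, integral_const_mul, coeff_single,
      Finsupp.single_apply]
    have h := (orthonormal_iff_ite.1 (orthonormal_fourier (T := 2 * π))) 0 m
    rw [ContinuousMap.inner_toLp] at h
    simp only [fourier_zero, map_one, mul_one] at h
    rw [AddCircle.integral_haarAddCircle] at h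
    rw [inv_smul_eq_iff₀ (by positivity)] at h
    rw [h]
    by_cases hm : m = 0
    · subst hm; simp [mul_comm]
    · simp [hm, Ne.symm hm]

namespace TrigPoly

open scoped InnerProductSpace

lemma evalLaurent_im (f : TrigPoly) (x : Torus) : (evalLaurent f.toLaurent x).im = 0 := by
  have h := evalLaurent_conjHom f.toLaurent x
  rw [show conjHom f.toLaurent = f.toLaurent from f.2] at h
  exact Complex.conj_eq_iff_im.1 h.symm

/-- The real-valued function on the torus given by a trigonometric polynomial. -/
def ev : TrigPoly →ₐ[ℝ] C(Torus, ℝ) where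
  toFun f := ⟨fun x => (evalLaurent f.toLaurent x).re, by fun_prop⟩
  map_one' := by
    ext x
    have : (1 : TrigPoly).toLaurent = 1 := rfl
    simp [this]
  map_mul' f g := by
    ext x
    have : (f * g).toLaurent = f.toLaurent * g.toLaurent := rfl
    simp [this, evalLaurent_im]
  map_zero' := by
    ext x
    have : (0 : TrigPoly).toLaurent = 0 := rfl
    simp [this]
  map_add' f g := by
    ext x
    have : (f + g).toLaurent = f.toLaurent + g.toLaurent := rfl
    simp [this]
  commutes' r := by
    ext x
    have : (algebraMap ℝ TrigPoly r).toLaurent = single 0 (r : ℂ) := rfl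
    simp only [this, evalLaurent_single]
    simp

lemma ev_apply (f : TrigPoly) (x : Torus) : ev f x = (evalLaurent f.toLaurent x).re := rfl

lemma evalLaurent_eq_sum (f : TrigPoly) {s : Finset ℤ} (hs : f.supp ⊆ s) (x : Torus) :
    evalLaurent f.toLaurent x = ∑ k ∈ s, f.co k * fourier k x := by
  rw [evalLaurent_apply]
  refine Finset.sum_subset hs fun k _ hk => ?_
  rw [show f.toLaurent.coeff k = 0 from co_eq_zero hk, zero_mul]

lemma integral_ev (f : TrigPoly) : ∫ x, ev f x = 2 * π * (f.co 0).re := by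
  have h := integral_evalLaurent f.toLaurent
  have hi : Integrable fun x => evalLaurent f.toLaurent x :=
    (evalLaurent f.toLaurent).continuous.integrable_of_hasCompactSupport
      (HasCompactSupport.of_compactSpace _)
  have h2 := integral_re hi
  simp only [RCLike.re_to_complex] at h2
  simp only [ev_apply, h2, h]
  rw [show (2 * π * f.toLaurent.coeff 0 : ℂ) = ((2 * π : ℝ) : ℂ) * f.co 0 by
    push_cast; rfl, Complex.re_ofReal_mul]

lemma hasDerivAt_ev (f : TrigPoly) (x : ℝ) :
    HasDerivAt (fun y : ℝ => ev f (y : Torus)) (ev (D f) (x : Torus)) x := by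
  have h : HasDerivAt (fun y : ℝ => evalLaurent f.toLaurent (y : Torus))
      (evalLaurent (D f).toLaurent (x : Torus)) x := by
    simp only [evalLaurent_eq_sum f Finset.Subset.rfl, evalLaurent_eq_sum (D f) (supp_D_subset f)]
    refine HasDerivAt.fun_sum fun k _ => ?_
    have := (hasDerivAt_fourier (2 * π) k x).const_mul (f.co k)
    refine this.congr_deriv ?_
    rw [co_D]
    have hp : (π : ℂ) ≠ 0 := by exact_mod_cast Real.pi_ne_zero
    push_cast
    field_simp
  exact Complex.reCLM.hasFDerivAt.comp_hasDerivAt x h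

lemma iteratedDeriv_ev (f : TrigPoly) (k : ℕ) :
    iteratedDeriv k (fun y : ℝ => ev f (y : Torus)) = fun y : ℝ => ev (D^[k] f) (y : Torus) := by
  induction k generalizing f with
  | zero => simp
  | succ k ih =>
    rw [iteratedDeriv_succ', show deriv (fun y : ℝ => ev f (y : Torus)) =
      fun y : ℝ => ev (D f) (y : Torus) from funext fun y => (hasDerivAt_ev f y).deriv, ih]
    rfl

lemma contDiff_ev (f : TrigPoly) : ContDiff ℝ ∞ (fun y : ℝ => ev f (y : Torus)) :=
  contDiff_of_differentiable_iteratedDeriv fun k _ => by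
    rw [iteratedDeriv_ev]
    exact fun y => (hasDerivAt_ev _ y).differentiableAt

lemma periodic_ev (f : TrigPoly) :
    Function.Periodic (fun y : ℝ => ev f (y : Torus)) (2 * π) := fun y => by
  simp

lemma integrable_ev (f : TrigPoly) : Integrable (ev f) :=
  (ev f).continuous.integrable_of_hasCompactSupport (HasCompactSupport.of_compactSpace _)

lemma integral_ev_mul_deriv (f : TrigPoly) {φ : ℝ → ℝ} (hφ : ContDiff ℝ ∞ φ)
    (hp : Function.Periodic φ (2 * π)) :
    ∫ x in (-π)..π, ev f (x : Torus) * deriv φ x =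
      -∫ x in (-π)..π, ev (D f) (x : Torus) * φ x := by
  have h := intervalIntegral.integral_mul_deriv_eq_deriv_mul (a := -π) (b := π)
    (u := fun y : ℝ => ev f (y : Torus)) (v := φ) (u' := fun y : ℝ => ev (D f) (y : Torus))
    (v' := deriv φ) (fun x _ => hasDerivAt_ev f x)
    (fun x _ => (hφ.differentiable (by simp)).differentiableAt.hasDerivAt)
    ((contDiff_ev (D f)).continuous.intervalIntegrable _ _)
    ((hφ.continuous_deriv (by simp)).intervalIntegrable _ _)
  have e : π = -π + 2 * π := by ring
  have e1 : φ π = φ (-π) := by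
    conv_lhs => rw [e]
    exact hp _
  have e2 : ev f ((π : ℝ) : Torus) = ev f ((-π : ℝ) : Torus) := by
    have := periodic_ev f (-π)
    rwa [← e] at this
  rw [h, e1, e2]
  ring

lemma periodic_deriv {φ : ℝ → ℝ} {c : ℝ} (h : Function.Periodic φ c) :
    Function.Periodic (deriv φ) c := fun x => by
  rw [← deriv_comp_add_const, show (fun y => φ (y + c)) = φ from funext h]

/-- Repeated integration by parts over one period; the boundary terms cancel by periodicity. -/
lemma isWeakDeriv_ev (k : ℕ) (f : TrigPoly) : IsWeakDeriv k (ev f) (ev (D^[k] f)) := by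
  refine ⟨integrable_ev _, integrable_ev _, ?_⟩
  induction k with
  | zero => simp
  | succ k ih =>
    intro φ hφ hp
    have hφ' : ContDiff ℝ ∞ (deriv φ) := ((contDiff_infty_iff_deriv).1 hφ).2
    rw [iteratedDeriv_succ', ih _ hφ' (periodic_deriv hp), integral_ev_mul_deriv _ hφ hp,
      Function.iterate_succ_apply']
    ring

/-- A trigonometric polynomial as an element of `L²`. -/
def incl : TrigPoly →ₗ[ℝ] L2 := (ContinuousMap.toLp 2 volume ℝ).toLinearMap ∘ₗ ev.toLinearMap

lemma coeFn_incl (f : TrigPoly) : (incl f : Torus → ℝ) =ᵐ[volume] ev f :=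
  ContinuousMap.coeFn_toLp (𝕜 := ℝ) volume (ev f)

lemma inner_incl (f g : TrigPoly) : ⟪incl f, incl g⟫_ℝ = 2 * π * ⟪f, g⟫_ℝ := by
  have h := ContinuousMap.inner_toLp (𝕜 := ℝ) (volume : Measure Torus) (ev f) (ev g)
  rw [inner_def, ← integral_ev, map_mul]
  refine h.trans (integral_congr_ae (.of_forall fun x => ?_))
  simp [mul_comm]

lemma norm_incl_sq (f : TrigPoly) : ‖incl f‖ ^ 2 = 2 * π * ‖f‖ ^ 2 := by
  rw [← real_inner_self_eq_norm_sq, inner_incl, real_inner_self_eq_norm_sq]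

lemma norm_incl (f : TrigPoly) : ‖incl f‖ = √(2 * π) * ‖f‖ := by
  rw [← Real.sqrt_sq (norm_nonneg (incl f)), norm_incl_sq, Real.sqrt_mul (by positivity),
    Real.sqrt_sq (norm_nonneg _)]

lemma isWeakDeriv_incl (k : ℕ) (f : TrigPoly) : IsWeakDeriv k (incl f) (incl (D^[k] f)) :=
  (isWeakDeriv_ev k f).congr (coeFn_incl f).symm (coeFn_incl _).symm

/-- Stone–Weierstrass gives density in the continuous functions, which are dense in `L²`. -/
lemma denseRange_incl : DenseRange incl := by
  have h1 : DenseRange (ev : TrigPoly → C(Torus, ℝ)) := by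
    have h := ContinuousMap.subalgebra_topologicalClosure_eq_top_of_separatesPoints
      (AlgHom.range ev) ?_
    · rw [DenseRange, dense_iff_closure_eq]
      have := congrArg (fun S : Subalgebra ℝ C(Torus, ℝ) => (S : Set C(Torus, ℝ))) h
      simpa [Subalgebra.topologicalClosure_coe] using this
    · intro x y hxy
      by_contra hcon
      have hcon' : ∀ f : TrigPoly, ev f x = ev f y := by
        intro f
        by_contra hf
        exact hcon ⟨_, ⟨ev f, ⟨f, rfl⟩, rfl⟩, hf⟩
      -- The functions `Re (c e^{ix})` are real trigonometric polynomials; `c = 1` and `c = -i`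
      -- recover the real and imaginary parts of `e^{ix}`, which separates points.
      have key : ∀ c : ℂ, (c * fourier 1 x).re = (c * fourier 1 y).re := by
        intro c
        let f : TrigPoly := ⟨single 1 c + single (-1) (conj c), by
          show conjHom _ = _
          rw [map_add, conjHom_single, conjHom_single, neg_neg, Complex.conj_conj, add_comm]⟩
        have hf : ∀ z, ev f z = 2 * (c * fourier 1 z).re := by
          intro z
          have : evalLaurent f.toLaurent z = c * fourier 1 z + conj (c * fourier 1 z) := by
            show evalLaurent (single 1 c + single (-1) (conj c)) z = _
            rw [map_add, evalLaurent_single, evalLaurent_single]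
            simp [fourier_neg, -fourier_apply]
          rw [ev_apply, this, Complex.add_conj]
          norm_cast
        have := hcon' f
        rw [hf, hf] at this
        linarith
      have e : fourier 1 x = fourier 1 y := by
        apply Complex.ext
        · simpa using key 1
        · simpa using key (-Complex.I)
      rw [fourier_one, fourier_one] at e
      exact hxy (AddCircle.injective_toCircle (by positivity) (Subtype.ext e))
  exact (ContinuousMap.toLp_denseRange (μ := volume) ℝ ℝ (by simp)).comp h1
    (ContinuousMap.toLp 2 volume ℝ).continuous

end TrigPoly

open scoped InnerProductSpace

/-! ### Weak derivatives of square integrable functions -/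

lemma inner_toLp_eq_integral (a : L2) (ψ : C(Torus, ℝ)) :
    ⟪a, ContinuousMap.toLp 2 volume ℝ ψ⟫_ℝ = ∫ x in (-π)..π, a (x : Torus) * ψ (x : Torus) := by
  have h := AddCircle.intervalIntegral_preimage (2 * π) (-π) fun x : Torus => a x * ψ x
  rw [show -π + 2 * π = π by ring] at h
  rw [h, L2.inner_def]
  refine integral_congr_ae ?_
  filter_upwards [ContinuousMap.coeFn_toLp (p := 2) (𝕜 := ℝ) volume ψ] with x hx
  rw [hx]
  exact mul_comm _ _

lemma exists_continuousMap_of_periodic {φ : ℝ → ℝ} (hφ : Continuous φ)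
    (hp : Function.Periodic φ (2 * π)) : ∃ ψ : C(Torus, ℝ), ∀ x : ℝ, ψ (x : Torus) = φ x :=
  ⟨⟨hp.lift, continuous_coinduced_dom.2 hφ⟩, fun _ => rfl⟩

lemma periodic_iteratedDeriv {φ : ℝ → ℝ} {c : ℝ} (h : Function.Periodic φ c) (k : ℕ) :
    Function.Periodic (iteratedDeriv k φ) c := by
  induction k with
  | zero => simpa using h
  | succ k ih =>
    rw [iteratedDeriv_succ]
    exact TrigPoly.periodic_deriv ih

/-- A periodic test function and its derivatives descend to continuous functions on the torus, so
both sides of the defining identity are `L²` inner products and pass to the limit. -/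
lemma isWeakDeriv_of_tendsto {k : ℕ} {f g : ℕ → L2} {a b : L2} (h : ∀ n, IsWeakDeriv k (f n) (g n))
    (hf : Tendsto f atTop (𝓝 a)) (hg : Tendsto g atTop (𝓝 b)) : IsWeakDeriv k a b := by
  refine ⟨integrable_L2 a, integrable_L2 b, fun φ hφ hp => ?_⟩
  obtain ⟨ψ₁, h₁⟩ := exists_continuousMap_of_periodic
    (hφ.continuous_iteratedDeriv k (by exact_mod_cast le_top)) (periodic_iteratedDeriv hp k)
  obtain ⟨ψ₂, h₂⟩ := exists_continuousMap_of_periodic hφ.continuous hp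
  simp only [← h₁, ← h₂, ← inner_toLp_eq_integral]
  have l1 := hf.inner (tendsto_const_nhds (x := ContinuousMap.toLp 2 volume ℝ ψ₁)) (𝕜 := ℝ)
  have l2 := (hg.inner (tendsto_const_nhds (x := ContinuousMap.toLp 2 volume ℝ ψ₂))
    (𝕜 := ℝ)).const_mul ((-1 : ℝ) ^ k)
  refine tendsto_nhds_unique l1 (l2.congr fun n => ?_)
  have := (h n).2.2 φ hφ hp
  simp only [← h₁, ← h₂, ← inner_toLp_eq_integral] at this
  exact this.symm

lemma isClosed_sobolev (s : ℕ) : IsClosed (Sobolev s : Set (WithLp 2 (L2 × L2))) :=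
  isClosed_of_closure_subset fun p hp => by
    obtain ⟨x, hx, hlim⟩ := mem_closure_iff_seq_limit.1 hp
    have h1 : Tendsto (fun n => (x n).fst) atTop (𝓝 p.fst) :=
      ((WithLp.prod_continuous_ofLp 2 L2 L2).fst.tendsto p).comp hlim
    have h2 : Tendsto (fun n => (x n).snd) atTop (𝓝 p.snd) :=
      ((WithLp.prod_continuous_ofLp 2 L2 L2).snd.tendsto p).comp hlim
    exact isWeakDeriv_of_tendsto hx h1 h2

instance (s : ℕ) : CompleteSpace (Sobolev s) := (isClosed_sobolev s).completeSpace_coe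

/-! ### Fourier truncation of square integrable functions and the embedding in `Hˢ`. -/

namespace TrigPoly

lemma cut_iterate_D (N k : ℕ) (f : TrigPoly) : cut N (D^[k] f) = D^[k] (cut N f) := by
  induction k generalizing f with
  | zero => rfl
  | succ k ih => rw [Function.iterate_succ_apply, ih, cut_D, Function.iterate_succ_apply]

lemma inner_iterate_D_left (k : ℕ) (f g : TrigPoly) :
    ⟪D^[k] f, g⟫_ℝ = (-1) ^ k * ⟪f, D^[k] g⟫_ℝ := by
  induction k generalizing f with
  | zero => simp
  | succ k ih =>
    rw [Function.iterate_succ_apply, ih, inner_D_left, Function.iterate_succ_apply']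
    ring

instance (N : ℕ) : CompleteSpace (modes N) := FiniteDimensional.complete ℝ _

/-- The Fourier truncation of a square integrable function to the frequencies `|k| ≤ N`. -/
def trunc (N : ℕ) : L2 →L[ℝ] TrigPoly :=
  -- The inner product on polynomials is normalised and that of `L²` is not; dividing the adjoint by
  -- `2π` makes the operator agree with `cut N` on polynomials.
  (modes N).subtypeL ∘L ((2 * π)⁻¹ • ContinuousLinearMap.adjoint
    (LinearMap.toContinuousLinearMap (incl ∘ₗ (modes N).subtype)))

lemma cut_trunc (N : ℕ) (h : L2) : cut N (trunc N h) = trunc N h :=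
  mem_modes.1 (((2 * π)⁻¹ • ContinuousLinearMap.adjoint
    (LinearMap.toContinuousLinearMap (incl ∘ₗ (modes N).subtype))) h).2

lemma inner_trunc (N : ℕ) (h : L2) (g : TrigPoly) :
    ⟪trunc N h, g⟫_ℝ = (2 * π)⁻¹ * ⟪h, incl (cut N g)⟫_ℝ := by
  rw [← cut_trunc, inner_cut_left, ← coe_cutModes]
  simp only [trunc, ContinuousLinearMap.comp_apply, Submodule.subtypeL_apply]
  rw [← Submodule.coe_inner, smul_apply, real_inner_smul_left,
    ContinuousLinearMap.adjoint_inner_left]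
  rfl

lemma trunc_incl (N : ℕ) (f : TrigPoly) : trunc N (incl f) = cut N f :=
  ext_inner_right ℝ fun g => by
    rw [inner_trunc, inner_incl, inner_cut_left, ← mul_assoc, inv_mul_cancel₀ (by positivity),
      one_mul]

lemma cut_trunc_of_le {N M : ℕ} (h : N ≤ M) (f : L2) : cut N (trunc M f) = trunc N f :=
  ext_inner_right ℝ fun g => by
    rw [inner_cut_left, inner_trunc, inner_trunc, cut_cut_of_le h]

lemma norm_incl_trunc_le (N : ℕ) (h : L2) : ‖incl (trunc N h)‖ ≤ ‖h‖ := by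
  have h1 : ‖incl (trunc N h)‖ ^ 2 = ⟪h, incl (trunc N h)⟫_ℝ := by
    rw [← real_inner_self_eq_norm_sq, inner_incl, inner_trunc, cut_trunc, ← mul_assoc,
      mul_inv_cancel₀ (by positivity), one_mul]
  have h2 := real_inner_le_norm h (incl (trunc N h))
  rcases (norm_nonneg (incl (trunc N h))).eq_or_lt with h0 | h0
  · rw [← h0]; exact norm_nonneg _
  · rw [← h1, sq] at h2
    exact le_of_mul_le_mul_right h2 h0

lemma one_le_sqrt_two_pi : 1 ≤ √(2 * π) :=
  Real.one_le_sqrt.2 (by linarith [Real.pi_gt_three])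

lemma norm_le_norm_incl (f : TrigPoly) : ‖f‖ ≤ ‖incl f‖ := by
  rw [norm_incl]
  exact le_mul_of_one_le_left (norm_nonneg _) one_le_sqrt_two_pi

/-- Truncation is a contraction and is eventually exact on each polynomial, and polynomials are
dense. -/
lemma tendsto_incl_trunc (h : L2) : Tendsto (fun N => incl (trunc N h)) atTop (𝓝 h) := by
  rw [Metric.tendsto_atTop]
  intro ε hε
  obtain ⟨g, hg⟩ := Metric.denseRange_iff.1 denseRange_incl h (ε / 2) (by linarith)
  obtain ⟨K, hK⟩ := exists_cut_eq_self g
  refine ⟨K, fun N hN => ?_⟩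
  have e : incl (trunc N h) - h = incl (trunc N (h - incl g)) - (h - incl g) := by
    rw [map_sub, trunc_incl, cut_eq_self_of_le hN hK, map_sub]
    abel
  rw [dist_eq_norm] at hg ⊢
  rw [e]
  have := norm_incl_trunc_le N (h - incl g)
  have := norm_sub_le (incl (trunc N (h - incl g))) (h - incl g)
  linarith

lemma inner_incl_eq_integral (a : L2) (g : TrigPoly) :
    ⟪a, incl g⟫_ℝ = ∫ x in (-π)..π, a (x : Torus) * ev g (x : Torus) :=
  inner_toLp_eq_integral a (ev g)

/-- Trigonometric polynomials are admissible test functions; the sign of the weak derivative cancels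
that of moving `D` across the inner product. -/
lemma trunc_of_isWeakDeriv {k : ℕ} {f g : L2} (h : IsWeakDeriv k f g) (N : ℕ) :
    trunc N g = D^[k] (trunc N f) :=
  ext_inner_right ℝ fun p => by
    have := h.2.2 _ (contDiff_ev (cut N p)) (periodic_ev (cut N p))
    rw [iteratedDeriv_ev, ← inner_incl_eq_integral, ← inner_incl_eq_integral] at this
    rw [inner_trunc, inner_iterate_D_left, inner_trunc, cut_iterate_D, this]
    have hs : ((-1 : ℝ) ^ k) * (-1) ^ k = 1 := by rw [← mul_pow]; norm_num
    linear_combination (-(2 * π)⁻¹ * ⟪g, incl (cut N p)⟫_ℝ) * hs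

lemma eq_of_trunc_eq {f g : L2} (h : ∀ N, trunc N f = trunc N g) : f = g :=
  tendsto_nhds_unique (tendsto_incl_trunc f)
    ((tendsto_incl_trunc g).congr fun N => by rw [h N])

lemma isWeakDeriv_unique {k : ℕ} {f : Torus → ℝ} {g g' : L2} (h : IsWeakDeriv k f g)
    (h' : IsWeakDeriv k f g') : g = g' :=
  eq_of_trunc_eq fun N => ext_inner_right ℝ fun p => by
    have e := h.2.2 _ (contDiff_ev (cut N p)) (periodic_ev (cut N p))
    rw [h'.2.2 _ (contDiff_ev (cut N p)) (periodic_ev (cut N p)), ← inner_incl_eq_integral,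
      ← inner_incl_eq_integral] at e
    rw [inner_trunc, inner_trunc, mul_left_cancel₀ (by simp) e]

lemma toL2_injective {s : ℕ} : Function.Injective (toL2 (s := s)) := fun f g h => by
  have h2 : f.1.snd = g.1.snd := by
    refine isWeakDeriv_unique (f := f.1.fst) f.2 ?_
    rw [show f.1.fst = g.1.fst from h]
    exact g.2
  exact Subtype.ext ((WithLp.equiv 2 (L2 × L2)).injective (Prod.ext h h2))

/-- A trigonometric polynomial as an element of `Hˢ`. -/
def emb (s : ℕ) : TrigPoly →ₗ[ℝ] Sobolev s where
  toFun f := ⟨WithLp.toLp 2 (incl f, incl (D^[s] f)), isWeakDeriv_incl s f⟩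
  map_add' f g := by
    have : D^[s] (f + g) = D^[s] f + D^[s] g := by
      simp only [← Module.End.pow_apply, map_add]
    refine Subtype.ext ((WithLp.equiv 2 (L2 × L2)).injective (Prod.ext ?_ ?_))
    · exact map_add incl f g
    · exact (congrArg incl this).trans (map_add incl _ _)
  map_smul' c f := by
    have : D^[s] (c • f) = c • D^[s] f := by
      simp only [← Module.End.pow_apply, map_smul]
    refine Subtype.ext ((WithLp.equiv 2 (L2 × L2)).injective (Prod.ext ?_ ?_))
    · exact map_smul incl c f
    · exact (congrArg incl this).trans (map_smul incl _ _)

lemma norm_emb_sq (s : ℕ) (f : TrigPoly) :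
    ‖emb s f‖ ^ 2 = 2 * π * (‖f‖ ^ 2 + ‖D^[s] f‖ ^ 2) := by
  rw [mul_add, ← norm_incl_sq, ← norm_incl_sq]
  exact WithLp.prod_norm_sq_eq_of_L2 _

lemma norm_emb_le (s : ℕ) {f : TrigPoly} {ε : ℝ} (h0 : ‖f‖ ≤ ε) (hs : ‖D^[s] f‖ ≤ ε) :
    ‖emb s f‖ ≤ 4 * ε := by
  have hε := (norm_nonneg _).trans h0
  refine abs_le_of_sq_le_sq' ?_ (by positivity) |>.2
  rw [norm_emb_sq]
  have a0 := pow_le_pow_left₀ (norm_nonneg _) h0 2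
  have a1 := pow_le_pow_left₀ (norm_nonneg _) hs 2
  have := mul_le_mul (by linarith [Real.pi_lt_four] : 2 * π ≤ 8) (add_le_add a0 a1) (by positivity)
    (by norm_num)
  linarith

lemma norm_le_norm_emb (s : ℕ) (f : TrigPoly) : ‖f‖ ≤ ‖emb s f‖ ∧ ‖D^[s] f‖ ≤ ‖emb s f‖ := by
  have h := norm_emb_sq s f
  have h1 : 1 * (‖f‖ ^ 2 + ‖D^[s] f‖ ^ 2) ≤ ‖emb s f‖ ^ 2 := by
    rw [h]; gcongr; linarith [Real.pi_gt_three]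
  exact ⟨abs_le_of_sq_le_sq' (by nlinarith [sq_nonneg ‖D^[s] f‖]) (norm_nonneg _) |>.2,
    abs_le_of_sq_le_sq' (by nlinarith [sq_nonneg ‖f‖]) (norm_nonneg _) |>.2⟩

lemma norm_toL2_le {s : ℕ} (f : Sobolev s) : ‖toL2 f‖ ≤ ‖f‖ := by
  have h : ‖f‖ ^ 2 = ‖f.1.fst‖ ^ 2 + ‖f.1.snd‖ ^ 2 := WithLp.prod_norm_sq_eq_of_L2 _
  exact abs_le_of_sq_le_sq' (by rw [h]; exact le_add_of_nonneg_right (sq_nonneg _))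
    (norm_nonneg _) |>.2

lemma iterate_D_trunc {s : ℕ} (f : Sobolev s) (N : ℕ) :
    D^[s] (trunc N (toL2 f)) = trunc N f.1.snd := (trunc_of_isWeakDeriv f.2 N).symm

lemma norm_emb_trunc_le {s : ℕ} (f : Sobolev s) (N : ℕ) : ‖emb s (trunc N (toL2 f))‖ ≤ ‖f‖ := by
  refine abs_le_of_sq_le_sq' ?_ (norm_nonneg _) |>.2
  rw [norm_emb_sq, iterate_D_trunc, mul_add, ← norm_incl_sq, ← norm_incl_sq]
  have h : ‖f‖ ^ 2 = ‖f.1.fst‖ ^ 2 + ‖f.1.snd‖ ^ 2 := WithLp.prod_norm_sq_eq_of_L2 _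
  rw [h]
  exact add_le_add (pow_le_pow_left₀ (norm_nonneg _) (norm_incl_trunc_le _ _) 2)
    (pow_le_pow_left₀ (norm_nonneg _) (norm_incl_trunc_le _ _) 2)

lemma tendsto_emb_trunc {s : ℕ} (f : Sobolev s) :
    Tendsto (fun N => emb s (trunc N (toL2 f))) atTop (𝓝 f) := by
  rw [tendsto_subtype_rng]
  have h : Tendsto (fun N => (incl (trunc N (toL2 f)), incl (D^[s] (trunc N (toL2 f))))) atTop
      (𝓝 (f.1.fst, f.1.snd)) := by
    simp only [iterate_D_trunc]
    exact (tendsto_incl_trunc _).prodMk_nhds (tendsto_incl_trunc _)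
  exact ((WithLp.prod_continuous_toLp 2 L2 L2).tendsto _).comp h

end TrigPoly

lemma exists_subseq_tendsto_ae {x : ℕ → L2} {a : L2} (h : Tendsto x atTop (𝓝 a)) :
    ∃ φ : ℕ → ℕ, StrictMono φ ∧
      ∀ᵐ y : Torus, Tendsto (fun n => x (φ n) y) atTop (𝓝 (a y)) :=
  (tendstoInMeasure_of_tendsto_Lp h).exists_seq_tendsto_ae

namespace TrigPoly

/-! ### Passing to the limit in the equations -/

lemma exists_tendsto_of_norm_sub_le {E : Type*} [SeminormedAddCommGroup E] {x : ℕ → L2}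
    {y : ℕ → E} {C : ℝ} (hy : CauchySeq y) (h : ∀ m n, ‖x m - x n‖ ≤ C * ‖y m - y n‖) :
    ∃ a, Tendsto x atTop (𝓝 a) := by
  refine cauchySeq_tendsto_of_complete (Metric.cauchySeq_iff.2 fun ε hε => ?_)
  obtain ⟨K, hK⟩ := Metric.cauchySeq_iff.1 hy (ε / (|C| + 1)) (by positivity)
  refine ⟨K, fun m hm n hn => ?_⟩
  have h1 := hK m hm n hn
  rw [dist_eq_norm] at h1 ⊢
  have h2 : C * ‖y m - y n‖ ≤ (|C| + 1) * ‖y m - y n‖ := by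
    gcongr; linarith [le_abs_self C]
  have h3 : (|C| + 1) * ‖y m - y n‖ < ε := by
    rw [lt_div_iff₀ (by positivity)] at h1; linarith
  linarith [h m n]

lemma norm_incl_iterate_D_le {j s : ℕ} (hj : j ≤ s) (f : TrigPoly) :
    ‖incl (D^[j] f)‖ ≤ ‖emb s f‖ := by
  refine abs_le_of_sq_le_sq' ?_ (norm_nonneg _) |>.2
  rw [norm_incl_sq, norm_emb_sq]
  exact mul_le_mul_of_nonneg_left (norm_iterate_D_le hj f) (by positivity)

lemma iterate_D_sub (j : ℕ) (f g : TrigPoly) : D^[j] (f - g) = D^[j] f - D^[j] g := by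
  simp only [← Module.End.pow_apply, map_sub]

lemma tendsto_toL2 {s : ℕ} {x : ℕ → Sobolev s} {a : Sobolev s} (h : Tendsto x atTop (𝓝 a)) :
    Tendsto (fun n => toL2 (x n)) atTop (𝓝 (toL2 a)) := by
  rw [tendsto_iff_norm_sub_tendsto_zero] at h ⊢
  exact squeeze_zero (fun _ => norm_nonneg _) (fun n => norm_toL2_le (x n - a)) h

lemma exists_tendsto_incl_iterate_D {j s : ℕ} (hj : j ≤ s) {f : ℕ → TrigPoly} {a : Sobolev s}
    (h : Tendsto (fun n => emb s (f n)) atTop (𝓝 a)) :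
    ∃ g : L2, IsWeakDeriv j (toL2 a) g ∧ Tendsto (fun n => incl (D^[j] (f n))) atTop (𝓝 g) := by
  obtain ⟨g, hg⟩ := exists_tendsto_of_norm_sub_le (x := fun n => incl (D^[j] (f n))) (C := 1)
    h.cauchySeq fun m n => by
      rw [← map_sub, ← map_sub, one_mul, ← iterate_D_sub]
      exact norm_incl_iterate_D_le hj _
  exact ⟨g, isWeakDeriv_of_tendsto (fun n => isWeakDeriv_incl j (f n)) (tendsto_toL2 h) hg, hg⟩

/-- Products of `L²`-convergent sequences that are bounded in the Wiener norm converge. -/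
lemma exists_tendsto_incl_mul {f g : ℕ → TrigPoly} {a b : L2} {M : ℝ}
    (hf : Tendsto (fun n => incl (f n)) atTop (𝓝 a))
    (hg : Tendsto (fun n => incl (g n)) atTop (𝓝 b))
    (hfM : ∀ n, (f n).wiener ≤ M) (hgM : ∀ n, (g n).wiener ≤ M) :
    ∃ p : L2, Tendsto (fun n => incl (f n * g n)) atTop (𝓝 p) ∧ ∀ᵐ x : Torus, p x = a x * b x := by
  have hM : 0 ≤ M := (wiener_nonneg _).trans (hfM 0)
  obtain ⟨p, hp⟩ := exists_tendsto_of_norm_sub_le (x := fun n => incl (f n * g n)) (C := 2 * M)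
    (hf.cauchySeq.prodMk hg.cauchySeq) fun m n => by
      have e : f m * g m - f n * g n = (f m - f n) * g m + f n * (g m - g n) := by ring
      rw [← map_sub, norm_incl, e, Prod.mk_sub_mk, ← map_sub, ← map_sub]
      have h1 := norm_mul_le_of_le' (f := f m - f n) le_rfl (hgM m)
      have h2 := norm_mul_le_of_le (g := g m - g n) (hfM n) le_rfl
      have h3 := le_max_left ‖incl (f m - f n)‖ ‖incl (g m - g n)‖
      have h4 := le_max_right ‖incl (f m - f n)‖ ‖incl (g m - g n)‖
      rw [Prod.norm_def]
      calc √(2 * π) * ‖(f m - f n) * g m + f n * (g m - g n)‖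
          ≤ √(2 * π) * (‖f m - f n‖ * M + M * ‖g m - g n‖) := by
            gcongr; exact (norm_add_le _ _).trans (add_le_add h1 h2)
        _ = M * ‖incl (f m - f n)‖ + M * ‖incl (g m - g n)‖ := by
            rw [norm_incl, norm_incl]; ring
        _ ≤ M * max ‖incl (f m - f n)‖ ‖incl (g m - g n)‖ +
            M * max ‖incl (f m - f n)‖ ‖incl (g m - g n)‖ := by gcongr
        _ = _ := by ring
  refine ⟨p, hp, ?_⟩
  -- The limit is identified pointwise: successive subsequences make the products and both factors
  -- converge almost everywhere.
  obtain ⟨φ₁, s₁, h₁⟩ := exists_subseq_tendsto_ae hp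
  obtain ⟨φ₂, s₂, h₂⟩ := exists_subseq_tendsto_ae (hf.comp s₁.tendsto_atTop)
  obtain ⟨φ₃, s₃, h₃⟩ := exists_subseq_tendsto_ae
    (hg.comp (s₁.tendsto_atTop.comp s₂.tendsto_atTop))
  filter_upwards [h₁, h₂, h₃, ae_all_iff.2 fun n => coeFn_incl (f n),
    ae_all_iff.2 fun n => coeFn_incl (g n), ae_all_iff.2 fun n => coeFn_incl (f n * g n)]
    with x l₁ l₂ l₃ ef eg efg
  refine tendsto_nhds_unique (l₁.comp (s₂.tendsto_atTop.comp s₃.tendsto_atTop))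
    (((l₂.comp s₃.tendsto_atTop).mul l₃).congr fun n => ?_)
  simp [ef, eg, efg]

lemma exists_wiener_mul_D_le (M : ℝ) :
    ∃ C, ∀ u v : TrigPoly, IsBdd M u v → (v * D v).wiener ≤ C := by
  obtain ⟨C, hC, h⟩ := exists_wiener_le
  refine ⟨C * (M * M + (M * M + M * M)), fun u v hb => (h _).trans ?_⟩
  gcongr
  · exact norm_mul_le_of_le hb.wv0 hb.v1
  · rw [D_mul]
    exact (norm_add_le _ _).trans (add_le_add (norm_mul_le_of_le hb.wv1 hb.v1)
      (norm_mul_le_of_le hb.wv0 hb.v2))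

/-- The fields of convergent sequences converge, and their limits satisfy the equations. -/
lemma exists_tendsto_field (ν γ M : ℝ) {U V : ℕ → TrigPoly} {u : Sobolev 3} {v : Sobolev 4}
    (hU : Tendsto (fun n => emb 3 (U n)) atTop (𝓝 u))
    (hV : Tendsto (fun n => emb 4 (V n)) atTop (𝓝 v)) (hB : ∀ n, IsBdd M (U n) (V n)) :
    ∃ ut vt ux uxx vx vxxx uvx : L2,
      Tendsto (fun n => incl (fieldU ν γ (U n) (V n))) atTop (𝓝 ut) ∧
      Tendsto (fun n => incl (fieldV γ (U n) (V n))) atTop (𝓝 vt) ∧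
      IsWeakDeriv 1 (toL2 u) ux ∧ IsWeakDeriv 2 (toL2 u) uxx ∧
      IsWeakDeriv 1 (toL2 v) vx ∧ IsWeakDeriv 3 (toL2 v) vxxx ∧
      IsWeakDeriv 1 (fun x => toL2 u x * toL2 v x) uvx ∧
      (∀ᵐ x : Torus, ut x + 3 * toL2 u x * ux x =
        -6 * toL2 v x ^ 2 * vx x - γ * toL2 v x * vxxx x + ν * uxx x) ∧
      (∀ᵐ x : Torus, vt x - 6 * toL2 v x * vx x = γ * vxxx x + uvx x) := by
  have tU : Tendsto (fun n => incl (U n)) atTop (𝓝 (toL2 u)) := tendsto_toL2 hU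
  have tV : Tendsto (fun n => incl (V n)) atTop (𝓝 (toL2 v)) := tendsto_toL2 hV
  obtain ⟨ux, wux, tux⟩ := exists_tendsto_incl_iterate_D (j := 1) (by norm_num) hU
  obtain ⟨uxx, wuxx, tuxx⟩ := exists_tendsto_incl_iterate_D (j := 2) (by norm_num) hU
  obtain ⟨vx, wvx, tvx⟩ := exists_tendsto_incl_iterate_D (j := 1) (by norm_num) hV
  obtain ⟨vxxx, wvxxx, tvxxx⟩ := exists_tendsto_incl_iterate_D (j := 3) (by norm_num) hV
  simp only [Function.iterate_succ, Function.iterate_zero, Function.comp_apply, id_eq]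
    at tux tuxx tvx tvxxx
  obtain ⟨C, hC⟩ := exists_wiener_mul_D_le M
  obtain ⟨p₁, t₁, e₁⟩ := exists_tendsto_incl_mul tU tux (fun n => (hB n).wu0) (fun n => (hB n).wu1)
  obtain ⟨p₂, t₂, e₂⟩ := exists_tendsto_incl_mul tV tvx (fun n => (hB n).wv0) (fun n => (hB n).wv1)
  obtain ⟨p₃, t₃, e₃⟩ := exists_tendsto_incl_mul tV t₂
    (fun n => (hB n).wv0.trans (le_max_left M C))
    (fun n => (hC _ _ (hB n)).trans (le_max_right M C))
  obtain ⟨p₄, t₄, e₄⟩ := exists_tendsto_incl_mul tV tvxxx (fun n => (hB n).wv0)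
    (fun n => (hB n).wv3)
  obtain ⟨p₅, t₅, e₅⟩ := exists_tendsto_incl_mul tU tV (fun n => (hB n).wu0) (fun n => (hB n).wv0)
  obtain ⟨p₆, t₆, e₆⟩ := exists_tendsto_incl_mul tux tV (fun n => (hB n).wu1) (fun n => (hB n).wv0)
  obtain ⟨p₇, t₇, e₇⟩ := exists_tendsto_incl_mul tU tvx (fun n => (hB n).wu0) (fun n => (hB n).wv1)
  have t₈ : Tendsto (fun n => incl (D (U n * V n))) atTop (𝓝 (p₆ + p₇)) := by
    refine (t₆.add t₇).congr fun n => ?_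
    rw [D_mul, map_add]
  refine ⟨-(3 : ℝ) • p₁ - (6 : ℝ) • p₃ - γ • p₄ + ν • uxx, (6 : ℝ) • p₂ + γ • vxxx + (p₆ + p₇),
    ux, uxx, vx, vxxx, p₆ + p₇, ?_, ?_, wux, wuxx, wvx, wvxxx, ?_, ?_, ?_⟩
  · refine ((((t₁.const_smul (-(3 : ℝ))).sub (t₃.const_smul (6 : ℝ))).sub
      (t₄.const_smul γ)).add (tuxx.const_smul ν)).congr fun n => ?_
    simp only [fieldU, map_add, map_sub, map_smul]
  · refine (((t₂.const_smul (6 : ℝ)).add (tvxxx.const_smul γ)).add t₈).congr fun n => ?_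
    simp only [fieldV, map_add, map_smul]
  · exact (isWeakDeriv_of_tendsto (fun n => isWeakDeriv_incl 1 (U n * V n)) t₅ t₈).congr e₅
      (.of_forall fun _ => rfl)
  · filter_upwards [e₁, e₂, e₃, e₄, Lp.coeFn_smul (-(3 : ℝ)) p₁, Lp.coeFn_smul (6 : ℝ) p₃,
      Lp.coeFn_smul γ p₄, Lp.coeFn_smul ν uxx, Lp.coeFn_sub (-(3 : ℝ) • p₁) ((6 : ℝ) • p₃),
      Lp.coeFn_sub (-(3 : ℝ) • p₁ - (6 : ℝ) • p₃) (γ • p₄),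
      Lp.coeFn_add (-(3 : ℝ) • p₁ - (6 : ℝ) • p₃ - γ • p₄) (ν • uxx)]
      with x h1 h2 h3 h4 a1 a2 a3 a4 b1 b2 b3
    rw [b3, Pi.add_apply, b2, Pi.sub_apply, b1, Pi.sub_apply, a1, a2, a3, a4]
    simp only [Pi.smul_apply, smul_eq_mul, h1, h2, h3, h4]
    ring
  · filter_upwards [e₂, Lp.coeFn_smul (6 : ℝ) p₂, Lp.coeFn_smul γ vxxx,
      Lp.coeFn_add ((6 : ℝ) • p₂) (γ • vxxx),
      Lp.coeFn_add ((6 : ℝ) • p₂ + γ • vxxx) (p₆ + p₇)] with x h2 a1 a2 b1 b2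
    rw [b2, Pi.add_apply, b1, Pi.add_apply, a1, a2]
    simp only [Pi.smul_apply, smul_eq_mul, h2]
    ring

end TrigPoly

/-! ### Existence -/

/-- A pointwise limit of curves whose derivatives are uniformly Cauchy is differentiable. -/
lemma hasDerivWithinAt_of_cauchy {E : Type*} [NormedAddCommGroup E] [NormedSpace ℝ E]
    {y y' : ℕ → ℝ → E} {Y : ℝ → E} {g : E} {s : Set ℝ} (hs : Convex ℝ s)
    (hd : ∀ n, ∀ t ∈ s, HasDerivWithinAt (y n) (y' n t) s t)
    (hc : ∀ ε > 0, ∃ N₀, ∀ n ≥ N₀, ∀ m ≥ N₀, ∀ t ∈ s, ‖y' n t - y' m t‖ ≤ ε)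
    (hy : ∀ t ∈ s, Tendsto (fun n => y n t) atTop (𝓝 (Y t))) {t : ℝ} (ht : t ∈ s)
    (hg : Tendsto (fun n => y' n t) atTop (𝓝 g)) : HasDerivWithinAt Y g s t := by
  rw [hasDerivWithinAt_iff_isLittleO, Asymptotics.isLittleO_iff]
  intro c hc0
  obtain ⟨N, hN⟩ := hc (c / 3) (by positivity)
  have hlip : ∀ τ ∈ s, ‖(y N τ - Y τ) - (y N t - Y t)‖ ≤ c / 3 * ‖τ - t‖ := by
    intro τ hτ
    have l := (((tendsto_const_nhds (x := y N τ)).sub (hy τ hτ)).sub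
      ((tendsto_const_nhds (x := y N t)).sub (hy t ht))).norm
    refine le_of_tendsto l (eventually_atTop.2 ⟨N, fun m hm => ?_⟩)
    exact hs.norm_image_sub_le_of_norm_hasDerivWithin_le (f := fun x => y N x - y m x)
      (fun x hx => (hd N x hx).sub (hd m x hx)) (fun x hx => hN N le_rfl m hm x hx) ht hτ
  have hder : ‖y' N t - g‖ ≤ c / 3 :=
    le_of_tendsto ((tendsto_const_nhds (x := y' N t)).sub hg).norm
      (eventually_atTop.2 ⟨N, fun m hm => hN N le_rfl m hm t ht⟩)
  have h1 := hd N t ht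
  rw [hasDerivWithinAt_iff_isLittleO, Asymptotics.isLittleO_iff] at h1
  filter_upwards [h1 (by positivity : 0 < c / 3), self_mem_nhdsWithin] with τ hτ hτs
  -- Three errors of size `c / 3`: differentiability of a fixed approximant, the Lipschitz constant
  -- of its difference to the limit, and the difference of the derivatives at `t`.
  have e : Y τ - Y t - (τ - t) • g = (y N τ - y N t - (τ - t) • y' N t) -
      ((y N τ - Y τ) - (y N t - Y t)) + (τ - t) • (y' N t - g) := by
    rw [smul_sub]; abel
  rw [e]
  have h2 := hlip τ hτs
  have h3 : ‖(τ - t) • (y' N t - g)‖ ≤ c / 3 * ‖τ - t‖ := by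
    rw [norm_smul, mul_comm]; gcongr
  have h4 := norm_add_le ((y N τ - y N t - (τ - t) • y' N t) -
      ((y N τ - Y τ) - (y N t - Y t))) ((τ - t) • (y' N t - g))
  have h5 := norm_sub_le (y N τ - y N t - (τ - t) • y' N t) ((y N τ - Y τ) - (y N t - Y t))
  linarith

namespace TrigPoly

lemma norm_iterate_D_le_emb {j s : ℕ} (hj : j ≤ s) (f : TrigPoly) : ‖D^[j] f‖ ≤ ‖emb s f‖ :=
  (norm_le_norm_incl _).trans (norm_incl_iterate_D_le hj f)

lemma exists_field_sub_le_emb (ν γ M : ℝ) :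
    ∃ C : ℝ, 0 < C ∧ ∀ u₁ v₁ u₂ v₂ : TrigPoly, IsBdd M u₁ v₁ → IsBdd M u₂ v₂ →
      ‖fieldU ν γ u₁ v₁ - fieldU ν γ u₂ v₂‖ ≤ C * (‖emb 3 (u₁ - u₂)‖ + ‖emb 4 (v₁ - v₂)‖) ∧
      ‖fieldV γ u₁ v₁ - fieldV γ u₂ v₂‖ ≤ C * (‖emb 3 (u₁ - u₂)‖ + ‖emb 4 (v₁ - v₂)‖) := by
  obtain ⟨C, hC, h⟩ := exists_field_sub_le ν γ M
  refine ⟨3 * C, by positivity, fun u₁ v₁ u₂ v₂ h₁ h₂ => ?_⟩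
  have key : C * (‖u₁ - u₂‖ + ‖D (u₁ - u₂)‖ + ‖D (D (u₁ - u₂))‖ + ‖v₁ - v₂‖ + ‖D (v₁ - v₂)‖ +
      ‖D (D (D (v₁ - v₂)))‖) ≤ 3 * C * (‖emb 3 (u₁ - u₂)‖ + ‖emb 4 (v₁ - v₂)‖) := by
    have a0 : ‖u₁ - u₂‖ ≤ _ := norm_iterate_D_le_emb (j := 0) (s := 3) (by norm_num) _
    have a1 : ‖D (u₁ - u₂)‖ ≤ _ := norm_iterate_D_le_emb (j := 1) (s := 3) (by norm_num) _
    have a2 : ‖D (D (u₁ - u₂))‖ ≤ _ := norm_iterate_D_le_emb (j := 2) (s := 3) (by norm_num) _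
    have b0 : ‖v₁ - v₂‖ ≤ _ := norm_iterate_D_le_emb (j := 0) (s := 4) (by norm_num) _
    have b1 : ‖D (v₁ - v₂)‖ ≤ _ := norm_iterate_D_le_emb (j := 1) (s := 4) (by norm_num) _
    have b3 : ‖D (D (D (v₁ - v₂)))‖ ≤ _ :=
      norm_iterate_D_le_emb (j := 3) (s := 4) (by norm_num) _
    rw [mul_comm 3 C, mul_assoc]
    refine mul_le_mul_of_nonneg_left ?_ hC.le
    linarith
  exact ⟨(h u₁ v₁ u₂ v₂ h₁ h₂).1.trans key, (h u₁ v₁ u₂ v₂ h₁ h₂).2.trans key⟩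

/-- One bounded derivative of the field gives the factor `N`. For `v` the third-order term drops
out, since `v` is already truncated. -/
lemma exists_field_sub_cut_le (ν γ M : ℝ) :
    ∃ C : ℝ, 0 < C ∧ ∀ (N : ℕ) (u v : TrigPoly), IsBdd M u v → cut N v = v →
      N * ‖fieldU ν γ u v - cut N (fieldU ν γ u v)‖ ≤ C ∧
      N * ‖fieldV γ u v - cut N (fieldV γ u v)‖ ≤ C := by
  obtain ⟨C, hC, h⟩ := exists_field_le ν γ M
  refine ⟨C, hC, fun N u v hb hv => ⟨?_, ?_⟩⟩
  · exact (norm_sub_cut_le_D N _).trans (h u v hb).2.1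
  · have e : fieldV γ u v - cut N (fieldV γ u v) = nonlinV u v - cut N (nonlinV u v) := by
      rw [fieldV_eq, map_add, map_smul, cut_D, cut_D, cut_D, hv]
      abel
    rw [e]
    exact (norm_sub_cut_le_D N _).trans (h u v hb).2.2.2.2.1

lemma norm_cut_sub_cut_le_of_le {C : ℝ} {N K : ℕ} (hK : 0 < K) (hN : K ≤ N) {f : TrigPoly}
    (h : N * ‖f - cut N f‖ ≤ C) : ‖f - cut N f‖ ≤ C / K := by
  have hK' : (0 : ℝ) < K := by exact_mod_cast hK
  rw [le_div_iff₀ hK', mul_comm]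
  refine le_trans ?_ h
  gcongr

/-- The embedding in `Hˢ` is not continuous for the `L²` norm, but it is on the finite-dimensional
space of modes. -/
lemma continuousOn_emb {s N : ℕ} {u : ℝ → TrigPoly} {S : Set ℝ} (hu : ContinuousOn u S)
    (hcut : ∀ t ∈ S, cut N (u t) = u t) : ContinuousOn (fun t => emb s (u t)) S := by
  have h1 : Continuous fun f : modes N => emb s f :=
    LinearMap.continuous_of_finiteDimensional ((emb s) ∘ₗ (modes N).subtype)
  have h2 : ContinuousOn (fun t => emb s (cutModes N (u t) : TrigPoly)) S :=
    h1.comp_continuousOn ((cutModes N).continuous.comp_continuousOn hu)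
  refine h2.congr fun t ht => ?_
  simp only [coe_cutModes, hcut t ht]

/-- The inclusion in `L²` as a bounded operator. -/
def inclL : TrigPoly →L[ℝ] L2 := incl.mkContinuous (√(2 * π)) fun f => (norm_incl f).le

lemma norm_incl_le (f : TrigPoly) : ‖incl f‖ ≤ 4 * ‖f‖ := by
  rw [norm_incl]
  gcongr
  rw [Real.sqrt_le_left (by norm_num)]
  linarith [Real.pi_lt_four]

/-! ### The limit of the Galerkin approximations. -/

section

variable {ν γ M T : ℝ} {U V : ℕ → ℝ → TrigPoly}

/-- Convergence in `H³ × H⁴` makes the fields uniformly Cauchy, and truncating them costs `O(1/N)`;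
so the time derivatives are uniformly Cauchy in `L²`. -/
lemma norm_cut_field_sub_le (hG : ∀ N, IsGalerkin ν γ T M N (U N) (V N))
    (hc : ∀ ε > 0, ∃ N₀, ∀ N ≥ N₀, ∀ N' ≥ N₀, ∀ t ∈ Icc 0 T,
      IsSmall ε (U N t - U N' t) (V N t - V N' t)) {ε : ℝ} (hε : 0 < ε) :
    ∃ N₀, ∀ N ≥ N₀, ∀ N' ≥ N₀, ∀ t ∈ Icc 0 T,
      ‖cut N (fieldU ν γ (U N t) (V N t)) - cut N' (fieldU ν γ (U N' t) (V N' t))‖ ≤ ε ∧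
      ‖cut N (fieldV γ (U N t) (V N t)) - cut N' (fieldV γ (U N' t) (V N' t))‖ ≤ ε := by
  obtain ⟨C₁, hC₁, h₁⟩ := exists_field_sub_le_emb ν γ M
  obtain ⟨C₂, hC₂, h₂⟩ := exists_field_sub_cut_le ν γ M
  obtain ⟨N₁, hN₁⟩ := hc (ε / (24 * C₁)) (by positivity)
  obtain ⟨K, hK⟩ := exists_nat_gt (3 * C₂ / ε)
  have hK0 : (0 : ℝ) < K := lt_trans (by positivity) hK
  have hKε : C₂ / K ≤ ε / 3 := by
    rw [div_lt_iff₀ hε] at hK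
    rw [div_le_iff₀ hK0]
    linarith
  refine ⟨max N₁ K, fun N hN N' hN' t ht => ?_⟩
  have hs := hN₁ N (le_of_max_le_left hN) N' (le_of_max_le_left hN') t ht
  have hu := norm_emb_le 3 (f := U N t - U N' t) hs.f0 hs.f3
  have hv := norm_emb_le 4 (f := V N t - V N' t) hs.g0 hs.g4
  have hd : C₁ * (‖emb 3 (U N t - U N' t)‖ + ‖emb 4 (V N t - V N' t)‖) ≤ ε / 3 := by
    refine (mul_le_mul_of_nonneg_left (add_le_add hu hv) hC₁.le).trans_eq ?_
    field_simp
    norm_num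
  have f₁ := h₁ _ _ _ _ ((hG N).isBdd t ht) ((hG N').isBdd t ht)
  have f₂ := h₂ N _ _ ((hG N).isBdd t ht) ((hG N).cut_v t ht)
  have f₃ := h₂ N' _ _ ((hG N').isBdd t ht) ((hG N').cut_v t ht)
  have hK' : 0 < K := by exact_mod_cast hK0
  have key : ∀ a b : TrigPoly, ‖a - b‖ ≤ ε / 3 → ‖a - cut N a‖ ≤ ε / 3 → ‖b - cut N' b‖ ≤ ε / 3 →
      ‖cut N a - cut N' b‖ ≤ ε := by
    intro a b p q r
    have e : cut N a - cut N' b = (a - b) - (a - cut N a) + (b - cut N' b) := by abel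
    rw [e]
    have := norm_add_le ((a - b) - (a - cut N a)) (b - cut N' b)
    have := norm_sub_le (a - b) (a - cut N a)
    linarith
  exact ⟨key _ _ (f₁.1.trans hd)
      ((norm_cut_sub_cut_le_of_le hK' (le_of_max_le_right hN) f₂.1).trans hKε)
      ((norm_cut_sub_cut_le_of_le hK' (le_of_max_le_right hN') f₃.1).trans hKε),
    key _ _ (f₁.2.trans hd)
      ((norm_cut_sub_cut_le_of_le hK' (le_of_max_le_right hN) f₂.2).trans hKε)
      ((norm_cut_sub_cut_le_of_le hK' (le_of_max_le_right hN') f₃.2).trans hKε)⟩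

lemma tendsto_incl_cut {C : ℝ} {f : ℕ → TrigPoly} {a : L2}
    (h : ∀ N : ℕ, N * ‖f N - cut N (f N)‖ ≤ C)
    (hf : Tendsto (fun N => incl (f N)) atTop (𝓝 a)) :
    Tendsto (fun N => incl (cut N (f N))) atTop (𝓝 a) := by
  have h0 : Tendsto (fun N => incl (f N - cut N (f N))) atTop (𝓝 0) := by
    rw [tendsto_zero_iff_norm_tendsto_zero]
    have l : Tendsto (fun N : ℕ => 4 * (C / N)) atTop (𝓝 0) := by
      have := (tendsto_const_div_atTop_nhds_zero_nat C).const_mul 4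
      rwa [mul_zero] at this
    refine squeeze_zero' (.of_forall fun _ => norm_nonneg _) ?_ l
    filter_upwards [eventually_gt_atTop 0] with N hN
    refine (norm_incl_le _).trans ?_
    have := norm_cut_sub_cut_le_of_le hN le_rfl (h N)
    linarith
  have := hf.sub h0
  rw [sub_zero] at this
  refine this.congr fun N => ?_
  rw [map_sub]; abel

/-- Convergent Galerkin approximations converge to a solution. -/
lemma exists_isSolution_of_isGalerkin (hT : 0 < T)
    (hG : ∀ N, IsGalerkin ν γ T M N (U N) (V N))
    (hc : ∀ ε > 0, ∃ N₀, ∀ N ≥ N₀, ∀ N' ≥ N₀, ∀ t ∈ Icc 0 T,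
      IsSmall ε (U N t - U N' t) (V N t - V N' t)) {u₀ : Sobolev 3} {v₀ : Sobolev 4}
    (hu₀ : Tendsto (fun N => emb 3 (U N 0)) atTop (𝓝 u₀))
    (hv₀ : Tendsto (fun N => emb 4 (V N 0)) atTop (𝓝 v₀)) :
    ∃ u v, IsSolution ν γ u₀ v₀ T u v := by
  have cu : UniformCauchySeqOn (fun N t => emb 3 (U N t)) atTop (Icc 0 T) := by
    rw [Metric.uniformCauchySeqOn_iff]
    intro ε hε
    -- The bound `norm_emb_le` loses a factor 4; dividing by 5 leaves the strict inequality.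
    obtain ⟨N₀, h⟩ := hc (ε / 5) (by positivity)
    refine ⟨N₀, fun m hm n hn t ht => ?_⟩
    have hs := h m hm n hn t ht
    rw [dist_eq_norm, ← map_sub]
    have := norm_emb_le 3 hs.f0 hs.f3
    linarith
  have cv : UniformCauchySeqOn (fun N t => emb 4 (V N t)) atTop (Icc 0 T) := by
    rw [Metric.uniformCauchySeqOn_iff]
    intro ε hε
    obtain ⟨N₀, h⟩ := hc (ε / 5) (by positivity)
    refine ⟨N₀, fun m hm n hn t ht => ?_⟩
    have hs := h m hm n hn t ht
    rw [dist_eq_norm, ← map_sub]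
    have := norm_emb_le 4 hs.g0 hs.g4
    linarith
  have lu : ∀ t, ∃ a, t ∈ Icc 0 T → Tendsto (fun N => emb 3 (U N t)) atTop (𝓝 a) := fun t => by
    by_cases ht : t ∈ Icc 0 T
    · obtain ⟨a, ha⟩ := cauchySeq_tendsto_of_complete (cu.cauchySeq ht)
      exact ⟨a, fun _ => ha⟩
    · exact ⟨0, fun h => absurd h ht⟩
  have lv : ∀ t, ∃ a, t ∈ Icc 0 T → Tendsto (fun N => emb 4 (V N t)) atTop (𝓝 a) := fun t => by
    by_cases ht : t ∈ Icc 0 T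
    · obtain ⟨a, ha⟩ := cauchySeq_tendsto_of_complete (cv.cauchySeq ht)
      exact ⟨a, fun _ => ha⟩
    · exact ⟨0, fun h => absurd h ht⟩
  choose u hu using lu
  choose v hv using lv
  have hsub : Ico 0 T ⊆ Icc 0 T := Ico_subset_Icc_self
  refine ⟨u, v, ?_, ?_, ?_, ?_, fun t ht => ?_⟩
  · refine ContinuousOn.mono ?_ hsub
    refine (cu.tendstoUniformlyOn_of_tendsto hu).continuousOn (Frequently.of_forall fun N => ?_)
    exact continuousOn_emb (fun t ht => ((hG N).deriv_u t ht).continuousWithinAt) (hG N).cut_u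
  · refine ContinuousOn.mono ?_ hsub
    refine (cv.tendstoUniformlyOn_of_tendsto hv).continuousOn (Frequently.of_forall fun N => ?_)
    exact continuousOn_emb (fun t ht => ((hG N).deriv_v t ht).continuousWithinAt) (hG N).cut_v
  · exact tendsto_nhds_unique (hu 0 (left_mem_Icc.2 hT.le)) hu₀
  · exact tendsto_nhds_unique (hv 0 (left_mem_Icc.2 hT.le)) hv₀
  have ht' := hsub ht
  obtain ⟨ut, vt, ux, uxx, vx, vxxx, uvx, tu, tv, hrest⟩ := exists_tendsto_field ν γ M (hu t ht')
    (hv t ht') fun N => (hG N).isBdd t ht'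
  obtain ⟨C, -, hC⟩ := exists_field_sub_cut_le ν γ M
  refine ⟨ut, vt, ux, uxx, vx, vxxx, uvx, ?_, ?_, hrest⟩
  · refine (hasDerivWithinAt_of_cauchy (y := fun N τ => incl (U N τ))
      (y' := fun N τ => incl (cut N (fieldU ν γ (U N τ) (V N τ)))) (convex_Icc 0 T)
      (fun N τ hτ => inclL.hasFDerivAt.comp_hasDerivWithinAt τ ((hG N).deriv_u τ hτ)) ?_
      (fun τ hτ => tendsto_toL2 (hu τ hτ)) ht'
      (tendsto_incl_cut (fun N => (hC N _ _ ((hG N).isBdd t ht') ((hG N).cut_v t ht')).1)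
        tu)).mono hsub
    intro ε hε
    obtain ⟨N₀, h⟩ := norm_cut_field_sub_le hG hc (by positivity : 0 < ε / 4)
    refine ⟨N₀, fun n hn m hm τ hτ => ?_⟩
    rw [← map_sub]
    have := (h n hn m hm τ hτ).1
    exact (norm_incl_le _).trans (by linarith)
  · refine (hasDerivWithinAt_of_cauchy (y := fun N τ => incl (V N τ))
      (y' := fun N τ => incl (cut N (fieldV γ (U N τ) (V N τ)))) (convex_Icc 0 T)
      (fun N τ hτ => inclL.hasFDerivAt.comp_hasDerivWithinAt τ ((hG N).deriv_v τ hτ)) ?_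
      (fun τ hτ => tendsto_toL2 (hv τ hτ)) ht'
      (tendsto_incl_cut (fun N => (hC N _ _ ((hG N).isBdd t ht') ((hG N).cut_v t ht')).2)
        tv)).mono hsub
    intro ε hε
    obtain ⟨N₀, h⟩ := norm_cut_field_sub_le hG hc (by positivity : 0 < ε / 4)
    refine ⟨N₀, fun n hn m hm τ hτ => ?_⟩
    rw [← map_sub]
    have := (h n hn m hm τ hτ).2
    exact (norm_incl_le _).trans (by linarith)

end

lemma energy_le_emb {γ : ℝ} (hγ : 0 < γ) (u v : TrigPoly) :
    energy γ u v ≤ ‖emb 3 u‖ ^ 2 + γ * ‖emb 4 v‖ ^ 2 := by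
  have key : ∀ (s : ℕ) (f : TrigPoly), ‖f‖ ^ 2 + ‖D^[s] f‖ ^ 2 ≤ ‖emb s f‖ ^ 2 := fun s f => by
    rw [norm_emb_sq]
    exact le_mul_of_one_le_left (by positivity) (by linarith [Real.pi_gt_three])
  exact add_le_add (key 3 u) (mul_le_mul_of_nonneg_left (key 4 v) hγ.le)

lemma energy_trunc_le {γ : ℝ} (hγ : 0 < γ) (u : Sobolev 3) (v : Sobolev 4) (N : ℕ) :
    energy γ (trunc N (toL2 u)) (trunc N (toL2 v)) ≤ ‖u‖ ^ 2 + γ * ‖v‖ ^ 2 := by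
  refine (energy_le_emb hγ _ _).trans ?_
  gcongr
  · exact norm_emb_trunc_le u N
  · exact norm_emb_trunc_le v N

/-- The Galerkin data are the truncations of `u₀` and `v₀`. Truncation does not increase the `H³`
and `H⁴` norms, so a single lifespan serves all `N`, and the data converge in `H³ × H⁴`. -/
theorem exists_isSolution {ν γ : ℝ} (hν : 0 < ν) (hγ : 0 < γ) (u₀ : Sobolev 3) (v₀ : Sobolev 4) :
    ∃ T, 0 < T ∧ ∃ u v, IsSolution ν γ u₀ v₀ T u v := by
  obtain ⟨T, M, hT, hM, h⟩ := exists_isGalerkin hν hγ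
    (by positivity : 0 ≤ ‖u₀‖ ^ 2 + γ * ‖v₀‖ ^ 2)
  have h' := fun N => h N _ _ (cut_trunc N (toL2 u₀)) (cut_trunc N (toL2 v₀))
    (energy_trunc_le hγ u₀ v₀ N)
  choose U V hU hV hG using h'
  have tu : Tendsto (fun N => emb 3 (U N 0)) atTop (𝓝 u₀) := by
    simp only [hU]; exact tendsto_emb_trunc u₀
  have tv : Tendsto (fun N => emb 4 (V N 0)) atTop (𝓝 v₀) := by
    simp only [hV]; exact tendsto_emb_trunc v₀
  refine ⟨T, hT, exists_isSolution_of_isGalerkin hT hG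
    (isGalerkin_cauchy hν hγ hM hT.le hG fun ε hε => ?_) tu tv⟩
  obtain ⟨N₁, h₁⟩ := Metric.cauchySeq_iff.1 tu.cauchySeq ε hε
  obtain ⟨N₂, h₂⟩ := Metric.cauchySeq_iff.1 tv.cauchySeq ε hε
  refine ⟨max N₁ N₂, fun N hN N' hN' => ?_⟩
  have a := (h₁ N (le_of_max_le_left hN) N' (le_of_max_le_left hN')).le
  have b := (h₂ N (le_of_max_le_right hN) N' (le_of_max_le_right hN')).le
  rw [dist_eq_norm, ← map_sub] at a b
  exact ⟨(norm_le_norm_emb 3 _).1.trans a, (norm_le_norm_emb 3 _).2.trans a,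
    (norm_le_norm_emb 4 _).1.trans b, (norm_le_norm_emb 4 _).2.trans b⟩

/-! ### Uniqueness -/

/-- At most one derivative of each difference appears. For truncation errors this leaves room to
gain `1/N²`, one power more than is needed in `L²`. -/
lemma norm_nonlinV_sub_le {M : ℝ} {u₁ v₁ u₂ v₂ : TrigPoly} (h₁ : IsBdd M u₁ v₁)
    (h₂ : IsBdd M u₂ v₂) : ‖nonlinV u₁ v₁ - nonlinV u₂ v₂‖ ≤
      7 * M * (‖u₁ - u₂‖ + ‖D (u₁ - u₂)‖ + ‖v₁ - v₂‖ + ‖D (v₁ - v₂)‖) := by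
  have hM := h₁.nonneg
  obtain ⟨w, hw⟩ : ∃ w, w = u₁ - u₂ := ⟨_, rfl⟩
  obtain ⟨z, hz⟩ : ∃ z, z = v₁ - v₂ := ⟨_, rfl⟩
  have e : nonlinV u₁ v₁ - nonlinV u₂ v₂ = (6 : ℝ) • (v₁ * D z + D v₂ * z) +
      ((v₁ * D w + D v₁ * w) + (D u₂ * z + u₂ * D z)) := by
    simp only [nonlinV, hw, hz, D_mul, map_sub, Algebra.smul_def, map_ofNat]
    ring
  rw [e, ← hw, ← hz]
  have a1 := norm_mul_le_of_le h₁.wv0 (le_refl ‖D z‖)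
  have a2 := norm_mul_le_of_le h₂.wv1 (le_refl ‖z‖)
  have a3 := norm_mul_le_of_le h₁.wv0 (le_refl ‖D w‖)
  have a4 := norm_mul_le_of_le h₁.wv1 (le_refl ‖w‖)
  have a5 := norm_mul_le_of_le h₂.wu1 (le_refl ‖z‖)
  have a6 := norm_mul_le_of_le h₂.wu0 (le_refl ‖D z‖)
  have b1 : ‖(6 : ℝ) • (v₁ * D z + D v₂ * z)‖ ≤ 6 * (M * ‖D z‖ + M * ‖z‖) := by
    rw [norm_smul, Real.norm_of_nonneg (by norm_num)]
    exact mul_le_mul_of_nonneg_left ((norm_add_le _ _).trans (add_le_add a1 a2)) (by norm_num)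
  have b2 := (norm_add_le (v₁ * D w) (D v₁ * w)).trans (add_le_add a3 a4)
  have b3 := (norm_add_le (D u₂ * z) (u₂ * D z)).trans (add_le_add a5 a6)
  have b4 := (norm_add_le _ _).trans (add_le_add b2 b3)
  have b5 := (norm_add_le _ _).trans (add_le_add b1 b4)
  refine b5.trans ?_
  have := mul_nonneg hM (norm_nonneg w)
  have := mul_nonneg hM (norm_nonneg (D w))
  linarith

lemma mul_norm_sub_cut_D_le (N : ℕ) (f : TrigPoly) :
    N * ‖D (f - cut N f)‖ ≤ ‖D (D f)‖ := by
  rw [map_sub, ← cut_D]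
  exact norm_sub_cut_le_D N (D f)

lemma mul_norm_sub_cut_le (N : ℕ) (f : TrigPoly) :
    N * ‖f - cut N f‖ ≤ ‖D (f - cut N f)‖ := by
  rw [map_sub, ← cut_D]
  exact norm_sub_cut_le N f

/-- Truncating both components changes the fields by `O(1/N)` on the frequencies `|k| ≤ N`. -/
lemma exists_cut_field_sub_le (ν γ M : ℝ) :
    ∃ C : ℝ, 0 < C ∧ ∀ (N : ℕ) (u v : TrigPoly), 0 < N → IsBdd M u v →
      IsBdd M (cut N u) (cut N v) →
      ‖cut N (fieldU ν γ u v - fieldU ν γ (cut N u) (cut N v))‖ ≤ C / N ∧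
      ‖cut N (fieldV γ u v - fieldV γ (cut N u) (cut N v))‖ ≤ C / N ∧
      ‖D (cut N (fieldV γ u v - fieldV γ (cut N u) (cut N v)))‖ ≤ C / N := by
  obtain ⟨K, hK, h⟩ := exists_field_sub_le ν γ M
  refine ⟨1 + 6 * K * |M| + 28 * |M| * |M|, by positivity, fun N u v hN hb hb' => ?_⟩
  have hM := hb.nonneg
  rw [abs_of_nonneg hM]
  have hN' : (1 : ℝ) ≤ N := by exact_mod_cast hN
  have hN0 : (0 : ℝ) < N := by linarith
  have one : ∀ f : TrigPoly, ‖D f‖ ≤ M → N * ‖f - cut N f‖ ≤ M := fun f hf =>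
    (norm_sub_cut_le_D N f).trans hf
  have u0 := one u hb.u1
  have v0 := one v hb.v1
  have u1 := (mul_norm_sub_cut_D_le N u).trans hb.u2
  have v1 := (mul_norm_sub_cut_D_le N v).trans hb.v2
  have u2 : N * ‖D (D (u - cut N u))‖ ≤ M := by
    rw [map_sub, ← cut_D]; exact (mul_norm_sub_cut_D_le N (D u)).trans hb.u3
  have v2 : N * ‖D (D (v - cut N v))‖ ≤ M := by
    rw [map_sub, ← cut_D]; exact (mul_norm_sub_cut_D_le N (D v)).trans hb.v3
  have v3 : N * ‖D (D (D (v - cut N v)))‖ ≤ M := by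
    rw [map_sub, map_sub, ← cut_D, ← cut_D]
    exact (mul_norm_sub_cut_D_le N (D (D v))).trans hb.v4
  have two : ∀ f : TrigPoly, N * ‖D (D (f - cut N f))‖ ≤ M →
      N * (N * ‖D (f - cut N f)‖) ≤ M ∧ N * (N * ‖f - cut N f‖) ≤ M := fun f hf => by
    have a : N * ‖D (f - cut N f)‖ ≤ ‖D (D (f - cut N f))‖ := by
      rw [map_sub, ← cut_D]; exact mul_norm_sub_cut_le N (D f)
    have b := mul_norm_sub_cut_le N f
    have c : N * ‖f - cut N f‖ ≤ N * ‖D (f - cut N f)‖ := by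
      refine b.trans (le_mul_of_one_le_left (norm_nonneg _) hN')
    exact ⟨(mul_le_mul_of_nonneg_left a hN0.le).trans hf,
      (mul_le_mul_of_nonneg_left (c.trans a) hN0.le).trans hf⟩
  obtain ⟨uu1, uu0⟩ := two u u2
  obtain ⟨vv1, vv0⟩ := two v v2
  have e : cut N (fieldV γ u v - fieldV γ (cut N u) (cut N v)) =
      cut N (nonlinV u v - nonlinV (cut N u) (cut N v)) := by
    simp only [fieldV_eq, map_add, map_sub, map_smul, cut_D, cut_cut]
    abel
  have n1 := norm_nonlinV_sub_le hb hb'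
  -- The errors and their first derivatives are `O(1/N²)`; Bernstein's inequality then spends one
  -- factor `N` on the `H¹` bound.
  have n2 : N * (N * ‖nonlinV u v - nonlinV (cut N u) (cut N v)‖) ≤ 28 * M * M := by
    refine (mul_le_mul_of_nonneg_left (mul_le_mul_of_nonneg_left n1 hN0.le) hN0.le).trans ?_
    have := mul_le_mul_of_nonneg_left (add_le_add (add_le_add (add_le_add uu0 uu1) vv0) vv1)
      (by positivity : 0 ≤ 7 * M)
    linarith
  rw [e]
  refine ⟨?_, ?_, ?_⟩
  · rw [le_div_iff₀ hN0, mul_comm]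
    refine (mul_le_mul_of_nonneg_left ((norm_cut_le N _).trans (h _ _ _ _ hb hb').1)
      hN0.le).trans ?_
    have := mul_le_mul_of_nonneg_left (add_le_add (add_le_add (add_le_add (add_le_add
      (add_le_add u0 u1) u2) v0) v1) v3) hK.le
    have := mul_nonneg hM hM
    linarith
  · rw [le_div_iff₀ hN0, mul_comm]
    refine (mul_le_mul_of_nonneg_left (norm_cut_le N _) hN0.le).trans ?_
    have h3 := le_mul_of_one_le_left
      (by positivity : 0 ≤ N * ‖nonlinV u v - nonlinV (cut N u) (cut N v)‖) hN'
    have := mul_nonneg hK.le hM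
    linarith
  · rw [le_div_iff₀ hN0, mul_comm]
    refine (mul_le_mul_of_nonneg_left (norm_D_cut_le N _) hN0.le).trans ?_
    have := mul_nonneg hK.le hM
    linarith

/-- The preceding estimate is applied to the truncations at `n ≥ N`, uniformly in `n`, and passes to
the limit `n → ∞`. -/
lemma exists_trunc_limit_sub_le (ν γ M : ℝ) :
    ∃ C : ℝ, 0 < C ∧ ∀ (N : ℕ) (a b ut vt : L2), 0 < N →
      (∀ n, IsBdd M (trunc n a) (trunc n b)) →
      Tendsto (fun n => incl (fieldU ν γ (trunc n a) (trunc n b))) atTop (𝓝 ut) →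
      Tendsto (fun n => incl (fieldV γ (trunc n a) (trunc n b))) atTop (𝓝 vt) →
      ‖trunc N ut - cut N (fieldU ν γ (trunc N a) (trunc N b))‖ ≤ C / N ∧
      ‖trunc N vt - cut N (fieldV γ (trunc N a) (trunc N b))‖ ≤ C / N ∧
      ‖D (trunc N vt - cut N (fieldV γ (trunc N a) (trunc N b)))‖ ≤ C / N := by
  obtain ⟨C, hC, h⟩ := exists_cut_field_sub_le ν γ M
  refine ⟨C, hC, fun N a b ut vt hN hb hu hv => ?_⟩
  have key : ∀ n ≥ N, _ := fun n hn => h N (trunc n a) (trunc n b) hN (hb n) (by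
    rw [cut_trunc_of_le hn, cut_trunc_of_le hn]; exact hb N)
  have lu : Tendsto (fun n => cut N (fieldU ν γ (trunc n a) (trunc n b) -
      fieldU ν γ (trunc N a) (trunc N b))) atTop
      (𝓝 (trunc N ut - cut N (fieldU ν γ (trunc N a) (trunc N b)))) := by
    refine ((((trunc N).continuous.tendsto ut).comp hu).sub_const _).congr fun n => ?_
    simp only [Function.comp_apply, trunc_incl, map_sub]
  have lv : Tendsto (fun n => cut N (fieldV γ (trunc n a) (trunc n b) -
      fieldV γ (trunc N a) (trunc N b))) atTop
      (𝓝 (trunc N vt - cut N (fieldV γ (trunc N a) (trunc N b)))) := by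
    refine ((((trunc N).continuous.tendsto vt).comp hv).sub_const _).congr fun n => ?_
    simp only [Function.comp_apply, trunc_incl, map_sub]
  have lDv := ((cutD N).continuous.tendsto _).comp lv
  simp only [Function.comp_def, cutD_apply, cut_cut, map_sub, cut_trunc] at lDv
  refine ⟨le_of_tendsto lu.norm ?_, le_of_tendsto lv.norm ?_, ?_⟩
  · filter_upwards [eventually_ge_atTop N] with n hn
    have := (key n hn).1
    rwa [cut_trunc_of_le hn, cut_trunc_of_le hn] at this
  · filter_upwards [eventually_ge_atTop N] with n hn
    have := (key n hn).2.1
    rwa [cut_trunc_of_le hn, cut_trunc_of_le hn] at this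
  · rw [map_sub]
    refine le_of_tendsto lDv.norm ?_
    filter_upwards [eventually_ge_atTop N] with n hn
    have := (key n hn).2.2
    rwa [cut_trunc_of_le hn, cut_trunc_of_le hn, map_sub, map_sub] at this

/-- Truncations of solutions solve the Galerkin system up to `O(1/N)`. -/
lemma exists_isApprox_of_isSolution (ν γ M : ℝ) :
    ∃ C : ℝ, 0 < C ∧ ∀ (T S : ℝ) (u₀ : Sobolev 3) (v₀ : Sobolev 4) (u : ℝ → Sobolev 3)
      (v : ℝ → Sobolev 4), S < T → IsSolution ν γ u₀ v₀ T u v →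
      (∀ t ∈ Icc 0 S, ∀ n, IsBdd M (trunc n (toL2 (u t))) (trunc n (toL2 (v t)))) →
      ∀ N : ℕ, 0 < N → IsApprox ν γ S M (C / N) N (fun t => trunc N (toL2 (u t)))
        (fun t => trunc N (toL2 (v t))) := by
  obtain ⟨C, hC, h⟩ := exists_trunc_limit_sub_le ν γ M
  refine ⟨C, hC, fun T S u₀ v₀ u v hST hsol hb N hN =>
    ⟨fun t _ => cut_trunc _ _, fun t _ => cut_trunc _ _, fun t ht => hb t ht N, fun t ht => ?_⟩⟩
  have hsub : Icc 0 S ⊆ Ico 0 T := fun x hx => ⟨hx.1, hx.2.trans_lt hST⟩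
  obtain ⟨ut, vt, ux, uxx, vx, vxxx, uvx, du, dv, w1, w2, w3, w4, w5, eu, ev⟩ :=
    hsol.equation t (hsub ht)
  obtain ⟨ut', vt', ux', uxx', vx', vxxx', uvx', tu, tv, w1', w2', w3', w4', w5', eu', ev'⟩ :=
    exists_tendsto_field ν γ M (tendsto_emb_trunc (u t)) (tendsto_emb_trunc (v t)) (hb t ht)
  obtain rfl := isWeakDeriv_unique w1 w1'
  obtain rfl := isWeakDeriv_unique w2 w2'
  obtain rfl := isWeakDeriv_unique w3 w3'
  obtain rfl := isWeakDeriv_unique w4 w4'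
  obtain rfl := isWeakDeriv_unique w5 w5'
  -- Weak derivatives are unique, so the time derivative of the solution and the limit of the
  -- truncated fields satisfy the same pointwise equation.
  have hut : ut' = ut := by
    refine Lp.ext ?_
    filter_upwards [eu, eu'] with x hx hx'
    linarith
  have hvt : vt' = vt := by
    refine Lp.ext ?_
    filter_upwards [ev, ev'] with x hx hx'
    linarith
  rw [hut] at tu
  rw [hvt] at tv
  obtain ⟨n1, n2, n3⟩ := h N _ _ ut vt hN (hb t ht) tu tv
  refine ⟨_, _, ?_, ?_, n1, n2, n3, ?_, ?_⟩
  · rw [map_sub, cut_trunc, cut_cut]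
  · rw [map_sub, cut_trunc, cut_cut]
  · rw [add_sub_cancel]
    exact (trunc N).hasFDerivAt.comp_hasDerivWithinAt t (du.mono hsub)
  · rw [add_sub_cancel]
    exact (trunc N).hasFDerivAt.comp_hasDerivWithinAt t (dv.mono hsub)

/-- The truncation at `K` factors through every truncation at `N ≥ K`, so it inherits the bound for
all large `N`. -/
lemma eq_of_norm_trunc_sq_le {a b : L2} {C : ℝ}
    (h : ∀ N : ℕ, 0 < N → ‖trunc N a - trunc N b‖ ^ 2 ≤ C / N ^ 2) : a = b := by
  refine eq_of_trunc_eq fun K => ?_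
  rw [← sub_eq_zero, ← norm_eq_zero, ← sq_eq_zero_iff]
  have l : Tendsto (fun N : ℕ => C / (N : ℝ) ^ 2) atTop (𝓝 0) :=
    tendsto_const_nhds.div_atTop
      ((tendsto_pow_atTop two_ne_zero).comp tendsto_natCast_atTop_atTop)
  refine le_antisymm (ge_of_tendsto l ?_) (sq_nonneg _)
  filter_upwards [eventually_ge_atTop K, eventually_gt_atTop 0] with N hN hN0
  refine le_trans ?_ (h N hN0)
  rw [← cut_trunc_of_le hN, ← cut_trunc_of_le hN, ← map_sub]
  exact pow_le_pow_left₀ (norm_nonneg _) (norm_cut_le K _) 2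

/-- Continuity on the compact interval `[0, S]`; this is where `S < T` is used. -/
lemma exists_norm_sq_le_of_isSolution {ν γ T S : ℝ} {u₀ : Sobolev 3} {v₀ : Sobolev 4}
    {u : ℝ → Sobolev 3} {v : ℝ → Sobolev 4} (hST : S < T)
    (h : IsSolution ν γ u₀ v₀ T u v) :
    ∃ R, ∀ t ∈ Icc 0 S, ‖u t‖ ^ 2 + γ * ‖v t‖ ^ 2 ≤ R := by
  have hsub : Icc 0 S ⊆ Ico 0 T := fun x hx => ⟨hx.1, hx.2.trans_lt hST⟩
  have hc : ContinuousOn (fun t => ‖u t‖ ^ 2 + γ * ‖v t‖ ^ 2) (Icc 0 S) :=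
    ((h.continuousOn_u.mono hsub).norm.pow 2).add
      (((h.continuousOn_v.mono hsub).norm.pow 2).const_mul γ)
  obtain ⟨R, hR⟩ := isCompact_Icc.bddAbove_image hc
  exact ⟨R, fun t ht => hR (mem_image_of_mem _ ht)⟩

/-- On `[0, t]` both solutions are bounded in `H³ × H⁴`, and their truncations have equal data and
residuals `C / N`. Stability bounds the `L² × H¹` distance, squared, by a multiple of `1 / N²`;
since truncation is compatible in `N`, the solutions agree at `t`. -/
theorem isSolution_unique {ν γ T₁ T₂ : ℝ} (hν : 0 < ν) (hγ : 0 < γ) {u₀ : Sobolev 3}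
    {v₀ : Sobolev 4} {u₁ u₂ : ℝ → Sobolev 3} {v₁ v₂ : ℝ → Sobolev 4}
    (h₁ : IsSolution ν γ u₀ v₀ T₁ u₁ v₁) (h₂ : IsSolution ν γ u₀ v₀ T₂ u₂ v₂) {t : ℝ}
    (ht0 : 0 ≤ t) (ht₁ : t < T₁) (ht₂ : t < T₂) : u₁ t = u₂ t ∧ v₁ t = v₂ t := by
  obtain ⟨R₁, hR₁⟩ := exists_norm_sq_le_of_isSolution ht₁ h₁
  obtain ⟨R₂, hR₂⟩ := exists_norm_sq_le_of_isSolution ht₂ h₂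
  obtain ⟨M, hM, hb⟩ := exists_isBdd_of_energy_le hγ (max R₁ R₂)
  obtain ⟨C, hC, happ⟩ := exists_isApprox_of_isSolution ν γ M
  obtain ⟨A, hA, hlow⟩ := exists_lowEnergy_le hν hγ hM ht0
  have key : ∀ N : ℕ, 0 < N → lowEnergy γ (trunc N (toL2 (u₁ t)) - trunc N (toL2 (u₂ t)))
      (trunc N (toL2 (v₁ t)) - trunc N (toL2 (v₂ t))) ≤ A * C ^ 2 / N ^ 2 := fun N hN => by
    have a₁ := happ T₁ t u₀ v₀ u₁ v₁ ht₁ h₁ (fun τ hτ n => hb _ _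
      ((energy_trunc_le hγ _ _ n).trans ((hR₁ τ hτ).trans (le_max_left _ _)))) N hN
    have a₂ := happ T₂ t u₀ v₀ u₂ v₂ ht₂ h₂ (fun τ hτ n => hb _ _
      ((energy_trunc_le hγ _ _ n).trans ((hR₂ τ hτ).trans (le_max_right _ _)))) N hN
    have := hlow _ N _ _ _ _ a₁ a₂ t ⟨ht0, le_rfl⟩
    simp only [h₁.initial_u, h₂.initial_u, h₁.initial_v, h₂.initial_v, sub_self] at this
    refine this.trans_eq ?_
    simp [lowEnergy, div_pow, mul_div_assoc]
  constructor
  · refine toL2_injective (eq_of_norm_trunc_sq_le fun N hN => le_trans ?_ (key N hN))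
    exact le_add_of_nonneg_right (by positivity)
  · refine toL2_injective (eq_of_norm_trunc_sq_le (C := A * C ^ 2 / γ) fun N hN => ?_)
    have h := key N hN
    rw [div_div, mul_comm γ, ← div_div, le_div_iff₀ hγ, mul_comm]
    refine le_trans ?_ h
    unfold lowEnergy
    rw [mul_add]
    have := mul_nonneg hγ.le (sq_nonneg ‖D (trunc N (toL2 (v₁ t)) - trunc N (toL2 (v₂ t)))‖)
    have := sq_nonneg ‖trunc N (toL2 (u₁ t)) - trunc N (toL2 (u₂ t))‖
    linarith

end TrigPoly

end BurgersKdV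

end

theorem theorem1 (ν γ : ℝ) (hν : 0 < ν) (hγ : 0 < γ)
    (u₀ : BurgersKdV.Sobolev 3) (v₀ : BurgersKdV.Sobolev 4)
    (hu₀ : ∫ x, BurgersKdV.toL2 u₀ x = 0) (hv₀ : ∫ x, BurgersKdV.toL2 v₀ x = 0) :
    ∃ Tmax : ℝ, 0 < Tmax ∧
      ∃ (u : ℝ → BurgersKdV.Sobolev 3) (v : ℝ → BurgersKdV.Sobolev 4),
        BurgersKdV.IsSolution ν γ u₀ v₀ Tmax u v ∧
        ∀ T : ℝ, 0 < T → T ≤ Tmax →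
          ∀ (u' : ℝ → BurgersKdV.Sobolev 3) (v' : ℝ → BurgersKdV.Sobolev 4),
            BurgersKdV.IsSolution ν γ u₀ v₀ T u' v' →
              ∀ t ∈ Ico 0 T, u' t = u t ∧ v' t = v t := by
  obtain ⟨T, hT, u, v, h⟩ := BurgersKdV.TrigPoly.exists_isSolution hν hγ u₀ v₀
  refine ⟨T, hT, u, v, h, fun S _ hST u' v' h' t ht => ?_⟩
  exact BurgersKdV.TrigPoly.isSolution_unique hν hγ h' h ht.1 ht.2 (ht.2.trans_le hST)
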